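/- **Conventions.** A link diagram $D$ in the plane is unoriented, its crossings are numbered $1,\dots,n$, and circles without crossings are allowed. It is connected if it is non-empty and connected as a subset of the plane. The $0$-smoothing of a crossing joins the two regions swept out when the upper strand is rotated counterclockwise until it meets the lower one, and the $1$-smoothing joins the two other regions. A Kauffman state $s$ of $D$ is a diagram obtained by smoothing every crossing. $r(D,s)$ is the number of $1$-smoothings in $s$, and $\mathcal K_1(D)$ is the set of Kauffman states that consist of exactly one circle. For a bigraded module $M$, let $(M[m]\{l\})^{i,j}=M^{i-m,j-l}$. Let $\mathcal A=\mathbb Z 1\oplus\mathbb Z X$ with $1$ in bidegree $(0,1)$ and $X$ in bidegree $(0,-1)$. *Lee's complex.* The bigraded module of the Khovanov complex is $\mathcal C(D)=\bigoplus_s \mathcal A^{\otimes\{\text{circles of }s\}}[r(D,s)]\{r(D,s)\}$, the sum being over all Kauffman states $s$. Its differential $d$, of bidegree $(1,0)$, is the sum over all changes of a $0$-smoothing into a $1$-smoothing at one crossing $c$ of the map that applies the multiplication $1\cdot 1=1$, $1\cdot X=X\cdot 1=X$, $X\cdot X=0$ if two circles merge, and the comultiplication $1\mapsto 1\otimes X+X\otimes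 1$, $X\mapsto X\otimes X$ if a circle splits, with sign $(-1)^e$, where $e$ is the number of $1$-smoothings at crossings with a smaller number than $c$. Lee's map $\Phi$, of bidegree $(1,4)$, is defined in the same way from the multiplication $X\otimes X\mapsto 1$, all other products $0$, and the comultiplication $X\mapsto 1\otimes 1$, $1\mapsto 0$. Let $\mathcal C'(D)$ be $\mathcal C(D)$ with the differential $d'=d+\Phi$, with its primary grading, and with the filtration in which an element has filtration at least $j$ if and only if it is a sum of homogeneous elements of secondary degree at least $j$. A bigraded module is regarded as a filtered module (graded by the primary degree) in the same way. A filtered complex $B$ with differential $d_B$ is contractible if there is a filtration-respecting map $p\colon B\to B$ of primary degree $-1$ with $p d_B+d_B p=\mathrm{id}_B$. *The diagrams $D_S$.* Start with a connected diagram $D$ and treat the crossings in the order of their numbering. If both smoothings of the crossing in the current diagram are connected, branch into these two diagrams; otherwise leave the crossing unsmoothed. This gives a binary tree whose leaves are diagrams obtained from $D$ by smoothing some of the crossings. For $S\in\mathcal K_1(D)$ let $D_S$ be the unique leaf that has $S$ among its Kauffman states. For any orientation of $D_S$, let $w(D_S)$ be the number of negative crossings minus the number of positive crossings of $D_S$.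 **Theorem.** Let $D$ be a connected link diagram. Then $\mathcal C'(D)$ is a filtered complex, and there are filtered complexes $A$ and $B$ and an isomorphism of complexes $\mathcal C'(D)\cong A\oplus B$ such that $B$ is a contractible filtered complex and $A$, as a filtered module, is isomorphic to $$\bigoplus_{S\in\mathcal K_1(D)}\mathcal A[w(D_S)]\{2w(D_S)\}[r(D,S)]\{r(D,S)\}.$$ The decomposition respects the filtration, i.e. the associated inclusion and projection maps respect the filtration. The orientations of the diagrams $D_S$ used to compute $w(D_S)$ may be chosen arbitrarily. -/

import Mathlib

/-! ### Filtered complexes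

Everything carries a primary grading (by `ℤ`, cohomological) and a decreasing filtration,
indexed by the secondary degree. -/

/-- A filtered module: a graded abelian group `⨁ i, X i` in which every `X i` carries a
decreasing filtration `F j i`; `F j i` is the set of elements of filtration at least `j`. -/
structure FilteredModule where
  X : ℤ → Type
  [group : ∀ i, AddCommGroup (X i)]
  F : ℤ → ∀ i, Submodule ℤ (X i)
  antitone : ∀ i j k, j ≤ k → F k i ≤ F j i

attribute [instance] FilteredModule.group

/-- An isomorphism of filtered modules: it preserves the primary grading, and it and its
inverse respect the filtrations. -/
structure FilteredModule.Iso (M N : FilteredModule) where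
  e : ∀ i, M.X i ≃ₗ[ℤ] N.X i
  map_F : ∀ j i, (M.F j i).map (e i).toLinearMap = N.F j i

/-- A filtered module with an endomorphism of primary degree `1`. It is a filtered complex if
it satisfies `IsFilteredComplex`. -/
structure FilteredDiffModule extends FilteredModule where
  d : ∀ i, X i →ₗ[ℤ] X (i + 1)

namespace FilteredDiffModule

/-- `d` is a differential and respects the filtration. -/
def IsFilteredComplex (M : FilteredDiffModule) : Prop :=
  (∀ i x, M.d (i + 1) (M.d i x) = 0) ∧ ∀ j i, ∀ x ∈ M.F j i, M.d i x ∈ M.F j (i + 1)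

/-- An isomorphism of filtered complexes: it commutes with `d`, and it and its inverse respect
the primary grading and the filtration. -/
structure Iso (M N : FilteredDiffModule) extends
    FilteredModule.Iso M.toFilteredModule N.toFilteredModule where
  comm : ∀ i x, e (i + 1) (M.d i x) = N.d i (e i x)

/-- The direct sum `A ⊕ B`. -/
def directSum (A B : FilteredDiffModule) : FilteredDiffModule where
  X i := A.X i × B.X i
  F j i := (A.F j i).prod (B.F j i)
  antitone i j k h := Submodule.prod_mono (A.antitone i j k h) (B.antitone i j k h)
  d i := (A.d i).prodMap (B.d i)

/-- Contractibility as a filtered complex: a filtration-respecting `p` of primary degree `-1`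
with `d ∘ p + p ∘ d = id`. -/
def Contractible (M : FilteredDiffModule) : Prop :=
  ∃ p : ∀ i, M.X (i + 1) →ₗ[ℤ] M.X i,
    (∀ j i, ∀ x ∈ M.F j (i + 1), p i x ∈ M.F j i) ∧
    ∀ i x, M.d i (p i x) + p (i + 1) (M.d (i + 1) x) = x

end FilteredDiffModule

/-! ### Free bigraded modules -/

/-- A free bigraded abelian group, given by a homogeneous basis `gen`; the basis element `g` has
bidegree `(prim g, sec g)`. -/
structure BigradedBasis where
  gen : Type
  prim : gen → ℤ
  sec : gen → ℤ

namespace BigradedBasis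

/-- `M[m]`, where `M[m]^{i,j} = M^{i-m,j}`. -/
def shiftPrim (M : BigradedBasis) (m : ℤ) : BigradedBasis where
  gen := M.gen
  prim g := M.prim g + m
  sec := M.sec

/-- `M{n}`, where `M{n}^{i,j} = M^{i,j-n}`. -/
def shiftSec (M : BigradedBasis) (n : ℤ) : BigradedBasis where
  gen := M.gen
  prim := M.prim
  sec g := M.sec g + n

/-- Direct sum of a family. -/
def directSum {ι : Type} (M : ι → BigradedBasis) : BigradedBasis where
  gen := Σ a, (M a).gen
  prim g := (M g.1).prim g.2
  sec g := (M g.1).sec g.2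

/-- The filtered module underlying a bigraded module: the elements of filtration at least `j`
are the sums of homogeneous elements of secondary degree at least `j`. -/
noncomputable def toFilteredModule (M : BigradedBasis) : FilteredModule where
  X i := {g : M.gen // M.prim g = i} →₀ ℤ
  F j _ := Finsupp.supported ℤ ℤ {g | j ≤ M.sec g.1}
  antitone _ _ _ h := Finsupp.supported_mono fun _ hg => h.trans hg

end BigradedBasis

/-! ### The module `𝒜` and its structure constants

`𝒜` has basis `1, X`, encoded by `true, false` respectively. -/

/-- The secondary degree of `1` is `1`, that of `X` is `-1`. -/
def labelDeg (b : Bool) : ℤ := if b then 1 else -1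

/-- The bigraded module `𝒜`, with `𝒜^{0,-1} = 𝒜^{0,1} = ℤ`. -/
def calA : BigradedBasis where
  gen := Bool
  prim _ := 0
  sec := labelDeg

/-- Khovanov's multiplication `1·1 = 1`, `1·X = X·1 = X`, `X·X = 0`:
the coefficient of `c` in `a·b`. -/
def khMul : Bool → Bool → Bool → ℤ
  | true, true, true => 1
  | true, false, false => 1
  | false, true, false => 1
  | _, _, _ => 0

/-- Khovanov's comultiplication `1 ↦ 1 ⊗ X + X ⊗ 1`, `X ↦ X ⊗ X`:
the coefficient of `b ⊗ c` in the image of `a`. -/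
def khComul : Bool → Bool → Bool → ℤ
  | true, true, false => 1
  | true, false, true => 1
  | false, false, false => 1
  | _, _, _ => 0

/-- The multiplication part of Lee's map: `X ⊗ X ↦ 1`, all other products `0`. -/
def leeMul : Bool → Bool → Bool → ℤ
  | false, false, true => 1
  | _, _, _ => 0

/-- The comultiplication part of Lee's map: `X ↦ 1 ⊗ 1`, `1 ↦ 0`. -/
def leeComul : Bool → Bool → Bool → ℤ
  | false, true, true => 1
  | _, _, _ => 0

/-! ### Link diagrams -/

/-- An unoriented planar link diagram with crossings numbered by `Fin n`, as a combinatorial map.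
The four ends at the crossing `c` are `(c, 0), (c, 1), (c, 2), (c, 3)` in counterclockwise order,
where `(c, 0), (c, 2)` belong to the lower strand and `(c, 1), (c, 3)` to the upper one.
`opp` sends an end to the other end of the same edge. There are, in addition, `k` circles without
crossings. `planar` says that the 4-valent graph is drawn in the plane: `V + F = E + 2 C`, with
`V = n`, `E = 2 n`, `F` the number of boundary cycles of regions (the orbits of "pass to the other
end of the edge, then to the next end counterclockwise"), and `C` the number of connected
components of the graph. As the genus of every component is nonnegative, the equation says that
all these genera are zero. -/
structure LinkDiagram where
  n : ℕ
  k : ℕ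
  opp : Fin n × Fin 4 → Fin n × Fin 4
  opp_opp : ∀ a, opp (opp a) = a
  opp_ne : ∀ a, opp a ≠ a
  planar : n + Nat.card (Quot fun a b : Fin n × Fin 4 => b = ((opp a).1, (opp a).2 + 1)) =
    2 * n + 2 * Nat.card (Quot fun a b : Fin n × Fin 4 => b = opp a ∨ b.1 = a.1)

/-- How a strand runs through the place of a crossing: straight on at an unsmoothed crossing
(`none`); along the arcs `0–1`, `2–3` in the `0`-smoothing (`some false`), which joins the two
regions swept by rotating the upper strand counterclockwise; along the arcs `1–2`, `3–0` in the
`1`-smoothing (`some true`). -/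
def through : Option Bool → Fin 4 → Fin 4
  | none => ![2, 3, 0, 1]
  | some false => ![1, 0, 3, 2]
  | some true => ![3, 2, 1, 0]

namespace LinkDiagram

/-- A diagram obtained from `D` by smoothing some of the crossings: `none` at crossings that are
kept, `some false` / `some true` at those replaced by the `0`- / `1`-smoothing. -/
abbrev PartialSmoothing (D : LinkDiagram) : Type := Fin D.n → Option Bool

/-- A Kauffman state: every crossing is smoothed, `true` for the `1`-smoothing. -/
abbrev KauffmanState (D : LinkDiagram) : Type := Fin D.n → Bool

/-- The ends of edges, and the circles without crossings. -/
abbrev Point (D : LinkDiagram) : Type := (Fin D.n × Fin 4) ⊕ Fin D.k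

/-- The relation that generates "lie in the same connected component" in the diagram `ρ`. -/
inductive Adj (D : LinkDiagram) (ρ : D.PartialSmoothing) : D.Point → D.Point → Prop
  | edge (a) : Adj D ρ (.inl a) (.inl (D.opp a))
  | crossing (c i j) : ρ c = none → Adj D ρ (.inl (c, i)) (.inl (c, j))
  | smoothing (c b i) : ρ c = some b → Adj D ρ (.inl (c, i)) (.inl (c, through (some b) i))

/-- The set of connected components of the diagram `ρ`. -/
abbrev Components (D : LinkDiagram) (ρ : D.PartialSmoothing) : Type := Quot (D.Adj ρ)

/-- The diagram `ρ` is connected. -/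
def IsConn (D : LinkDiagram) (ρ : D.PartialSmoothing) : Prop := Nat.card (D.Components ρ) = 1

/-- The diagram `D` is connected. -/
def Connected (D : LinkDiagram) : Prop := D.IsConn fun _ => none

/-- The circles of a Kauffman state. -/
abbrev Circles (D : LinkDiagram) (s : D.KauffmanState) : Type := D.Components fun c => some (s c)

noncomputable instance (D : LinkDiagram) (s : D.KauffmanState) : Fintype (D.Circles s) :=
  Fintype.ofFinite _

/-- The circle through a given point. -/
def circleOf (D : LinkDiagram) (s : D.KauffmanState) (a : D.Point) : D.Circles s := Quot.mk _ a

/-- `r(D, s)`, the number of `1`-smoothings. -/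
def r (D : LinkDiagram) (s : D.KauffmanState) : ℤ := (Finset.univ.filter fun c => s c = true).card

/-- `𝒦₁(D)`, the set of Kauffman states that consist of exactly one circle. -/
abbrev K₁ (D : LinkDiagram) : Type := {s : D.KauffmanState // Nat.card (D.Circles s) = 1}

/-! ### The binary tree -/

open Classical in
/-- The leaves below the node `ρ` of the binary tree, where the crossings in the list are still to
be treated: a crossing is smoothed, in both ways, if and only if both resulting diagrams are
connected. -/
def leaves (D : LinkDiagram) : List (Fin D.n) → D.PartialSmoothing → Set D.PartialSmoothing
  | [], ρ => {ρ}
  | c :: cs, ρ =>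
    if D.IsConn (Function.update ρ c (some false)) ∧ D.IsConn (Function.update ρ c (some true)) then
      D.leaves cs (Function.update ρ c (some false)) ∪ D.leaves cs (Function.update ρ c (some true))
    else D.leaves cs ρ

/-- `𝒯(D)`, the set of leaves of the binary tree that starts at `D` and treats the crossings in
the order of their numbering. -/
def T (D : LinkDiagram) : Set D.PartialSmoothing := D.leaves (List.finRange D.n) fun _ => none

/-- `s` is one of the Kauffman states of the diagram `ρ`. -/
def HasState (D : LinkDiagram) (ρ : D.PartialSmoothing) (s : D.KauffmanState) : Prop :=
  ∀ c b, ρ c = some b → s c = b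

open Classical in
/-- The leaf below `ρ` that is reached by following `s`. -/
noncomputable def leafBelow (D : LinkDiagram) (s : D.KauffmanState) :
    List (Fin D.n) → D.PartialSmoothing → D.PartialSmoothing
  | [], ρ => ρ
  | c :: cs, ρ =>
    if D.IsConn (Function.update ρ c (some false)) ∧ D.IsConn (Function.update ρ c (some true)) then
      D.leafBelow s cs (Function.update ρ c (some (s c)))
    else D.leafBelow s cs ρ

/-- `D_S`, the unique element of `𝒯(D)` that has `S` among its Kauffman states, see
`mem_T_and_hasState_iff`. -/
noncomputable def leaf (D : LinkDiagram) (s : D.KauffmanState) : D.PartialSmoothing :=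
  D.leafBelow s (List.finRange D.n) fun _ => none

theorem eq_of_mem_leaves (D : LinkDiagram) {ρ' : D.PartialSmoothing} {c : Fin D.n} :
    ∀ (cs : List (Fin D.n)) (ρ : D.PartialSmoothing), c ∉ cs → ρ' ∈ D.leaves cs ρ → ρ' c = ρ c
  | [], ρ, _, h => by rw [leaves, Set.mem_singleton_iff] at h; rw [h]
  | a :: cs, ρ, hc, h => by
    rw [List.mem_cons, not_or] at hc
    rw [leaves] at h
    split_ifs at h
    · rcases h with h | h <;>
        rw [eq_of_mem_leaves D cs _ hc.2 h, Function.update_of_ne hc.1]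
    · exact eq_of_mem_leaves D cs ρ hc.2 h

theorem mem_leaves_and_hasState_iff (D : LinkDiagram) (s : D.KauffmanState)
    (ρ' : D.PartialSmoothing) :
    ∀ (cs : List (Fin D.n)) (ρ : D.PartialSmoothing), cs.Nodup → D.HasState ρ s →
      (ρ' ∈ D.leaves cs ρ ∧ D.HasState ρ' s ↔ ρ' = D.leafBelow s cs ρ)
  | [], ρ, _, hs => by
    rw [leaves, leafBelow, Set.mem_singleton_iff]
    exact ⟨fun h => h.1, fun h => ⟨h, h ▸ hs⟩⟩
  | c :: cs, ρ, hcs, hs => by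
    rw [List.nodup_cons] at hcs
    have key : ∀ b, ρ' ∈ D.leaves cs (Function.update ρ c (some b)) → D.HasState ρ' s → s c = b :=
      fun b h h' => h' c b (by rw [eq_of_mem_leaves D cs _ hcs.1 h, Function.update_self])
    have hs' : D.HasState (Function.update ρ c (some (s c))) s := by
      intro a b hab
      by_cases ha : a = c
      · subst ha; simpa using hab
      · rw [Function.update_of_ne ha] at hab; exact hs a b hab
    rw [leaves, leafBelow]
    split_ifs
    · rw [← mem_leaves_and_hasState_iff D s ρ' cs _ hcs.2 hs']
      refine ⟨?_, fun ⟨h, h'⟩ => ⟨?_, h'⟩⟩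
      · rintro ⟨h | h, h'⟩
        · exact ⟨by rwa [key false h h'], h'⟩
        · exact ⟨by rwa [key true h h'], h'⟩
      · cases hb : s c <;> rw [hb] at h
        · exact Or.inl h
        · exact Or.inr h
    · exact mem_leaves_and_hasState_iff D s ρ' cs ρ hcs.2 hs

theorem mem_T_and_hasState_iff (D : LinkDiagram) (s : D.KauffmanState) (ρ : D.PartialSmoothing) :
    ρ ∈ D.T ∧ D.HasState ρ s ↔ ρ = D.leaf s :=
  D.mem_leaves_and_hasState_iff s ρ _ _ (List.nodup_finRange _) fun _ _ h => by cases h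

/-! ### Orientations and the numbers `x`, `y`, `w` -/

/-- An orientation of the diagram `ρ` (up to the irrelevant orientations of the circles without
crossings): `out a` says whether the end `a` points away from its crossing. -/
structure Orientation (D : LinkDiagram) (ρ : D.PartialSmoothing) where
  out : Fin D.n × Fin 4 → Bool
  edge : ∀ a, out (D.opp a) = !out a
  strand : ∀ c i, out (c, through (ρ c) i) = !out (c, i)

/-- Two fixed-point-free involutions have a common sign function. -/
theorem exists_alternating {Y : Type} (α τ : Y → Y) (hα : ∀ a, α (α a) = a) (hα' : ∀ a, α a ≠ a)
    (hτ : ∀ a, τ (τ a) = a) (hτ' : ∀ a, τ a ≠ a) :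
    ∃ f : Y → Bool, (∀ a, f (α a) = !f a) ∧ ∀ a, f (τ a) = !f a := by
  classical
  let A : Equiv.Perm Y := Function.Involutive.toPerm α hα
  let B : Equiv.Perm Y := Function.Involutive.toPerm τ hτ
  have hA : A * A = 1 := Equiv.ext hα
  have hB : B * B = 1 := Equiv.ext hτ
  have hAi : A⁻¹ = A := inv_eq_of_mul_eq_one_left hA
  have hBi : B⁻¹ = B := inv_eq_of_mul_eq_one_left hB
  let P : Equiv.Perm Y := B * A
  have hP : A * P * A⁻¹ = P⁻¹ := by
    simp only [P, mul_inv_rev, hAi, hBi, mul_assoc, hA, mul_one]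
  have hz : ∀ (k : ℤ) y, A ((P ^ k) y) = (P ^ (-k)) (A y) := by
    intro k y
    have h : A * P ^ k * A⁻¹ = P ^ (-k) := by rw [← conj_zpow, hP, inv_zpow, zpow_neg]
    rw [← h]; simp
  have hne : ∀ a, ¬ P.SameCycle a (A a) := by
    rintro a ⟨k, hk⟩
    have hm : ∀ m : ℤ, A a = (P ^ m) (A ((P ^ m) a)) := by
      intro m; rw [hz, ← Equiv.Perm.mul_apply, ← zpow_add]; simp
    rcases Int.even_or_odd' k with ⟨m, rfl | rfl⟩
    · rw [hm m, two_mul, zpow_add, Equiv.Perm.mul_apply] at hk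
      exact hα' _ ((P ^ m).injective hk).symm
    · rw [hm m, two_mul, add_assoc, add_comm m 1, zpow_add, zpow_add, zpow_one,
        Equiv.Perm.mul_apply, Equiv.Perm.mul_apply] at hk
      exact hτ' _ ((P ^ m).injective hk)
  let Q := Quotient (Equiv.Perm.SameCycle.setoid P)
  let q : Y → Q := Quotient.mk _
  have hq : ∀ a b, q a = q b ↔ P.SameCycle a b := fun a b => Quotient.eq
  have hqt : ∀ a, q (τ a) = q (α a) := fun a => (hq _ _).2 <| by
    refine Equiv.Perm.SameCycle.symm ⟨1, ?_⟩
    change τ (α (α a)) = τ a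
    rw [hα]
  have hqa : ∀ a b, q a = q b → q (α a) = q (α b) := fun a b h => by
    obtain ⟨k, rfl⟩ := (hq a b).1 h
    exact (hq _ _).2 ⟨-k, (hz k a).symm⟩
  have hqat : ∀ a, q (α (τ a)) = q a := fun a => by
    rw [hqa _ _ (hqt a), hα]
  let _ : LinearOrder Q := linearOrderOfSTO WellOrderingRel
  have hd : ∀ a, q a ≠ q (α a) := fun a h => hne a ((hq _ _).1 h)
  have hlt : ∀ u v : Q, u ≠ v → decide (v < u) = !decide (u < v) := fun u v h => by
    rcases lt_or_gt_of_ne h with h | h <;> simp [h, h.le]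
  refine ⟨fun a => decide (q a < q (α a)), fun a => ?_, fun a => ?_⟩
  · simp only [hα]; exact hlt _ _ (hd a)
  · simp only [hqt, hqat]; exact hlt _ _ (hd a)

/-- Every diagram can be oriented. -/
instance (D : LinkDiagram) (ρ : D.PartialSmoothing) : Nonempty (D.Orientation ρ) := by
  have h1 : ∀ (u : Option Bool) (i : Fin 4), through u (through u i) = i := by decide
  have h2 : ∀ (u : Option Bool) (i : Fin 4), through u i ≠ i := by decide
  obtain ⟨f, hf, hf'⟩ := exists_alternating D.opp (fun a => (a.1, through (ρ a.1) a.2))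
    D.opp_opp D.opp_ne (fun a => by simp [h1]) (fun a h => h2 _ _ (congrArg Prod.snd h))
  exact ⟨⟨f, hf, fun c i => hf' (c, i)⟩⟩

/-- The crossing `c` is positive: with the lower strand running from `0` to `2`, the upper one
runs from `3` to `1` (or both the other way round). -/
def Orientation.IsPositive {D : LinkDiagram} {ρ : D.PartialSmoothing} (o : D.Orientation ρ)
    (c : Fin D.n) : Prop := o.out (c, 0) ≠ o.out (c, 1)

instance {D : LinkDiagram} {ρ : D.PartialSmoothing} (o : D.Orientation ρ) (c : Fin D.n) :
    Decidable (o.IsPositive c) := inferInstanceAs (Decidable (_ ≠ _))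

/-- `x`, the number of negative crossings of the diagram `ρ`. -/
def Orientation.x {D : LinkDiagram} {ρ : D.PartialSmoothing} (o : D.Orientation ρ) : ℤ :=
  (Finset.univ.filter fun c => ρ c = none ∧ ¬ o.IsPositive c).card

/-- `y`, the number of positive crossings of the diagram `ρ`. -/
def Orientation.y {D : LinkDiagram} {ρ : D.PartialSmoothing} (o : D.Orientation ρ) : ℤ :=
  (Finset.univ.filter fun c => ρ c = none ∧ o.IsPositive c).card

/-- `w = x - y`. -/
def Orientation.w {D : LinkDiagram} {ρ : D.PartialSmoothing} (o : D.Orientation ρ) : ℤ := o.x - o.y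

/-! ### Lee's complex -/

/-- The module underlying the Khovanov complex, `⨁_s 𝒜^{⊗ circles of s}[r(D,s)]{r(D,s)}` over all
Kauffman states `s`; a basis element is a state with a label `1` (`true`) or `X` (`false`) on each
of its circles. -/
noncomputable def khovanovModule (D : LinkDiagram) : BigradedBasis where
  gen := Σ s : D.KauffmanState, (D.Circles s → Bool)
  prim g := D.r g.1
  sec g := ∑ γ, labelDeg (g.2 γ) + D.r g.1

open Classical in
/-- The coefficient of `h` in the image of `g` under the map from the cube of smoothings that is
built from a multiplication `m` and a comultiplication `Δ`. The part that turns the `0`-smoothing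
at `c` into the `1`-smoothing multiplies the labels of the two circles at `c` if they are merged,
comultiplies the label of the circle at `c` if it is split, leaves all other labels unchanged, and
has the sign `(-1)^{number of 1-smoothings at crossings before c}`. (The two arcs at `c` contain
the ends `0` and `2`, respectively, in both smoothings.) -/
noncomputable def cubeCoeff (D : LinkDiagram) (m Δ : Bool → Bool → Bool → ℤ)
    (g h : D.khovanovModule.gen) : ℤ :=
  ∑ c : Fin D.n,
    if g.1 c = false ∧ h.1 = Function.update g.1 c true ∧
        ∀ a : D.Point, D.circleOf g.1 a ≠ D.circleOf g.1 (.inl (c, 0)) →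
          D.circleOf g.1 a ≠ D.circleOf g.1 (.inl (c, 2)) →
          h.2 (D.circleOf h.1 a) = g.2 (D.circleOf g.1 a) then
      (-1) ^ (Finset.univ.filter fun c' => c' < c ∧ g.1 c' = true).card *
        (if D.circleOf g.1 (.inl (c, 0)) ≠ D.circleOf g.1 (.inl (c, 2)) then
          m (g.2 (D.circleOf g.1 (.inl (c, 0)))) (g.2 (D.circleOf g.1 (.inl (c, 2))))
            (h.2 (D.circleOf h.1 (.inl (c, 0))))
        else if D.circleOf h.1 (.inl (c, 0)) ≠ D.circleOf h.1 (.inl (c, 2)) then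
          Δ (g.2 (D.circleOf g.1 (.inl (c, 0))))
            (h.2 (D.circleOf h.1 (.inl (c, 0)))) (h.2 (D.circleOf h.1 (.inl (c, 2))))
        else 0)
    else 0

/-- The map of primary degree `1` with given coefficients. -/
noncomputable def mapOfCoeff (D : LinkDiagram)
    (q : D.khovanovModule.gen → D.khovanovModule.gen → ℤ) (i : ℤ) :
    D.khovanovModule.toFilteredModule.X i →ₗ[ℤ] D.khovanovModule.toFilteredModule.X (i + 1) :=
  haveI : Finite D.khovanovModule.gen :=
    inferInstanceAs (Finite (Σ s : D.KauffmanState, (D.Circles s → Bool)))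
  Finsupp.linearCombination ℤ fun g : {g : D.khovanovModule.gen // D.khovanovModule.prim g = i} =>
    Finsupp.equivFunOnFinite.symm
      fun h : {h : D.khovanovModule.gen // D.khovanovModule.prim h = i + 1} => q g.1 h.1

/-- Khovanov's differential `d`. -/
noncomputable def khovanovD (D : LinkDiagram) (i : ℤ) :=
  D.mapOfCoeff (D.cubeCoeff khMul khComul) i

/-- Lee's map `Φ`. -/
noncomputable def leePhi (D : LinkDiagram) (i : ℤ) :=
  D.mapOfCoeff (D.cubeCoeff leeMul leeComul) i

/-- `C'(D)`: the filtered module of the Khovanov complex, with `d' = d + Φ`. -/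
noncomputable def leeComplex (D : LinkDiagram) : FilteredDiffModule where
  toFilteredModule := D.khovanovModule.toFilteredModule
  d i := D.khovanovD i + D.leePhi i

/-- `⨁_{S ∈ 𝒦₁(D)} 𝒜[w(D_S)]{2w(D_S)}[r(D,S)]{r(D,S)}`. -/
noncomputable def spanningTreeModule (D : LinkDiagram) (o : ∀ S : D.K₁, D.Orientation (D.leaf S.1)) :
    BigradedBasis :=
  BigradedBasis.directSum fun S : D.K₁ =>
    (((calA.shiftPrim (o S).w).shiftSec (2 * (o S).w)).shiftPrim (D.r S.1)).shiftSec (D.r S.1)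

end LinkDiagram

/-! ### Maps of bigraded modules given by matrices -/

open Matrix

namespace BigradedBasis

/-- The homogeneous part of primary degree `i`, as the free module on the generators of that
degree. -/
noncomputable def freePart {M : BigradedBasis} {i : ℤ} :
    M.toFilteredModule.X i ≃ₗ[ℤ] ({g : M.gen // M.prim g = i} →₀ ℤ) :=
  LinearEquiv.refl ℤ ({g : M.gen // M.prim g = i} →₀ ℤ)

/-- The coefficients of a homogeneous element, as a function on all generators. -/
noncomputable def coeff {M : BigradedBasis} {i : ℤ} :
    M.toFilteredModule.X i →ₗ[ℤ] (M.gen → ℤ) :=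
  (Function.ExtendByZero.linearMap ℤ (Subtype.val : {g : M.gen // M.prim g = i} → M.gen)).comp
    (Finsupp.lcoeFun.comp freePart.toLinearMap)

theorem coeff_apply {M : BigradedBasis} {i : ℤ} (x : M.toFilteredModule.X i)
    (g : M.gen) (hg : M.prim g = i) : coeff x g = freePart x ⟨g, hg⟩ :=
  Subtype.val_injective.extend_apply (freePart x) 0 ⟨g, hg⟩

theorem coeff_of_ne {M : BigradedBasis} {i : ℤ} (x : M.toFilteredModule.X i)
    (g : M.gen) (hg : M.prim g ≠ i) : coeff x g = 0 :=
  Function.extend_apply' _ _ _ (by rintro ⟨⟨a, ha⟩, rfl⟩; exact hg ha)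

theorem coeff_injective {M : BigradedBasis} {i : ℤ} {x y : M.toFilteredModule.X i}
    (h : coeff x = coeff y) : x = y :=
  freePart.injective <| Finsupp.ext fun ⟨g, hg⟩ => by
    have := congrFun h g
    rwa [coeff_apply _ g hg, coeff_apply _ g hg] at this

theorem mem_F_iff {M : BigradedBasis} {i j : ℤ} (x : M.toFilteredModule.X i) :
    x ∈ M.toFilteredModule.F j i ↔ ∀ g, coeff x g ≠ 0 → j ≤ M.sec g := by
  have h0 : x ∈ M.toFilteredModule.F j i ↔
      freePart x ∈ Finsupp.supported ℤ ℤ {g : {g : M.gen // M.prim g = i} | j ≤ M.sec g.1} := Iff.rfl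
  rw [h0, Finsupp.mem_supported']
  constructor
  · intro h g hg
    by_cases hi : M.prim g = i
    · by_contra hj
      rw [coeff_apply _ g hi] at hg
      exact hg (h ⟨g, hi⟩ hj)
    · exact absurd (coeff_of_ne x g hi) hg
  · rintro h ⟨g, hi⟩ hg
    by_contra hne
    refine hg (h g ?_)
    rwa [coeff_apply _ g hi]

/-- The map from the part of primary degree `i` to the part of primary degree `j` that is given by
a matrix. -/
noncomputable def matrixMap {M N : BigradedBasis} [Finite N.gen] (q : Matrix M.gen N.gen ℤ)
    (i j : ℤ) : M.toFilteredModule.X i →ₗ[ℤ] N.toFilteredModule.X j :=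
  freePart.symm.toLinearMap.comp <| LinearMap.comp
    (Finsupp.linearCombination ℤ fun g : {g : M.gen // M.prim g = i} =>
      Finsupp.equivFunOnFinite.symm fun h : {h : N.gen // N.prim h = j} => q g.1 h.1)
    freePart.toLinearMap

theorem freePart_matrixMap {M N : BigradedBasis} [Fintype M.gen] [Finite N.gen]
    (q : Matrix M.gen N.gen ℤ) {i j : ℤ} (x : M.toFilteredModule.X i)
    (h : {h : N.gen // N.prim h = j}) :
    freePart (matrixMap q i j x) h =
      ∑ g : {g : M.gen // M.prim g = i}, freePart x g * q g.1 h.1 := by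
  rw [matrixMap, LinearMap.comp_apply, LinearEquiv.coe_coe, LinearEquiv.apply_symm_apply,
    LinearMap.comp_apply, LinearEquiv.coe_coe,
    Finsupp.linearCombination_apply, Finsupp.sum_fintype _ _ (by simp), Finsupp.finsetSum_apply]
  simp

theorem coeff_matrixMap {M N : BigradedBasis} [Fintype M.gen] [Finite N.gen]
    (q : Matrix M.gen N.gen ℤ) {i j : ℤ}
    (hq : ∀ g h, q g h ≠ 0 → M.prim g = i → N.prim h = j) (x : M.toFilteredModule.X i) :
    coeff (matrixMap q i j x) = coeff x ᵥ* q := by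
  funext h
  have key : (coeff x ᵥ* q) h =
      ∑ g : {g : M.gen // M.prim g = i}, freePart x g * q g.1 h := by
    rw [vecMul, dotProduct, ← Fintype.sum_subtype_add_sum_subtype (fun g => M.prim g = i),
      Finset.sum_eq_zero (s := (Finset.univ : Finset {g // ¬ M.prim g = i})), add_zero]
    · exact Finset.sum_congr rfl fun g _ => by rw [coeff_apply _ g.1 g.2]
    · rintro ⟨g, hg⟩ _
      rw [coeff_of_ne x g hg, zero_mul]
  rw [key]
  by_cases hj : N.prim h = j
  · rw [coeff_apply _ h hj, freePart_matrixMap]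
  · rw [coeff_of_ne _ h hj]
    refine (Finset.sum_eq_zero fun g _ => ?_).symm
    by_contra hne
    exact hj (hq g.1 h (right_ne_zero_of_mul hne) g.2)

/-- The matrix has primary degree `k` and respects the filtration. -/
def HasDeg {M N : BigradedBasis} (k : ℤ) (q : Matrix M.gen N.gen ℤ) : Prop :=
  ∀ g h, q g h ≠ 0 → N.prim h = M.prim g + k ∧ M.sec g ≤ N.sec h

namespace HasDeg

variable {M N P : BigradedBasis}

theorem mul [Fintype N.gen] {k l m : ℤ} {q : Matrix M.gen N.gen ℤ} {q' : Matrix N.gen P.gen ℤ}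
    (h : HasDeg k q) (h' : HasDeg l q') (hm : k + l = m) : HasDeg m (q * q') := by
  intro a c hac
  obtain ⟨b, -, hb⟩ := Finset.exists_ne_zero_of_sum_ne_zero hac
  have h1 := h a b (left_ne_zero_of_mul hb)
  have h2 := h' b c (right_ne_zero_of_mul hb)
  exact ⟨by omega, h1.2.trans h2.2⟩

theorem add {k : ℤ} {q q' : Matrix M.gen N.gen ℤ} (h : HasDeg k q) (h' : HasDeg k q') :
    HasDeg k (q + q') := by
  intro a b hab
  by_cases h0 : q a b = 0
  · exact h' a b (by simpa [h0] using hab)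
  · exact h a b h0

theorem neg {k : ℤ} {q : Matrix M.gen N.gen ℤ} (h : HasDeg k q) : HasDeg k (-q) :=
  fun a b hab => h a b (by simpa using hab)

theorem sub {k : ℤ} {q q' : Matrix M.gen N.gen ℤ} (h : HasDeg k q) (h' : HasDeg k q') :
    HasDeg k (q - q') := sub_eq_add_neg q q' ▸ h.add h'.neg

theorem one [DecidableEq M.gen] : HasDeg 0 (1 : Matrix M.gen M.gen ℤ) := by
  intro a b hab
  obtain rfl : a = b := by by_contra h; exact hab (Matrix.one_apply_ne h)
  simp

theorem submatrix {Q R : BigradedBasis} {k : ℤ} {q : Matrix M.gen N.gen ℤ} (h : HasDeg k q)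
    (u : Q.gen → M.gen) (v : R.gen → N.gen) (hu : ∀ g, M.prim (u g) = Q.prim g)
    (hu' : ∀ g, M.sec (u g) = Q.sec g) (hv : ∀ g, N.prim (v g) = R.prim g)
    (hv' : ∀ g, N.sec (v g) = R.sec g) : HasDeg (M := Q) (N := R) k (q.submatrix u v) := by
  intro a b hab
  have := h _ _ hab
  rwa [hu, hu', hv, hv'] at this

theorem coeff_matrixMap [Fintype M.gen] [Finite N.gen] {k : ℤ} {q : Matrix M.gen N.gen ℤ}
    (hq : HasDeg k q) {i j : ℤ} (hj : i + k = j) (x : M.toFilteredModule.X i) :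
    coeff (matrixMap q i j x) = coeff x ᵥ* q :=
  BigradedBasis.coeff_matrixMap q (fun g h hne hg => by rw [(hq g h hne).1, hg, hj]) x

theorem matrixMap_mem [Fintype M.gen] [Finite N.gen] {k : ℤ} {q : Matrix M.gen N.gen ℤ}
    (hq : HasDeg k q) {i i' j : ℤ} (hi : i + k = i') (x : M.toFilteredModule.X i)
    (hx : x ∈ M.toFilteredModule.F j i) : matrixMap q i i' x ∈ N.toFilteredModule.F j i' := by
  rw [mem_F_iff] at hx ⊢
  intro h hne
  rw [hq.coeff_matrixMap hi] at hne
  obtain ⟨g, -, hg⟩ := Finset.exists_ne_zero_of_sum_ne_zero hne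
  exact (hx g (left_ne_zero_of_mul hg)).trans (hq g h (right_ne_zero_of_mul hg)).2

end HasDeg

/-- The filtered differential module with the differential given by a matrix. -/
noncomputable def withMatrix (M : BigradedBasis) [Finite M.gen] (q : Matrix M.gen M.gen ℤ) :
    FilteredDiffModule where
  toFilteredModule := M.toFilteredModule
  d i := matrixMap q i (i + 1)

theorem isFilteredComplex_withMatrix (M : BigradedBasis) [Fintype M.gen]
    {q : Matrix M.gen M.gen ℤ} (hq : HasDeg 1 q) (hqq : q * q = 0) :
    (M.withMatrix q).IsFilteredComplex := by
  have h (i : ℤ) (x : M.toFilteredModule.X i) :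
      matrixMap q (i + 1) (i + 1 + 1) (matrixMap q i (i + 1) x) = 0 := coeff_injective <| by
    rw [hq.coeff_matrixMap rfl, hq.coeff_matrixMap rfl, vecMul_vecMul, hqq, vecMul_zero, map_zero]
  exact ⟨h, fun j i x hx => hq.matrixMap_mem rfl x hx⟩

theorem contractible_withMatrix (M : BigradedBasis) [Fintype M.gen] [DecidableEq M.gen]
    {q p : Matrix M.gen M.gen ℤ} (hq : HasDeg 1 q) (hp : HasDeg (-1) p) (hqp : q * p + p * q = 1) :
    (M.withMatrix q).Contractible := by
  have h (i : ℤ) (x : M.toFilteredModule.X (i + 1)) : matrixMap q i (i + 1)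
      (matrixMap p (i + 1) i x) + matrixMap p (i + 1 + 1) (i + 1)
        (matrixMap q (i + 1) (i + 1 + 1) x) = x := coeff_injective <| by
    rw [map_add, hq.coeff_matrixMap rfl, hp.coeff_matrixMap (by ring), hp.coeff_matrixMap (by ring),
      hq.coeff_matrixMap rfl, vecMul_vecMul, vecMul_vecMul, ← vecMul_add,
      add_comm (p * q), hqp, vecMul_one]
  exact ⟨fun i => matrixMap p (i + 1) i, fun j i x hx => hp.matrixMap_mem (by ring) x hx, h⟩

/-- The free bigraded module on a subset of the homogeneous basis. -/
def restrict (M : BigradedBasis) (P : M.gen → Prop) : BigradedBasis where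
  gen := {g // P g}
  prim g := M.prim g.1
  sec g := M.sec g.1

instance (M : BigradedBasis) [Finite M.gen] (P : M.gen → Prop) : Finite (M.restrict P).gen :=
  inferInstanceAs (Finite {g // P g})

theorem nonempty_iso_directSum (M : BigradedBasis) [Fintype M.gen] [DecidableEq M.gen]
    (P : M.gen → Prop)
    {q U V : Matrix M.gen M.gen ℤ} (hq : HasDeg 1 q) (hU : HasDeg 0 U) (hV : HasDeg 0 V)
    (hUV : U * V = 1) (hVU : V * U = 1) (hblock : ∀ g h, (U * q * V) g h ≠ 0 → (P g ↔ P h)) :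
    Nonempty (FilteredDiffModule.Iso (M.withMatrix q)
      (((M.restrict P).withMatrix ((U * q * V).submatrix Subtype.val Subtype.val)).directSum
      ((M.restrict fun g => ¬ P g).withMatrix
        ((U * q * V).submatrix Subtype.val Subtype.val)))) := by
  set Q := M.restrict P
  set R := M.restrict fun g => ¬ P g
  let _ : Fintype Q.gen := Fintype.ofFinite _
  let _ : Fintype R.gen := Fintype.ofFinite _
  let _ : DecidableEq Q.gen := Classical.decEq _
  let _ : DecidableEq R.gen := Classical.decEq _
  let VQ : Matrix M.gen Q.gen ℤ := V.submatrix id Subtype.val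
  let VR : Matrix M.gen R.gen ℤ := V.submatrix id Subtype.val
  let UQ : Matrix Q.gen M.gen ℤ := U.submatrix Subtype.val id
  let UR : Matrix R.gen M.gen ℤ := U.submatrix Subtype.val id
  let qQ : Matrix Q.gen Q.gen ℤ := (U * q * V).submatrix Subtype.val Subtype.val
  let qR : Matrix R.gen R.gen ℤ := (U * q * V).submatrix Subtype.val Subtype.val
  have hVQ : HasDeg (M := M) (N := Q) 0 VQ := hV.submatrix (Q := M) (R := Q) id Subtype.val
    (fun _ => rfl) (fun _ => rfl) (fun _ => rfl) (fun _ => rfl)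
  have hVR : HasDeg (M := M) (N := R) 0 VR := hV.submatrix (Q := M) (R := R) id Subtype.val
    (fun _ => rfl) (fun _ => rfl) (fun _ => rfl) (fun _ => rfl)
  have hUQ : HasDeg (M := Q) (N := M) 0 UQ := hU.submatrix (Q := Q) (R := M) Subtype.val id
    (fun _ => rfl) (fun _ => rfl) (fun _ => rfl) (fun _ => rfl)
  have hUR : HasDeg (M := R) (N := M) 0 UR := hU.submatrix (Q := R) (R := M) Subtype.val id
    (fun _ => rfl) (fun _ => rfl) (fun _ => rfl) (fun _ => rfl)
  have hd : HasDeg 1 (U * q * V) := (hU.mul hq rfl).mul hV rfl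
  have hqQ : HasDeg (M := Q) (N := Q) 1 qQ := hd.submatrix (Q := Q) (R := Q) _ _
    (fun _ => rfl) (fun _ => rfl) (fun _ => rfl) (fun _ => rfl)
  have hqR : HasDeg (M := R) (N := R) 1 qR := hd.submatrix (Q := R) (R := R) _ _
    (fun _ => rfl) (fun _ => rfl) (fun _ => rfl) (fun _ => rfl)
  have split : ∀ f : M.gen → ℤ, ∑ g, f g = ∑ g : Q.gen, f g.1 + ∑ g : R.gen, f g.1 := by
    intro f
    classical
    let eQ : {g // P g} ≃ Q.gen := Equiv.refl _
    let eR : {g // ¬ P g} ≃ R.gen := Equiv.refl _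
    rw [← Fintype.sum_subtype_add_sum_subtype P]
    exact congrArg₂ _ (Fintype.sum_equiv eQ _ _ fun _ => rfl)
      (Fintype.sum_equiv eR _ _ fun _ => rfl)
  have h1 : VQ * UQ + VR * UR = 1 := by
    rw [← hVU]
    ext a b
    exact (split fun g => V a g * U g b).symm
  have h2 : UQ * VQ = 1 := by
    ext a b
    refine (congrFun (congrFun hUV a.1) b.1).trans ?_
    by_cases h : a = b
    · rw [h, Matrix.one_apply_eq, Matrix.one_apply_eq]
    · rw [Matrix.one_apply_ne h, Matrix.one_apply_ne fun h' => h (Subtype.ext h')]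
  have h3 : UR * VR = 1 := by
    ext a b
    refine (congrFun (congrFun hUV a.1) b.1).trans ?_
    by_cases h : a = b
    · rw [h, Matrix.one_apply_eq, Matrix.one_apply_eq]
    · rw [Matrix.one_apply_ne h, Matrix.one_apply_ne fun h' => h (Subtype.ext h')]
  have h4 : UQ * VR = 0 := by
    ext a b
    refine (congrFun (congrFun hUV a.1) b.1).trans (Matrix.one_apply_ne ?_)
    rintro h
    exact b.2 (h ▸ a.2)
  have h5 : UR * VQ = 0 := by
    ext a b
    refine (congrFun (congrFun hUV a.1) b.1).trans (Matrix.one_apply_ne ?_)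
    rintro h
    exact a.2 (h ▸ b.2)
  have hVqV : V * (U * q * V) = q * V := by
    rw [← Matrix.mul_assoc, ← Matrix.mul_assoc, hVU, Matrix.one_mul]
  have h6 : VQ * qQ = q * VQ := by
    ext a b
    refine Eq.trans ?_ (congrFun (congrFun hVqV a) b.1)
    rw [Matrix.mul_apply (M := V), split, Finset.sum_eq_zero (s := (Finset.univ : Finset R.gen)),
      add_zero]
    · rfl
    · intro g _
      by_contra hne
      exact g.2 ((hblock _ _ (right_ne_zero_of_mul hne)).2 b.2)
  have h7 : VR * qR = q * VR := by
    ext a b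
    refine Eq.trans ?_ (congrFun (congrFun hVqV a) b.1)
    rw [Matrix.mul_apply (M := V), split, Finset.sum_eq_zero (s := (Finset.univ : Finset Q.gen)),
      zero_add]
    · rfl
    · intro g _
      by_contra hne
      exact b.2 ((hblock _ _ (right_ne_zero_of_mul hne)).1 g.2)
  let fwd (i : ℤ) : M.toFilteredModule.X i →ₗ[ℤ] Q.toFilteredModule.X i × R.toFilteredModule.X i :=
    (matrixMap VQ i i).prod (matrixMap VR i i)
  let bwd (i : ℤ) : Q.toFilteredModule.X i × R.toFilteredModule.X i →ₗ[ℤ] M.toFilteredModule.X i :=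
    (matrixMap UQ i i).coprod (matrixMap UR i i)
  have bwd_fwd : ∀ i x, bwd i (fwd i x) = x := fun i x => coeff_injective <| by
    change coeff (matrixMap UQ i i (matrixMap VQ i i x) + matrixMap UR i i (matrixMap VR i i x)) = _
    rw [map_add, hUQ.coeff_matrixMap (add_zero i), hUR.coeff_matrixMap (add_zero i),
      hVQ.coeff_matrixMap (add_zero i), hVR.coeff_matrixMap (add_zero i), vecMul_vecMul,
      vecMul_vecMul, ← vecMul_add, h1, vecMul_one]
  have fwd_bwd : ∀ i x, fwd i (bwd i x) = x := fun i x => by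
    refine Prod.ext (coeff_injective ?_) (coeff_injective ?_)
    · change coeff (matrixMap VQ i i (matrixMap UQ i i x.1 + matrixMap UR i i x.2)) = _
      rw [hVQ.coeff_matrixMap (add_zero i), map_add, hUQ.coeff_matrixMap (add_zero i),
        hUR.coeff_matrixMap (add_zero i), add_vecMul, vecMul_vecMul, vecMul_vecMul, h2, h5,
        vecMul_one, vecMul_zero, add_zero]
    · change coeff (matrixMap VR i i (matrixMap UQ i i x.1 + matrixMap UR i i x.2)) = _
      rw [hVR.coeff_matrixMap (add_zero i), map_add, hUQ.coeff_matrixMap (add_zero i),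
        hUR.coeff_matrixMap (add_zero i), add_vecMul, vecMul_vecMul, vecMul_vecMul, h3, h4,
        vecMul_one, vecMul_zero, zero_add]
  have commQ (i : ℤ) (x : M.toFilteredModule.X i) : matrixMap VQ (i + 1) (i + 1)
      (matrixMap q i (i + 1) x) = matrixMap qQ i (i + 1) (matrixMap VQ i i x) :=
    coeff_injective <| by
      rw [hVQ.coeff_matrixMap (add_zero _), hq.coeff_matrixMap rfl, hqQ.coeff_matrixMap rfl,
        hVQ.coeff_matrixMap (add_zero _), vecMul_vecMul, vecMul_vecMul, h6]
  have commR (i : ℤ) (x : M.toFilteredModule.X i) : matrixMap VR (i + 1) (i + 1)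
      (matrixMap q i (i + 1) x) = matrixMap qR i (i + 1) (matrixMap VR i i x) :=
    coeff_injective <| by
      rw [hVR.coeff_matrixMap (add_zero _), hq.coeff_matrixMap rfl, hqR.coeff_matrixMap rfl,
        hVR.coeff_matrixMap (add_zero _), vecMul_vecMul, vecMul_vecMul, h7]
  refine ⟨{
    e := fun i => LinearEquiv.ofLinearMap (fwd i) (bwd i)
      (LinearMap.ext (fwd_bwd i)) (LinearMap.ext (bwd_fwd i))
    map_F := fun j i => le_antisymm ?_ ?_
    comm := fun i x => Prod.ext (commQ i x) (commR i x) }⟩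
  · rintro _ ⟨x, hx, rfl⟩
    exact ⟨hVQ.matrixMap_mem (add_zero i) x hx, hVR.matrixMap_mem (add_zero i) x hx⟩
  · rintro y ⟨hy1, hy2⟩
    exact ⟨bwd i y, Submodule.add_mem _ (hUQ.matrixMap_mem (add_zero i) _ hy1)
      (hUR.matrixMap_mem (add_zero i) _ hy2), fwd_bwd i y⟩

/-- A bijection between the homogeneous bases induces an isomorphism of filtered modules. -/
theorem nonempty_iso_of_equiv {M N : BigradedBasis} (e : M.gen ≃ N.gen)
    (hp : ∀ g, N.prim (e g) = M.prim g) (hs : ∀ g, N.sec (e g) = M.sec g) :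
    Nonempty (FilteredModule.Iso M.toFilteredModule N.toFilteredModule) := by
  let f (i : ℤ) : {g // M.prim g = i} ≃ {g // N.prim g = i} :=
    e.subtypeEquiv fun g => by rw [hp]
  refine ⟨⟨fun i => Finsupp.domLCongr (f i), fun j i => ?_⟩⟩
  have h := Finsupp.lmapDomain_supported ℤ ℤ (f i) {g | j ≤ M.sec g.1}
  have himg : f i '' {g | j ≤ M.sec g.1} = {g | j ≤ N.sec g.1} := by
    ext g
    rw [Equiv.image_eq_preimage_symm]
    obtain ⟨g, rfl⟩ := (f i).surjective g
    simp [f, hs]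
  rw [himg] at h
  refine Eq.trans ?_ h
  change Submodule.map _ (Finsupp.supported ℤ ℤ {g : {g : M.gen // M.prim g = i} | j ≤ M.sec g.1}) =
    Submodule.map _ (Finsupp.supported ℤ ℤ {g : {g : M.gen // M.prim g = i} | j ≤ M.sec g.1})
  ext y
  constructor
  · rintro ⟨x, hx, rfl⟩
    exact ⟨x, hx, (Finsupp.equivMapDomain_eq_mapDomain (f i) x).symm⟩
  · rintro ⟨x, hx, rfl⟩
    exact ⟨x, hx, Finsupp.equivMapDomain_eq_mapDomain (f i) x⟩

end BigradedBasis

/-! ### The perturbation lemma -/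

section Triangular

variable {G α : Type*} [PartialOrder α] {φ : G → α}

/-- The matrix is weakly triangular with respect to `φ`. -/
def WeaklyIncreasing (φ : G → α) (q : Matrix G G ℤ) : Prop := ∀ g h, q g h ≠ 0 → φ g ≤ φ h

/-- The matrix is strictly triangular with respect to `φ`. -/
def StrictlyIncreasing (φ : G → α) (q : Matrix G G ℤ) : Prop := ∀ g h, q g h ≠ 0 → φ g < φ h

theorem StrictlyIncreasing.weaklyIncreasing {q : Matrix G G ℤ} (h : StrictlyIncreasing φ q) :
    WeaklyIncreasing φ q := fun a b hab => (h a b hab).le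

theorem WeaklyIncreasing.add {q q' : Matrix G G ℤ} (h : WeaklyIncreasing φ q)
    (h' : WeaklyIncreasing φ q') : WeaklyIncreasing φ (q + q') := fun a b hab => by
  by_cases h0 : q a b = 0
  · exact h' a b (by simpa [h0] using hab)
  · exact h a b h0

theorem StrictlyIncreasing.add {q q' : Matrix G G ℤ} (h : StrictlyIncreasing φ q)
    (h' : StrictlyIncreasing φ q') : StrictlyIncreasing φ (q + q') := fun a b hab => by
  by_cases h0 : q a b = 0
  · exact h' a b (by simpa [h0] using hab)
  · exact h a b h0

theorem StrictlyIncreasing.neg {q : Matrix G G ℤ} (h : StrictlyIncreasing φ q) :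
    StrictlyIncreasing φ (-q) := fun a b hab => h a b (by simpa using hab)

theorem weaklyIncreasing_diagonal [DecidableEq G] (f : G → ℤ) :
    WeaklyIncreasing φ (diagonal f) := fun a b hab => by
  obtain rfl : a = b := by by_contra h; exact hab (diagonal_apply_ne _ h)
  exact le_rfl

variable [Fintype G]

theorem WeaklyIncreasing.mul {q q' : Matrix G G ℤ} (h : WeaklyIncreasing φ q)
    (h' : WeaklyIncreasing φ q') : WeaklyIncreasing φ (q * q') := fun a c hac => by
  obtain ⟨b, -, hb⟩ := Finset.exists_ne_zero_of_sum_ne_zero hac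
  exact (h a b (left_ne_zero_of_mul hb)).trans (h' b c (right_ne_zero_of_mul hb))

theorem StrictlyIncreasing.mul {q q' : Matrix G G ℤ} (h : StrictlyIncreasing φ q)
    (h' : WeaklyIncreasing φ q') : StrictlyIncreasing φ (q * q') := fun a c hac => by
  obtain ⟨b, -, hb⟩ := Finset.exists_ne_zero_of_sum_ne_zero hac
  exact (h a b (left_ne_zero_of_mul hb)).trans_le (h' b c (right_ne_zero_of_mul hb))

theorem WeaklyIncreasing.mul_strictlyIncreasing {q q' : Matrix G G ℤ} (h : WeaklyIncreasing φ q)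
    (h' : StrictlyIncreasing φ q') : StrictlyIncreasing φ (q * q') := fun a c hac => by
  obtain ⟨b, -, hb⟩ := Finset.exists_ne_zero_of_sum_ne_zero hac
  exact (h a b (left_ne_zero_of_mul hb)).trans_lt (h' b c (right_ne_zero_of_mul hb))

variable [DecidableEq G]

theorem StrictlyIncreasing.pow_card_eq_zero {q : Matrix G G ℤ} (h : StrictlyIncreasing φ q) :
    q ^ Fintype.card G = 0 := by
  classical
  have key : ∀ (k : ℕ) (a b : G), (q ^ k) a b ≠ 0 →
      k ≤ (Finset.univ.filter fun x => φ x < φ b).card := by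
    intro k
    induction k with
    | zero => intro a b _; exact Nat.zero_le _
    | succ k ih =>
      intro a c hac
      rw [pow_succ] at hac
      obtain ⟨b, -, hb⟩ := Finset.exists_ne_zero_of_sum_ne_zero hac
      have hbc := h b c (right_ne_zero_of_mul hb)
      refine (ih a b (left_ne_zero_of_mul hb)).trans_lt (Finset.card_lt_card ?_)
      refine Finset.ssubset_iff_of_subset (fun x hx => ?_) |>.2 ⟨b, ?_, ?_⟩
      · simp only [Finset.mem_filter, Finset.mem_univ, true_and] at hx ⊢
        exact hx.trans hbc
      · simpa using hbc
      · simp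
  ext a b
  by_contra hne
  refine (key _ a b hne).not_gt (Finset.card_lt_univ_of_notMem (x := b) ?_)
  simp

end Triangular

namespace BigradedBasis

variable {M : BigradedBasis} [Fintype M.gen] [DecidableEq M.gen] {α : Type*} [PartialOrder α]
  {φ : M.gen → α}

theorem exists_inverse_one_add {N : Matrix M.gen M.gen ℤ} (hN : StrictlyIncreasing φ N)
    (hd : HasDeg 0 N) : ∃ S, (1 + N) * S = 1 ∧ S * (1 + N) = 1 ∧ HasDeg 0 S ∧
      StrictlyIncreasing φ (S - 1) := by
  have hpow : ∀ k : ℕ, HasDeg (M := M) (N := M) 0 ((-N) ^ k) ∧ WeaklyIncreasing φ ((-N) ^ k) := by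
    intro k
    induction k with
    | zero =>
      rw [pow_zero]
      exact ⟨.one, by simpa using weaklyIncreasing_diagonal (φ := φ) fun _ => 1⟩
    | succ k ih =>
      rw [pow_succ]
      exact ⟨ih.1.mul hd.neg rfl, ih.2.mul hN.neg.weaklyIncreasing⟩
  have hsum : ∀ k : ℕ, HasDeg (M := M) (N := M) 0 (∑ i ∈ Finset.range k, (-N) ^ i) ∧
      WeaklyIncreasing φ (∑ i ∈ Finset.range k, (-N) ^ i) := by
    intro k
    induction k with
    | zero => exact ⟨fun _ _ h => absurd rfl h, fun _ _ h => absurd rfl h⟩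
    | succ k ih =>
      rw [Finset.sum_range_succ]
      exact ⟨ih.1.add (hpow k).1, ih.2.add (hpow k).2⟩
  have h1 := mul_neg_geom_sum (-N) (Fintype.card M.gen)
  have h2 := geom_sum_mul_neg (-N) (Fintype.card M.gen)
  rw [hN.neg.pow_card_eq_zero, sub_zero, sub_neg_eq_add] at h1 h2
  refine ⟨_, h1, h2, (hsum _).1, ?_⟩
  have h3 : ∑ i ∈ Finset.range (Fintype.card M.gen), (-N) ^ i - 1 =
      -N * ∑ i ∈ Finset.range (Fintype.card M.gen), (-N) ^ i := by
    rw [add_mul, one_mul] at h1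
    rw [neg_mul, sub_eq_iff_eq_add, ← h1]
    abel
  rw [h3]
  exact hN.neg.mul (hsum _).2

/-- Homological perturbation: if `p₀` is a homotopy for the leading part `q₀` of the differential
`q` that contracts everything but the span of the generators in `P`, then the complex is the direct
sum of a complex on these generators and of a contractible one. -/
theorem exists_decomposition {q q₀ p₀ : Matrix M.gen M.gen ℤ} (hq : HasDeg 1 q)
    (hq₀ : HasDeg 1 q₀) (hp₀ : HasDeg (-1) p₀) (hqq : q * q = 0) (hq₀w : WeaklyIncreasing φ q₀)
    (hp₀w : WeaklyIncreasing φ p₀) (hs : StrictlyIncreasing φ (q - q₀)) (hpp : p₀ * p₀ = 0)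
    (hpqp : p₀ * q₀ * p₀ = p₀) (P : M.gen → Prop) [DecidablePred P]
    (hP : 1 - q₀ * p₀ - p₀ * q₀ = diagonal fun g => if P g then 1 else 0) :
    ∃ A B : FilteredDiffModule, A.IsFilteredComplex ∧ B.IsFilteredComplex ∧ B.Contractible ∧
      A.toFilteredModule = (M.restrict P).toFilteredModule ∧
      Nonempty (FilteredDiffModule.Iso (M.withMatrix q) (A.directSum B)) := by
  obtain ⟨S, hS1, -, hSd, hSs⟩ := exists_inverse_one_add (φ := φ) (hs.mul hp₀w)
    ((hq.sub hq₀).mul hp₀ (by norm_num))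
  obtain ⟨S', -, hS2, hSd', -⟩ := exists_inverse_one_add (φ := φ)
    (hp₀w.mul_strictlyIncreasing hs) (hp₀.mul (hq.sub hq₀) (by norm_num))
  set p := p₀ * S with hp
  have hp' : p = S' * p₀ := by
    calc p = S' * (1 + p₀ * (q - q₀)) * p₀ * S := by rw [hS2, one_mul]
      _ = S' * p₀ * ((1 + (q - q₀) * p₀) * S) := by noncomm_ring
      _ = S' * p₀ := by rw [hS1, mul_one]
  have hpd : HasDeg (M := M) (N := M) (-1) p := hp₀.mul hSd (by norm_num)
  have hp2 : p * p = 0 := by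
    calc p * p = S' * (p₀ * p₀) * S := by nth_rw 1 [hp']; rw [hp]; noncomm_ring
      _ = 0 := by rw [hpp]; simp
  have hpqp' : p * q * p = p := by
    calc p * q * p = S' * (p₀ * q₀ * p₀ + p₀ * (q - q₀) * p₀) * S := by
          nth_rw 1 [hp']; rw [hp]; noncomm_ring
      _ = S' * (1 + p₀ * (q - q₀)) * p₀ * S := by rw [hpqp]; noncomm_ring
      _ = p := by rw [hS2, one_mul]
  set π := 1 - q * p - p * q with hπ
  set π₀ := 1 - q₀ * p₀ - p₀ * q₀ with hπ₀
  have hππ : π * π = π := by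
    have : π * π = 1 - 2 * (q * p) - 2 * (p * q) + q * (p * q * p) + (q * (p * p) * q)
        + p * (q * q) * p + (p * q * p) * q := by rw [hπ]; noncomm_ring
    rw [this, hp2, hqq, hpqp', hπ]; noncomm_ring
  have hqπ : π * q = q * π := by
    have h1 : π * q = q - q * p * q - p * (q * q) := by rw [hπ]; noncomm_ring
    have h2 : q * π = q - q * p * q - (q * q) * p := by rw [hπ]; noncomm_ring
    rw [h1, h2, hqq]; simp
  have hπ₀π₀ : π₀ * π₀ = π₀ := by rw [hP, diagonal_mul_diagonal]; congr; ext; simp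
  have hps : StrictlyIncreasing φ (p - p₀) := by
    have : p - p₀ = p₀ * (S - 1) := by rw [hp]; noncomm_ring
    rw [this]; exact hp₀w.mul_strictlyIncreasing hSs
  have hpw : WeaklyIncreasing φ p := by
    have := hp₀w.add hps.weaklyIncreasing
    rwa [add_sub_cancel] at this
  have hT : StrictlyIncreasing φ (π - π₀) := by
    have : π - π₀ = -((q - q₀) * p + q₀ * (p - p₀) + (p * (q - q₀) + (p - p₀) * q₀)) := by
      rw [hπ, hπ₀]; noncomm_ring
    rw [this]
    exact (((hs.mul hpw).add (hq₀w.mul_strictlyIncreasing hps)).add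
      ((hpw.mul_strictlyIncreasing hs).add (hps.mul hq₀w))).neg
  have hπd : HasDeg (M := M) (N := M) 0 π :=
    (HasDeg.one.sub (hq.mul hpd (by norm_num))).sub (hpd.mul hq (by norm_num))
  have hπ₀d : HasDeg (M := M) (N := M) 0 π₀ :=
    (HasDeg.one.sub (hq₀.mul hp₀ (by norm_num))).sub (hp₀.mul hq₀ (by norm_num))
  have hπ₀w : WeaklyIncreasing φ (π₀ + π₀ - 1) := by
    rw [hP, diagonal_add, ← diagonal_one, diagonal_sub]
    exact weaklyIncreasing_diagonal _
  obtain ⟨V, hUV, hVU, hVd, -⟩ := exists_inverse_one_add (M := M) (φ := φ)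
    (hπ₀w.mul_strictlyIncreasing hT)
    (((hπ₀d.add hπ₀d).sub HasDeg.one).mul (hπd.sub hπ₀d) (by norm_num))
  set U := 1 + (π₀ + π₀ - 1) * (π - π₀) with hU
  have hUd : HasDeg (M := M) (N := M) 0 U :=
    HasDeg.one.add (((hπ₀d.add hπ₀d).sub HasDeg.one).mul (hπd.sub hπ₀d) (by norm_num))
  have hU' : U = π₀ * π + (1 - π₀) * (1 - π) := by
    have : U = 1 + 2 * (π₀ * π) - 2 * (π₀ * π₀) - π + π₀ := by rw [hU]; noncomm_ring
    rw [this, hπ₀π₀]; noncomm_ring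
  have h1 : π₀ * U = U * π := by
    have e1 : π₀ * U = π₀ * π₀ * π + (π₀ - π₀ * π₀) * (1 - π) := by rw [hU']; noncomm_ring
    have e2 : U * π = π₀ * (π * π) + (1 - π₀) * (π - π * π) := by rw [hU']; noncomm_ring
    rw [e1, e2, hππ, hπ₀π₀]; simp
  have h2 : π * V = V * π₀ := by
    calc π * V = V * U * π * V := by rw [hVU, one_mul]
      _ = V * (U * π) * V := by noncomm_ring
      _ = V * π₀ * (U * V) := by rw [← h1]; noncomm_ring
      _ = V * π₀ := by rw [hUV, mul_one]
  have hD : π₀ * (U * q * V) = U * q * V * π₀ := by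
    calc π₀ * (U * q * V) = (π₀ * U) * q * V := by noncomm_ring
      _ = U * (π * q) * V := by rw [h1]; noncomm_ring
      _ = U * q * (π * V) := by rw [hqπ]; noncomm_ring
      _ = U * q * V * π₀ := by rw [h2]; noncomm_ring
  have hblock : ∀ g h, (U * q * V) g h ≠ 0 → (P g ↔ P h) := by
    intro g h hne
    have := congrFun (congrFun hD g) h
    rw [hP, diagonal_mul, mul_diagonal] at this
    by_cases hg : P g <;> by_cases hh : P h
    · exact iff_of_true hg hh
    · rw [if_pos hg, if_neg hh, one_mul, mul_zero] at this
      exact absurd this hne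
    · rw [if_neg hg, if_pos hh, zero_mul, mul_one] at this
      exact absurd this.symm hne
    · exact iff_of_false hg hh
  have hDD : U * q * V * (U * q * V) = 0 := by
    calc U * q * V * (U * q * V) = U * q * (V * U) * q * V := by noncomm_ring
      _ = U * (q * q) * V := by rw [hVU]; noncomm_ring
      _ = 0 := by rw [hqq]; simp
  have hDp : U * q * V * (U * p * V) + U * p * V * (U * q * V) = 1 - π₀ := by
    calc U * q * V * (U * p * V) + U * p * V * (U * q * V)
        = U * q * (V * U) * p * V + U * p * (V * U) * q * V := by noncomm_ring
      _ = U * V - (U * π) * V := by rw [hVU, hπ]; noncomm_ring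
      _ = 1 - π₀ := by rw [← h1, mul_assoc, hUV, mul_one]
  have hDd : HasDeg (M := M) (N := M) 1 (U * q * V) := (hUd.mul hq rfl).mul hVd rfl
  have hpd' : HasDeg (M := M) (N := M) (-1) (U * p * V) := (hUd.mul hpd rfl).mul hVd rfl
  generalize U * p * V = E at hDp hpd'
  have hiso := nonempty_iso_directSum M P hq hUd hVd hUV hVU hblock
  generalize U * q * V = F at hDp hDd hDD hblock hiso
  let _ : Fintype (M.restrict P).gen := Fintype.ofFinite _
  let _ : Fintype (M.restrict fun g => ¬ P g).gen := Fintype.ofFinite _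
  let _ : DecidableEq (M.restrict fun g => ¬ P g).gen := Classical.decEq _
  have split : ∀ f : M.gen → ℤ, ∑ g, f g =
      ∑ g : (M.restrict P).gen, f g.1 + ∑ g : (M.restrict fun g => ¬ P g).gen, f g.1 := by
    intro f
    let eQ : {g // P g} ≃ (M.restrict P).gen := Equiv.refl _
    let eR : {g // ¬ P g} ≃ (M.restrict fun g => ¬ P g).gen := Equiv.refl _
    rw [← Fintype.sum_subtype_add_sum_subtype P]
    exact congrArg₂ _ (Fintype.sum_equiv eQ _ _ fun _ => rfl)
      (Fintype.sum_equiv eR _ _ fun _ => rfl)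
  have hsub : ∀ Q : M.gen → Prop, HasDeg (M := M.restrict Q) (N := M.restrict Q) 1
      (F.submatrix Subtype.val Subtype.val) := fun Q =>
    hDd.submatrix (Q := M.restrict Q) (R := M.restrict Q) _ _
      (fun _ => rfl) (fun _ => rfl) (fun _ => rfl) (fun _ => rfl)
  have hsub' : HasDeg (M := M.restrict fun g => ¬ P g) (N := M.restrict fun g => ¬ P g) (-1)
      (E.submatrix Subtype.val Subtype.val) :=
    hpd'.submatrix (Q := M.restrict fun g => ¬ P g) (R := M.restrict fun g => ¬ P g) _ _
      (fun _ => rfl) (fun _ => rfl) (fun _ => rfl) (fun _ => rfl)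
  refine ⟨(M.restrict P).withMatrix (F.submatrix Subtype.val Subtype.val),
    (M.restrict fun g => ¬ P g).withMatrix (F.submatrix Subtype.val Subtype.val),
    isFilteredComplex_withMatrix _ (hsub _) ?_, isFilteredComplex_withMatrix _ (hsub _) ?_,
    contractible_withMatrix _ (hsub _) hsub' ?_, rfl, hiso⟩
  · ext a b
    refine Eq.trans ?_ (congrFun (congrFun hDD a.1) b.1)
    rw [Matrix.mul_apply, Matrix.mul_apply, split]
    refine left_eq_add.2 (Finset.sum_eq_zero fun g _ => ?_)
    by_contra hne
    exact g.2 ((hblock _ _ (left_ne_zero_of_mul hne)).1 a.2)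
  · ext a b
    refine Eq.trans ?_ (congrFun (congrFun hDD a.1) b.1)
    rw [Matrix.mul_apply, Matrix.mul_apply, split]
    refine right_eq_add.2 (Finset.sum_eq_zero fun g _ => ?_)
    by_contra hne
    exact a.2 ((hblock _ _ (left_ne_zero_of_mul hne)).2 g.2)
  · ext a b
    have h3 : (F * E + E * F) a.1 b.1 = (1 : Matrix (M.restrict fun g => ¬ P g).gen _ ℤ) a b := by
      rw [hDp, hP, Matrix.sub_apply]
      by_cases h : a = b
      · subst h
        simp [a.2]
      · rw [Matrix.one_apply_ne h, Matrix.one_apply_ne fun h' => h (Subtype.ext h'),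
          diagonal_apply_ne _ fun h' => h (Subtype.ext h'), sub_zero]
    refine Eq.trans ?_ h3
    rw [Matrix.add_apply, Matrix.add_apply, Matrix.mul_apply, Matrix.mul_apply, Matrix.mul_apply,
      Matrix.mul_apply, split, split fun j => E a.1 j * F j b.1]
    refine congrArg₂ _ (right_eq_add.2 ?_) (right_eq_add.2 ?_)
    · refine Finset.sum_eq_zero fun g _ => ?_
      by_contra hne
      exact a.2 ((hblock _ _ (left_ne_zero_of_mul hne)).2 g.2)
    · refine Finset.sum_eq_zero fun g _ => ?_
      by_contra hne
      exact b.2 ((hblock _ _ (right_ne_zero_of_mul hne)).1 g.2)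

end BigradedBasis

namespace LinkDiagram

/-! ### The source-sink orientation of a planar diagram -/

/-- In a planar diagram, the edges can be oriented so that at every crossing the ends point
alternately towards the crossing and away from it. -/
theorem exists_sourceSink (D : LinkDiagram) :
    ∃ f : Fin D.n × Fin 4 → Bool, (∀ a, f (D.opp a) = !f a) ∧ ∀ c i, f (c, i + 1) = !f (c, i) := by
  classical
  obtain ⟨g, hg, -⟩ := exists_alternating D.opp D.opp D.opp_opp D.opp_ne D.opp_opp D.opp_ne
  let T : Fin D.n × Fin 4 → Fin D.n × Fin 4 := fun a => ((D.opp a).1, (D.opp a).2 + 1)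
  have hT : Function.Bijective T := by
    refine (Finite.injective_iff_bijective).1 fun a b hab => ?_
    obtain ⟨h1, h2⟩ := Prod.mk.inj hab
    have h2 := add_right_cancel h2
    rw [← D.opp_opp a, ← D.opp_opp b, Prod.ext h1 h2]
  let rF := fun a b : Fin D.n × Fin 4 => b = ((D.opp a).1, (D.opp a).2 + 1)
  let rC := fun a b : Fin D.n × Fin 4 => b = D.opp a ∨ b.1 = a.1
  let F := Quot rF
  let C := Quot rC
  let S := {a : Fin D.n × Fin 4 // g a = true}
  let _ : Fintype F := Fintype.ofFinite F
  let _ : Fintype C := Fintype.ofFinite C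
  have hpl : D.n + Fintype.card F = 2 * D.n + 2 * Fintype.card C := by
    rw [← Nat.card_eq_fintype_card, ← Nat.card_eq_fintype_card]; exact D.planar
  let face : Fin D.n × Fin 4 → F := Quot.mk rF
  let comp : Fin D.n × Fin 4 → C := Quot.mk rC
  have face_T : ∀ a, face (T a) = face a := fun a => (Quot.sound (r := rF) rfl).symm
  have comp_opp : ∀ a, comp (D.opp a) = comp a := fun a => (Quot.sound (r := rC) (Or.inl rfl)).symm
  have comp_vertex : ∀ c i j, comp (c, i) = comp (c, j) := fun c i j => Quot.sound (r := rC) (Or.inr rfl)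
  have eS : S ≃ {a : Fin D.n × Fin 4 // ¬ g a = true} :=
    { toFun := fun s => ⟨D.opp s.1, by rw [hg, s.2]; simp⟩
      invFun := fun s => ⟨D.opp s.1, by rw [hg, Bool.eq_false_of_not_eq_true s.2]; rfl⟩
      left_inv := fun s => Subtype.ext (D.opp_opp _)
      right_inv := fun s => Subtype.ext (D.opp_opp _) }
  have hcard : Fintype.card S = 2 * D.n := by
    have h := Fintype.card_subtype_compl fun a : Fin D.n × Fin 4 => g a = true
    have h' := Fintype.card_subtype_le fun a : Fin D.n × Fin 4 => g a = true
    rw [← Fintype.card_congr eS, Fintype.card_prod, Fintype.card_fin, Fintype.card_fin] at h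
    rw [Fintype.card_prod, Fintype.card_fin, Fintype.card_fin] at h'
    change Fintype.card S = D.n * 4 - Fintype.card S at h
    change Fintype.card S ≤ _ at h'
    omega
  have hsum : ∀ w : Fin D.n × Fin 4 → ZMod 2, ∑ s : S, (w s.1 + w (D.opp s.1)) = ∑ a, w a := by
    intro w
    rw [← Fintype.sum_subtype_add_sum_subtype (fun a => g a = true), Finset.sum_add_distrib]
    congr 1
    refine Fintype.sum_bijective (fun s : S =>
      (⟨D.opp s.1, by rw [hg, s.2]; simp⟩ : {a : Fin D.n × Fin 4 // ¬ g a = true}))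
      ⟨fun a b h => Subtype.ext ?_, fun b => ⟨⟨D.opp b.1, ?_⟩, ?_⟩⟩ _ _ fun _ => rfl
    · have := congrArg (fun x => D.opp x.1) h
      simpa [D.opp_opp] using this
    · rw [hg, Bool.eq_false_of_not_eq_true b.2]; rfl
    · exact Subtype.ext (D.opp_opp _)
  let δ : (Fin D.n → ZMod 2) →ₗ[ZMod 2] (S → ZMod 2) :=
    LinearMap.funLeft _ _ (fun s : S => s.1.1) +
      LinearMap.funLeft _ _ (fun s : S => (D.opp s.1).1)
  let τ : (F → ZMod 2) →ₗ[ZMod 2] (S → ZMod 2) :=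
    LinearMap.funLeft _ _ (fun s : S => face s.1) +
      LinearMap.funLeft _ _ (fun s : S => face (D.opp s.1))
  have two : ∀ x y : ZMod 2, x + y = 0 → x = y := by decide
  have two' : ∀ x : ZMod 2, x + x = 0 := by decide
  let faceComp : F → C := Quot.lift comp (by
    rintro a b rfl
    exact (comp_opp a).symm.trans (comp_vertex _ _ _))
  have kerδ : LinearMap.ker δ ≤ LinearMap.range
      (LinearMap.funLeft (ZMod 2) (ZMod 2) fun c : Fin D.n => comp (c, 0)) := by
    intro ε hε
    have h1 : ∀ a, ε (D.opp a).1 = ε a.1 := by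
      intro a
      by_cases ha : g a = true
      · exact (two _ _ (congrFun hε ⟨a, ha⟩)).symm
      · have : ε (D.opp a).1 = ε (D.opp (D.opp a)).1 :=
          two _ _ (congrFun hε ⟨D.opp a, by rw [hg, Bool.eq_false_of_not_eq_true ha]; rfl⟩)
        rwa [D.opp_opp] at this
    refine ⟨Quot.lift (fun a => ε a.1) ?_, rfl⟩
    rintro a b (rfl | h)
    · exact (h1 a).symm
    · exact congrArg ε h.symm
  have kerτ : LinearMap.ker τ ≤
      LinearMap.range (LinearMap.funLeft (ZMod 2) (ZMod 2) faceComp) := by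
    intro φ hφ
    have h1 : ∀ a, φ (face (D.opp a)) = φ (face a) := by
      intro a
      by_cases ha : g a = true
      · exact (two _ _ (congrFun hφ ⟨a, ha⟩)).symm
      · have : φ (face (D.opp a)) = φ (face (D.opp (D.opp a))) :=
          two _ _ (congrFun hφ ⟨D.opp a, by rw [hg, Bool.eq_false_of_not_eq_true ha]; rfl⟩)
        rwa [D.opp_opp] at this
    have h2 : ∀ c i, φ (face (c, i + 1)) = φ (face (c, i)) := by
      intro c i
      have h := face_T (D.opp (c, i))
      simp only [T, D.opp_opp] at h
      rw [h, h1]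
    have h3 : ∀ c i, φ (face (c, i)) = φ (face (c, 0)) := by
      intro c i
      fin_cases i
      · rfl
      · exact h2 c 0
      · exact (h2 c 1).trans (h2 c 0)
      · exact ((h2 c 2).trans (h2 c 1)).trans (h2 c 0)
    refine ⟨Quot.lift (fun a => φ (face a)) ?_, ?_⟩
    · rintro a ⟨c, i⟩ (h | h)
      · rw [h, h1]
      · obtain rfl : c = a.1 := h
        rw [h3 a.1 i, ← h3 a.1 a.2]
    · funext x
      obtain ⟨a, rfl⟩ := Quot.exists_rep x
      rfl
  let M : Matrix S F (ZMod 2) := LinearMap.toMatrix' τ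
  let σ : (S → ZMod 2) →ₗ[ZMod 2] (F → ZMod 2) := M.transpose.mulVecLin
  have hσ : ∀ θ : Fin D.n × Fin 4 → ZMod 2,
      (∀ a, θ (D.opp a) + θ (T (D.opp a)) = θ a + θ (T a)) →
        σ (fun s => θ s.1 + θ (T s.1)) = 0 := by
    intro θ hθ
    funext x
    have hM : ∀ s : S, M s x = (if face s.1 = x then 1 else 0) +
        (if face (D.opp s.1) = x then 1 else 0) := by
      intro s
      change LinearMap.toMatrix' τ s x = _
      rw [LinearMap.toMatrix'_apply]
      change (Pi.single x 1 : F → ZMod 2) (face s.1) + (Pi.single x 1 : F → ZMod 2) _ = _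
      simp only [Pi.single_apply]
    change ∑ s : S, M s x * (θ s.1 + θ (T s.1)) = 0
    have h1 : ∀ s : S, M s x * (θ s.1 + θ (T s.1)) =
        (if face s.1 = x then θ s.1 + θ (T s.1) else 0) +
          (if face (D.opp s.1) = x then θ (D.opp s.1) + θ (T (D.opp s.1)) else 0) := by
      intro s
      rw [hM, hθ, add_mul, ite_mul, ite_mul]
      simp
    simp_rw [h1]
    rw [hsum fun a => if face a = x then θ a + θ (T a) else 0]
    have h2 : ∀ a, (if face a = x then θ a + θ (T a) else 0) =
        (if face a = x then θ a else 0) + (if face (T a) = x then θ (T a) else 0) := by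
      intro a
      rw [face_T]
      split_ifs <;> simp
    simp_rw [h2]
    rw [Finset.sum_add_distrib, hT.sum_comp fun a => if face a = x then θ a else 0]
    exact two' _
  have hle : LinearMap.range δ ≤ LinearMap.ker σ := by
    rintro _ ⟨ε, rfl⟩
    exact hσ (fun a => ε a.1) fun a => by simp only [T, D.opp_opp]; exact add_comm _ _
  have heq : LinearMap.range δ = LinearMap.ker σ := by
    refine Submodule.eq_of_le_of_finrank_le hle ?_
    have e1 := LinearMap.finrank_range_add_finrank_ker δ
    have e2 := LinearMap.finrank_range_add_finrank_ker σ
    have e3 := LinearMap.finrank_range_add_finrank_ker τ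
    have e4 := Submodule.finrank_mono kerδ
    have e5 := Submodule.finrank_mono kerτ
    have e6 := LinearMap.finrank_range_le
      (LinearMap.funLeft (ZMod 2) (ZMod 2) fun c : Fin D.n => comp (c, 0))
    have e7 := LinearMap.finrank_range_le (LinearMap.funLeft (ZMod 2) (ZMod 2) faceComp)
    have e8 : Module.finrank (ZMod 2) (LinearMap.range σ) =
        Module.finrank (ZMod 2) (LinearMap.range τ) := by
      have h1 : M.transpose.rank = M.rank := Matrix.rank_transpose M
      have h2 : M.mulVecLin = τ := by
        rw [← Matrix.toLin'_apply']; exact Matrix.toLin'_toMatrix' τ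
      rw [Matrix.rank, Matrix.rank, h2] at h1
      exact h1
    rw [Module.finrank_fintype_fun_eq_card] at e1 e2 e3 e6 e7
    rw [Fintype.card_fin] at e1
    omega
  let θ : Fin D.n × Fin 4 → ZMod 2 := fun a => (a.2.val : ZMod 2)
  have hθ1 : ∀ i : Fin 4, (((i + 1).val : ℕ) : ZMod 2) = (i.val : ZMod 2) + 1 := by decide
  have hω : (fun s : S => θ s.1 + θ (T s.1)) ∈ LinearMap.range δ := by
    rw [heq]
    refine hσ θ fun a => ?_
    simp only [T, θ, D.opp_opp, hθ1]
    ring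
  obtain ⟨ε, hε⟩ := hω
  have key : ∀ a, ε a.1 + ε (D.opp a).1 = θ a + θ (D.opp a) + 1 := by
    intro a
    by_cases ha : g a = true
    · refine (congrFun hε ⟨a, ha⟩).trans ?_
      simp only [T, θ, hθ1]
      ring
    · have := congrFun hε ⟨D.opp a, by rw [hg, Bool.eq_false_of_not_eq_true ha]; rfl⟩
      change ε (D.opp a).1 + ε (D.opp (D.opp a)).1 = θ (D.opp a) + θ (T (D.opp a)) at this
      simp only [T, θ, hθ1, D.opp_opp] at this
      rw [add_comm, this]
      ring
  refine ⟨fun a => decide (ε a.1 + θ a = 0), fun a => ?_, fun c i => ?_⟩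
  · have h : ∀ x1 x2 x3 x4 : ZMod 2, x1 + x2 = x3 + x4 + 1 →
        decide (x2 + x4 = 0) = !decide (x1 + x3 = 0) := by decide
    exact h _ _ _ _ (key a)
  · have h : ∀ x1 x2 : ZMod 2, decide (x1 + (x2 + 1) = 0) = !decide (x1 + x2 = 0) := by decide
    simp only [θ, hθ1]
    exact h _ _

end LinkDiagram

namespace LinkDiagram

/-! ### Connected components of partially smoothed diagrams -/

variable {D : LinkDiagram}

/-- The points `a` and `b` lie in the same component of the diagram `ρ`. -/
def Joined (ρ : D.PartialSmoothing) (a b : D.Point) : Prop :=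
  (Quot.mk _ a : D.Components ρ) = Quot.mk _ b

/-- A Kauffman state, as a partial smoothing. -/
abbrev ofState (s : D.KauffmanState) : D.PartialSmoothing := fun c => some (s c)

theorem circleOf_eq_iff {s : D.KauffmanState} {a b : D.Point} :
    D.circleOf s a = D.circleOf s b ↔ Joined (ofState s) a b := Iff.rfl

theorem circleOf_out (s : D.KauffmanState) (γ : D.Circles s) : D.circleOf s γ.out = γ :=
  Quot.out_eq γ

theorem circleOf_surjective (s : D.KauffmanState) : Function.Surjective (D.circleOf s) :=
  Quot.exists_rep

namespace Joined

variable {ρ ρ' : D.PartialSmoothing} {a b x : D.Point}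

theorem refl (a : D.Point) : Joined ρ a a := rfl

theorem symm (h : Joined ρ a b) : Joined ρ b a := Eq.symm h

theorem trans (h : Joined ρ a b) (h' : Joined ρ b x) : Joined ρ a x := Eq.trans h h'

theorem edge (a : Fin D.n × Fin 4) : Joined ρ (.inl a) (.inl (D.opp a)) := Quot.sound (.edge a)

theorem crossing {c : Fin D.n} (h : ρ c = none) (i j : Fin 4) :
    Joined ρ (.inl (c, i)) (.inl (c, j)) := Quot.sound (.crossing c i j h)

theorem through (c : Fin D.n) (i : Fin 4) :
    Joined ρ (.inl (c, i)) (.inl (c, through (ρ c) i)) := by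
  cases h : ρ c with
  | none => exact crossing h _ _
  | some b => exact Quot.sound (.smoothing c b i h)

theorem iff_of_invariant {p : D.Point → Prop} (hp : ∀ x y, D.Adj ρ x y → (p x ↔ p y))
    (h : Joined ρ a b) : p a ↔ p b :=
  iff_of_eq (congrArg (Quot.lift p fun x y hxy => propext (hp x y hxy)) h)

/-- A path survives if the diagram is changed at crossings that the path does not meet, or if
smoothed crossings are restored. -/
theorem transfer (h : Joined ρ a b)
    (hρ : ∀ c, ρ' c = none ∨ ρ' c = ρ c ∨ ∀ i, ¬ Joined ρ a (.inl (c, i))) : Joined ρ' a b := by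
  have key : ∀ x y, D.Adj ρ x y → Joined ρ a x ∧ Joined ρ' a x → Joined ρ a y ∧ Joined ρ' a y := by
    rintro x y hxy ⟨h1, h2⟩
    have h3 : Joined ρ a y := h1.trans (Quot.sound hxy)
    refine ⟨h3, h2.trans ?_⟩
    cases hxy with
    | edge a => exact edge a
    | crossing c i j hc =>
      rcases hρ c with h | h | h
      · exact crossing h _ _
      · exact crossing (h.trans hc) _ _
      · exact absurd h1 (h i)
    | smoothing c b i hc =>
      rcases hρ c with h | h | h
      · exact crossing h _ _
      · have := through (ρ := ρ') c i
        rwa [h, hc] at this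
      · exact absurd h1 (h i)
  have key' : ∀ x y, D.Adj ρ x y → Joined ρ a y ∧ Joined ρ' a y → Joined ρ a x ∧ Joined ρ' a x := by
    rintro x y hxy ⟨h1, h2⟩
    have h3 : Joined ρ a x := h1.trans (Quot.sound hxy).symm
    refine ⟨h3, h2.trans (Joined.symm ?_)⟩
    cases hxy with
    | edge a => exact edge a
    | crossing c i j hc =>
      rcases hρ c with h | h | h
      · exact crossing h _ _
      · exact crossing (h.trans hc) _ _
      · exact absurd h1 (h j)
    | smoothing c b i hc =>
      rcases hρ c with h | h | h
      · exact crossing h _ _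
      · have := through (ρ := ρ') c i
        rwa [h, hc] at this
      · exact absurd h1 (h _)
  exact ((h.iff_of_invariant fun x y hxy => ⟨key x y hxy, key' x y hxy⟩).1 ⟨refl a, refl a⟩).2

theorem mono (h : Joined ρ a b) (hρ : ∀ c, ρ' c = none ∨ ρ' c = ρ c) : Joined ρ' a b :=
  h.transfer fun c => (hρ c).imp_right Or.inl

theorem end_of_some {c : Fin D.n} {b : Bool} (h : ρ c = some b) (i : Fin 4) :
    Joined ρ (.inl (c, 0)) (.inl (c, i)) ∨ Joined ρ (.inl (c, 2)) (.inl (c, i)) := by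
  have h0 := through (ρ := ρ) c 0
  have h2 := through (ρ := ρ) c 2
  rw [h] at h0 h2
  cases b <;> fin_cases i
  · exact .inl (.refl _)
  · exact .inl h0
  · exact .inr (.refl _)
  · exact .inr h2
  · exact .inl (.refl _)
  · exact .inr h2
  · exact .inr (.refl _)
  · exact .inl h0

end Joined

theorem isConn_iff {ρ : D.PartialSmoothing} :
    D.IsConn ρ ↔ Nonempty D.Point ∧ ∀ a b, Joined ρ a b := by
  rw [IsConn, Nat.card_eq_one_iff_unique, and_comm]
  refine and_congr ⟨fun ⟨x⟩ => ?_, fun ⟨x⟩ => ⟨Quot.mk _ x⟩⟩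
    ⟨fun h a b => Subsingleton.elim _ _, fun h => ⟨fun x y => ?_⟩⟩
  · obtain ⟨a, -⟩ := Quot.exists_rep x
    exact ⟨a⟩
  · obtain ⟨a, rfl⟩ := Quot.exists_rep x
    obtain ⟨b, rfl⟩ := Quot.exists_rep y
    exact h a b

theorem IsConn.mono {ρ ρ' : D.PartialSmoothing} (h : D.IsConn ρ)
    (hρ : ∀ c, ρ' c = none ∨ ρ' c = ρ c) : D.IsConn ρ' :=
  isConn_iff.2 ⟨(isConn_iff.1 h).1, fun a b => ((isConn_iff.1 h).2 a b).mono hρ⟩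

/-- Smoothing the crossing `c` cuts the component of `c` into at most two pieces. -/
theorem Joined.cut {ρ ρ' : D.PartialSmoothing} {a : D.Point} {c : Fin D.n} {b : Bool} {i : Fin 4}
    (h : Joined ρ a (.inl (c, i))) (hc : ρ' c = some b) (hρ : ∀ c', c' ≠ c → ρ' c' = ρ c') :
    Joined ρ' a (.inl (c, 0)) ∨ Joined ρ' a (.inl (c, 2)) := by
  by_contra! hne
  have hi : ¬ Joined ρ' a (.inl (c, i)) := fun h' => by
    rcases Joined.end_of_some hc i with h1 | h1
    · exact hne.1 (h'.trans h1.symm)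
    · exact hne.2 (h'.trans h1.symm)
  have key : ∀ x y, D.Adj ρ x y → (Joined ρ' a x ↔ Joined ρ' a y) := by
    intro x y hxy
    have hend : ∀ i, ¬ Joined ρ' a (.inl (c, i)) := fun i h' => by
      rcases Joined.end_of_some hc i with h1 | h1
      · exact hne.1 (h'.trans h1.symm)
      · exact hne.2 (h'.trans h1.symm)
    have hj : ∀ {x y}, Joined ρ' x y → (Joined ρ' a x ↔ Joined ρ' a y) := fun h =>
      ⟨fun h' => h'.trans h, fun h' => h'.trans h.symm⟩
    cases hxy with
    | edge a => exact hj (.edge a)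
    | crossing c' i j h' =>
      by_cases hcc : c' = c
      · subst hcc; exact iff_of_false (hend _) (hend _)
      · exact hj (.crossing ((hρ _ hcc).trans h') _ _)
    | smoothing c' b' i h' =>
      by_cases hcc : c' = c
      · subst hcc; exact iff_of_false (hend _) (hend _)
      · have := Joined.through (ρ := ρ') c' i
        rw [hρ _ hcc, h'] at this
        exact hj this
  exact hi ((h.iff_of_invariant key).1 (.refl a))

/-! ### Changing one smoothing of a Kauffman state -/

theorem sameCycle_iff_not_sameCycle {Y : Type*} [Finite Y] [DecidableEq Y] {P Q : Equiv.Perm Y}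
    {C : Set Y} {x y : Y} (hxy : x ≠ y) (hx : x ∈ C) (hP : ∀ z ∈ C, P z ∈ C)
    (hQ : ∀ z ∈ C, Q z = Equiv.swap x y (P z)) : P.SameCycle x y ↔ ¬ Q.SameCycle x y := by
  have hpow : ∀ m : ℕ, P^[m] x ∈ C := by
    intro m
    induction m with
    | zero => exact hx
    | succ m ih => rw [Function.iterate_succ_apply']; exact hP _ ih
  have hex : ∃ k, 0 < k ∧ (P^[k] x = x ∨ P^[k] x = y) := by
    refine ⟨orderOf P, orderOf_pos P, Or.inl ?_⟩
    rw [← Equiv.Perm.coe_pow, pow_orderOf_eq_one]; rfl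
  classical
  let k := Nat.find hex
  obtain ⟨hk, hk'⟩ : 0 < k ∧ (P^[k] x = x ∨ P^[k] x = y) := Nat.find_spec hex
  have hmin : ∀ j, 0 < j → j < k → P^[j] x ≠ x ∧ P^[j] x ≠ y := fun j hj hjk => by
    have := Nat.find_min hex hjk
    rw [not_and_or, not_or] at this
    exact this.resolve_left (not_not.2 hj)
  have hagree : ∀ j, j < k → Q^[j] x = P^[j] x := by
    intro j
    induction j with
    | zero => intro _; rfl
    | succ j ih =>
      intro hj
      have h := hmin _ (Nat.succ_pos j) hj
      rw [Function.iterate_succ_apply'] at h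
      rw [Function.iterate_succ_apply', Function.iterate_succ_apply', ih (by omega),
        hQ _ (hpow j), Equiv.swap_apply_of_ne_of_ne h.1 h.2]
  have hQk : Q^[k] x = Equiv.swap x y (P^[k] x) := by
    obtain ⟨j, hj⟩ : ∃ j, k = j + 1 := ⟨k - 1, by omega⟩
    rw [hj, Function.iterate_succ_apply', Function.iterate_succ_apply', hagree j (by omega),
      hQ _ (hpow j)]
  have hsc : ∀ {R : Equiv.Perm Y}, R.SameCycle x y ↔ ∃ m : ℕ, R^[m] x = y := by
    intro R
    constructor
    · intro h
      obtain ⟨m, -, -, hm⟩ := h.exists_pow_eq''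
      exact ⟨m, by rw [← Equiv.Perm.coe_pow]; exact hm⟩
    · rintro ⟨m, hm⟩
      exact ⟨m, by rw [zpow_natCast, Equiv.Perm.coe_pow]; exact hm⟩
  have hnot : ∀ {R : Equiv.Perm Y}, R^[k] x = x → (∀ j < k, R^[j] x ≠ y) → ¬ R.SameCycle x y := by
    intro R h1 h2 h
    obtain ⟨m, hm⟩ := hsc.1 h
    have h3 : Function.IsPeriodicPt R k x := h1
    rw [← h3.iterate_mod_apply] at hm
    exact h2 _ (Nat.mod_lt _ hk) hm
  rcases hk' with h | h
  · rw [h, Equiv.swap_apply_left] at hQk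
    refine iff_of_false (hnot h fun j hj => ?_) (not_not.2 (hsc.2 ⟨k, hQk⟩))
    rcases Nat.eq_zero_or_pos j with rfl | hj'
    · exact hxy
    · exact (hmin j hj' hj).2
  · rw [h, Equiv.swap_apply_right] at hQk
    refine iff_of_true (hsc.2 ⟨k, h⟩) (hnot hQk fun j hj => ?_)
    rw [hagree j hj]
    rcases Nat.eq_zero_or_pos j with rfl | hj'
    · exact hxy
    · exact (hmin j hj' hj).2

theorem through_through (u : Option Bool) (i : Fin 4) : through u (through u i) = i := by
  revert u i; decide

/-- One step along the circles of a Kauffman state. -/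
def step (D : LinkDiagram) (s : D.KauffmanState) : Equiv.Perm (Fin D.n × Fin 4) :=
  (Function.Involutive.toPerm D.opp D.opp_opp).trans
    (Function.Involutive.toPerm (fun a => (a.1, through (some (s a.1)) a.2)) fun a => by
      simp [through_through])

theorem step_apply (s : D.KauffmanState) (a : Fin D.n × Fin 4) :
    D.step s a = ((D.opp a).1, through (some (s (D.opp a).1)) (D.opp a).2) := rfl

theorem joined_iff_sameCycle {f : Fin D.n × Fin 4 → Bool} (hf : ∀ a, f (D.opp a) = !f a)
    (hf' : ∀ c i, f (c, i + 1) = !f (c, i)) (s : D.KauffmanState) {a b : Fin D.n × Fin 4}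
    (hab : f a = f b) : Joined (ofState s) (.inl a) (.inl b) ↔ (D.step s).SameCycle a b := by
  have hthr : ∀ c i, f (c, through (some (s c)) i) = !f (c, i) := by
    intro c i
    have h0 := hf' c 0
    have h1 := hf' c 1
    have h2 := hf' c 2
    have h3 := hf' c 3
    cases s c <;> fin_cases i <;> simp_all [through]
  have hstep : ∀ x, f (D.step s x) = f x := fun x => by
    rw [step_apply, hthr, hf, Bool.not_not]
  constructor
  · intro h
    let p : D.Point → Prop := fun x => ∃ y, x = .inl y ∧
      ((D.step s).SameCycle a y ∨ (D.step s).SameCycle a (D.opp y))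
    have hp : ∀ x y, D.Adj (ofState s) x y → p x → p y := by
      rintro x y hxy ⟨z, rfl, hz⟩
      cases hxy with
      | edge => exact ⟨_, rfl, by rw [D.opp_opp]; exact hz.symm⟩
      | crossing c i j h => simp at h
      | smoothing c b' i h =>
        obtain rfl : s c = b' := Option.some.inj h
        refine ⟨_, rfl, hz.symm.imp (fun h1 => ?_) fun h1 => ?_⟩
        · have h2 : D.step s (D.opp (c, i)) = (c, through (some (s c)) i) := by
            rw [step_apply, D.opp_opp]
          rw [← h2]
          exact Equiv.Perm.sameCycle_apply_right.2 h1
        · have h2 : D.step s (D.opp (c, through (some (s c)) i)) = (c, i) := by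
            rw [step_apply, D.opp_opp, through_through]
          rw [← h2] at h1
          exact Equiv.Perm.sameCycle_apply_right.1 h1
    have hadj : ∀ x y, D.Adj (ofState s) x y → D.Adj (ofState s) y x := by
      intro x y hxy
      cases hxy with
      | edge a =>
        have := Adj.edge (D := D) (ρ := ofState s) (D.opp a)
        rwa [D.opp_opp] at this
      | crossing c i j h => simp at h
      | smoothing c b' i h =>
        have := Adj.smoothing (D := D) (ρ := ofState s) c b' (_root_.through (some b') i) h
        rwa [through_through] at this
    obtain ⟨y, hy, hy'⟩ := (h.iff_of_invariant (p := p) fun x y hxy =>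
      ⟨hp x y hxy, hp y x (hadj x y hxy)⟩).1 ⟨a, rfl, Or.inl (.refl _ _)⟩
    obtain rfl := Sum.inl.inj hy
    refine hy'.resolve_right fun h1 => ?_
    have hinv : ∀ z, (D.step s).SameCycle a z → f z = f a := by
      rintro z h
      obtain ⟨m, -, -, rfl⟩ := h.exists_pow_eq''
      clear h
      induction m with
      | zero => rfl
      | succ m ih => rw [pow_succ', Equiv.Perm.mul_apply, hstep, ih]
    have := hinv _ h1
    rw [hf, hab] at this
    simp at this
  · intro h
    obtain ⟨m, -, -, rfl⟩ := h.exists_pow_eq''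
    clear h hab
    induction m with
    | zero => exact .refl _
    | succ m ih =>
      rw [pow_succ', Equiv.Perm.mul_apply, step_apply]
      exact (ih.trans (.edge _)).trans (.through (ρ := ofState s) _ _)

/-- Changing the smoothing of one crossing either merges two circles or splits one circle. -/
theorem joined_update_iff (s : D.KauffmanState) (c : Fin D.n) :
    Joined (ofState (Function.update s c (!s c))) (.inl (c, 0)) (.inl (c, 2)) ↔
      ¬ Joined (ofState s) (.inl (c, 0)) (.inl (c, 2)) := by
  obtain ⟨f, hf, hf'⟩ := D.exists_sourceSink
  have h02 : f (c, 0) = f (c, 2) := by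
    have h0 := hf' c 0
    have h1 := hf' c 1
    rw [show (2 : Fin 4) = 1 + 1 from rfl, h1, show (1 : Fin 4) = 0 + 1 from rfl, h0, Bool.not_not]
  have h01 : f (c, 1) = !f (c, 0) := hf' c 0
  have hthr : ∀ s : D.KauffmanState, ∀ c i, f (c, through (some (s c)) i) = !f (c, i) := by
    intro s c i
    have h0 := hf' c 0
    have h1 := hf' c 1
    have h2 := hf' c 2
    have h3 := hf' c 3
    cases s c <;> fin_cases i <;> simp_all [through]
  rw [joined_iff_sameCycle hf hf' _ h02, joined_iff_sameCycle hf hf' _ h02, iff_not_comm]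
  refine sameCycle_iff_not_sameCycle (C := {z | f z = f (c, 0)}) (by simp) rfl
    (fun z hz => ?_) fun z hz => ?_
  · change f (D.step s z) = _
    rw [step_apply, hthr, hf, Bool.not_not]
    exact hz
  · have hy : f (D.opp z) = !f (c, 0) := by rw [hf]; exact congrArg _ hz
    rw [step_apply, step_apply]
    generalize D.opp z = y at hy
    obtain ⟨c', i⟩ := y
    by_cases hc : c' = c
    · subst hc
      simp only [Function.update_self]
      have h2 : i = 1 ∨ i = 3 := by
        fin_cases i
        · simp at hy
        · exact .inl rfl
        · change f (c', 2) = _ at hy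
          rw [← h02] at hy
          simp at hy
        · exact .inr rfl
      rcases h2 with rfl | rfl <;> cases s c'
      · exact (Equiv.swap_apply_left _ _).symm
      · exact (Equiv.swap_apply_right _ _).symm
      · exact (Equiv.swap_apply_right _ _).symm
      · exact (Equiv.swap_apply_left _ _).symm
    · rw [Function.update_of_ne hc, Equiv.swap_apply_of_ne_of_ne] <;>
        exact fun h => hc (congrArg Prod.fst h)

/-! ### Counting circles -/

theorem card_components_of_joined {ρ : D.PartialSmoothing} {c : Fin D.n}
    (h : Joined ρ (.inl (c, 0)) (.inl (c, 2))) :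
    Nat.card (D.Components ρ) = Nat.card (D.Components (Function.update ρ c none)) := by
  have hend : ∀ i, Joined ρ (.inl (c, 0)) (.inl (c, i)) := by
    intro i
    cases hc : ρ c with
    | none => exact .crossing hc _ _
    | some b => exact (Joined.end_of_some hc i).elim id h.trans
  refine Nat.card_congr ⟨Quot.lift (fun a => Quot.mk _ a) fun a b hab => ?_,
    Quot.lift (fun a => Quot.mk _ a) fun a b hab => ?_, ?_, ?_⟩
  · refine Joined.mono (ρ := ρ) (Quot.sound hab) fun c' => ?_
    by_cases h' : c' = c
    · subst h'; simp
    · simp [h']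
  · cases hab with
    | edge a => exact Joined.edge a
    | crossing c' i j hc =>
      by_cases h' : c' = c
      · subst h'; exact (hend i).symm.trans (hend j)
      · rw [Function.update_of_ne h'] at hc
        exact Joined.crossing hc i j
    | smoothing c' b i hc =>
      by_cases h' : c' = c
      · subst h'; simp at hc
      · rw [Function.update_of_ne h'] at hc
        have := Joined.through (ρ := ρ) c' i
        rwa [hc] at this
  · rintro ⟨a⟩; rfl
  · rintro ⟨a⟩; rfl

theorem card_components_of_not_joined {ρ : D.PartialSmoothing} {c : Fin D.n} {b : Bool}
    (hc : ρ c = some b) (h : ¬ Joined ρ (.inl (c, 0)) (.inl (c, 2))) :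
    Nat.card (D.Components ρ) = Nat.card (D.Components (Function.update ρ c none)) + 1 := by
  classical
  have hmono : ∀ {x y}, Joined ρ x y → Joined (Function.update ρ c none) x y := fun hxy =>
    hxy.mono fun c' => by
      by_cases h' : c' = c
      · subst h'; simp
      · simp [h']
  have hcr : ∀ i j, Joined (Function.update ρ c none) (.inl (c, i)) (.inl (c, j)) := fun i j =>
    .crossing (by simp) i j
  let v : D.Components ρ := Quot.mk _ (.inl (c, 2))
  have hcard : Nat.card (D.Components ρ) = Nat.card {γ : D.Components ρ // γ ≠ v} + 1 := by
    let _ : Fintype (D.Components ρ) := Fintype.ofFinite _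
    rw [Nat.card_eq_fintype_card, Nat.card_eq_fintype_card]
    have h1 := Fintype.card_subtype_compl fun γ : D.Components ρ => γ = v
    have h2 : 0 < Fintype.card (D.Components ρ) := Fintype.card_pos_iff.2 ⟨v⟩
    rw [Fintype.card_subtype_eq] at h1
    change Fintype.card {γ : D.Components ρ // γ ≠ v} = _ at h1
    omega
  rw [hcard, Nat.add_right_cancel_iff]
  let f : D.Point → D.Components ρ := fun a =>
    if Joined ρ (.inl (c, 2)) a then Quot.mk _ (.inl (c, 0)) else Quot.mk _ a
  have hf : ∀ {a b}, Joined ρ a b → f a = f b := by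
    intro a b hab
    by_cases ha : Joined ρ (.inl (c, 2)) a
    · simp only [f, if_pos ha, if_pos (ha.trans hab)]
    · have hb : ¬ Joined ρ (.inl (c, 2)) b := fun hb => ha (hb.trans hab.symm)
      simp only [f, if_neg ha, if_neg hb]
      exact hab
  have hfc : ∀ i, f (.inl (c, i)) = Quot.mk _ (.inl (c, 0)) := by
    intro i
    rcases Joined.end_of_some hc i with h1 | h1
    · rw [← hf h1]
      exact if_neg fun h' => h h'.symm
    · exact if_pos h1
  have hv : ∀ a, f a ≠ v := by
    intro a ha
    by_cases h' : Joined ρ (.inl (c, 2)) a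
    · simp only [f, if_pos h'] at ha
      exact h ha
    · simp only [f, if_neg h'] at ha
      exact h' (Eq.symm ha)
  refine Nat.card_congr ⟨fun γ => Quot.lift (fun a => Quot.mk _ a) (fun a b hab => hmono
    (Quot.sound hab)) γ.1, Quot.lift (fun a => ⟨f a, hv a⟩) fun a b hab => ?_, ?_, ?_⟩
  · refine Subtype.ext ?_
    cases hab with
    | edge a => exact hf (Joined.edge a)
    | crossing c' i j hc' =>
      by_cases h' : c' = c
      · subst h'; exact (hfc i).trans (hfc j).symm
      · rw [Function.update_of_ne h'] at hc'
        exact hf (Joined.crossing hc' i j)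
    | smoothing c' b' i hc' =>
      by_cases h' : c' = c
      · subst h'; simp at hc'
      · rw [Function.update_of_ne h'] at hc'
        have := Joined.through (ρ := ρ) c' i
        rw [hc'] at this
        exact hf this
  · rintro ⟨⟨a⟩, ha⟩
    exact Subtype.ext (if_neg fun h' => ha (Eq.symm h'))
  · rintro ⟨a⟩
    change Quot.lift _ _ (f a) = _
    by_cases h' : Joined ρ (.inl (c, 2)) a
    · simp only [f, if_pos h']
      exact (hcr 0 2).trans (hmono h')
    · simp only [f, if_neg h']

theorem ofState_update (s : D.KauffmanState) (c : Fin D.n) (b : Bool) :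
    Function.update (ofState (Function.update s c b)) c none =
      Function.update (ofState s) c none := by
  funext c'
  by_cases h : c' = c
  · subst h; simp
  · simp [h]

/-- The number of circles increases by one if the circle at `c` is split. -/
theorem card_circles_update {s : D.KauffmanState} {c : Fin D.n}
    (h : Joined (ofState s) (.inl (c, 0)) (.inl (c, 2))) :
    Nat.card (D.Circles (Function.update s c (!s c))) = Nat.card (D.Circles s) + 1 := by
  have h' : ¬ Joined (ofState (Function.update s c (!s c))) (.inl (c, 0)) (.inl (c, 2)) := fun h' =>
    (joined_update_iff s c).1 h' h
  have h1 := card_components_of_joined h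
  have h2 := card_components_of_not_joined (b := !s c) (by simp) h'
  rw [ofState_update, ← h1] at h2
  exact h2

/-- The number of circles decreases by one if two circles at `c` are merged. -/
theorem card_circles_update' {s : D.KauffmanState} {c : Fin D.n}
    (h : ¬ Joined (ofState s) (.inl (c, 0)) (.inl (c, 2))) :
    Nat.card (D.Circles (Function.update s c (!s c))) + 1 = Nat.card (D.Circles s) := by
  have h1 := card_components_of_joined ((joined_update_iff s c).2 h)
  have h2 := card_components_of_not_joined (b := s c) (by simp) h
  rw [ofState_update] at h1
  exact (congrArg (· + 1) h1).trans h2.symm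

/-! ### Circles that do not meet a given crossing -/

/-- A component that avoids the crossings where two diagrams differ is a component of both. -/
theorem Joined.of_transfer {ρ ρ' : D.PartialSmoothing} {a b : D.Point} (h : Joined ρ' a b)
    (hρ : ∀ c, ρ c = ρ' c ∨ ∀ i, ¬ Joined ρ a (.inl (c, i))) : Joined ρ a b := by
  have hj : ∀ {x y}, Joined ρ x y → (Joined ρ a x ↔ Joined ρ a y) := fun h =>
    ⟨fun h' => h'.trans h, fun h' => h'.trans h.symm⟩
  refine (h.iff_of_invariant (p := Joined ρ a) fun x y hxy => ?_).1 (.refl a)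
  cases hxy with
  | edge a => exact hj (.edge a)
  | crossing c i j h' =>
    rcases hρ c with h | h
    · exact hj (.crossing (h.trans h') _ _)
    · exact iff_of_false (h _) (h _)
  | smoothing c b i h' =>
    rcases hρ c with h | h
    · have := Joined.through (ρ := ρ) c i
      rw [h, h'] at this
      exact hj this
    · exact iff_of_false (h _) (h _)

/-- The circle through `a` in the state `s` meets the crossing `c`. -/
def Touches (s : D.KauffmanState) (c : Fin D.n) (a : D.Point) : Prop :=
  Joined (ofState s) a (.inl (c, 0)) ∨ Joined (ofState s) a (.inl (c, 2))

theorem not_touches_iff {s : D.KauffmanState} {c : Fin D.n} {a : D.Point} :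
    ¬ Touches s c a ↔ ∀ i, ¬ Joined (ofState s) a (.inl (c, i)) := by
  refine ⟨fun h i h' => h ?_, fun h h' => h'.elim (h 0) (h 2)⟩
  exact (Joined.end_of_some (ρ := ofState s) rfl i).imp (fun h1 => h'.trans h1.symm)
    fun h1 => h'.trans h1.symm

theorem Touches.congr {s : D.KauffmanState} {c : Fin D.n} {a b : D.Point} (h : Touches s c a)
    (hab : Joined (ofState s) a b) : Touches s c b :=
  h.imp hab.symm.trans hab.symm.trans

section Untouched

variable {s t : D.KauffmanState} {c : Fin D.n} {a b : D.Point}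

theorem joined_iff_of_not_touches (hst : ∀ c', c' ≠ c → s c' = t c') (ha : ¬ Touches s c a) :
    Joined (ofState s) a b ↔ Joined (ofState t) a b := by
  constructor
  · intro h
    refine h.transfer fun c' => ?_
    by_cases hc : c' = c
    · subst hc; exact .inr (.inr (not_touches_iff.1 ha))
    · exact .inr (.inl (congrArg some (hst c' hc).symm))
  · intro h
    refine h.of_transfer fun c' => ?_
    by_cases hc : c' = c
    · subst hc; exact .inr (not_touches_iff.1 ha)
    · exact .inl (congrArg some (hst c' hc))

theorem touches_iff (hst : ∀ c', c' ≠ c → s c' = t c') : Touches s c a ↔ Touches t c a := by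
  rw [← not_iff_not]
  constructor
  · intro ha h
    exact ha (h.imp (joined_iff_of_not_touches hst ha).2 (joined_iff_of_not_touches hst ha).2)
  · intro ha h
    have hst' : ∀ c', c' ≠ c → t c' = s c' := fun c' h => (hst c' h).symm
    exact ha (h.imp (joined_iff_of_not_touches hst' ha).2 (joined_iff_of_not_touches hst' ha).2)

/-- The circles of the state `s` that do not meet the crossing `c`. -/
abbrev FarCircles (s : D.KauffmanState) (c : Fin D.n) : Type :=
  {γ : D.Circles s // ¬ Touches s c γ.out}

noncomputable instance (s : D.KauffmanState) (c : Fin D.n) : Fintype (FarCircles s c) :=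
  Fintype.ofFinite _

theorem joined_out (s : D.KauffmanState) (a : D.Point) :
    Joined (ofState s) (D.circleOf s a).out a := circleOf_out s (D.circleOf s a)

/-- Circles that do not meet a crossing survive a change of the smoothing there. -/
noncomputable def farCirclesEquiv (hst : ∀ c', c' ≠ c → s c' = t c') :
    FarCircles s c ≃ FarCircles t c where
  toFun γ := ⟨D.circleOf t γ.1.out, fun h =>
    γ.2 ((touches_iff hst).2 (h.congr (joined_out t _)))⟩
  invFun γ := ⟨D.circleOf s γ.1.out, fun h =>
    γ.2 ((touches_iff hst).1 (h.congr (joined_out s _)))⟩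
  left_inv γ := Subtype.ext <| by
    refine Eq.trans ?_ (circleOf_out s γ.1)
    refine ((joined_iff_of_not_touches hst ?_).2 (joined_out t _).symm).symm
    exact γ.2
  right_inv γ := Subtype.ext <| by
    have hst' : ∀ c', c' ≠ c → t c' = s c' := fun c' h => (hst c' h).symm
    refine Eq.trans ?_ (circleOf_out t γ.1)
    exact ((joined_iff_of_not_touches hst' γ.2).2 (joined_out s _).symm).symm

theorem touches_out_iff (γ : D.Circles s) : Touches s c γ.out ↔
    γ = D.circleOf s (.inl (c, 0)) ∨ γ = D.circleOf s (.inl (c, 2)) := by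
  conv_rhs => rw [← circleOf_out s γ]
  rfl

open Classical in
@[to_additive]
theorem prod_circles {R : Type*} [CommMonoid R] (s : D.KauffmanState) (c : Fin D.n)
    (F : D.Circles s → R) : ∏ γ, F γ =
      (if Joined (ofState s) (.inl (c, 0)) (.inl (c, 2)) then F (D.circleOf s (.inl (c, 0)))
        else F (D.circleOf s (.inl (c, 0))) * F (D.circleOf s (.inl (c, 2)))) *
      ∏ γ : FarCircles s c, F γ.1 := by
  rw [← Finset.prod_filter_mul_prod_filter_not Finset.univ fun γ : D.Circles s =>
    Touches s c γ.out]
  congr 1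
  · have : (Finset.univ.filter fun γ : D.Circles s => Touches s c γ.out) =
        {D.circleOf s (.inl (c, 0)), D.circleOf s (.inl (c, 2))} := by
      ext γ
      simp [touches_out_iff]
    rw [this]
    split_ifs with h
    · rw [circleOf_eq_iff.2 h, Finset.pair_eq_singleton, Finset.prod_singleton]
    · rw [Finset.prod_pair fun h' => h (circleOf_eq_iff.1 h')]
  · refine Finset.prod_subtype _ (fun γ => ?_) F
    simp

end Untouched

/-! ### The coefficients of the differential -/

/-- The generator `h` is obtained from `g` by a change at the crossing `c`. -/
def IsEdge (c : Fin D.n) (g h : D.khovanovModule.gen) : Prop :=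
  g.1 c = false ∧ h.1 = Function.update g.1 c true ∧
    ∀ a, ¬ Touches g.1 c a → h.2 (D.circleOf h.1 a) = g.2 (D.circleOf g.1 a)

open Classical in
/-- The coefficient of the multiplication or comultiplication at the crossing `c`. -/
noncomputable def localCoeff (m Δ : Bool → Bool → Bool → ℤ) (c : Fin D.n)
    (g h : D.khovanovModule.gen) : ℤ :=
  if ¬ Joined (ofState g.1) (.inl (c, 0)) (.inl (c, 2)) then
    m (g.2 (D.circleOf g.1 (.inl (c, 0)))) (g.2 (D.circleOf g.1 (.inl (c, 2))))
      (h.2 (D.circleOf h.1 (.inl (c, 0))))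
  else if ¬ Joined (ofState h.1) (.inl (c, 0)) (.inl (c, 2)) then
    Δ (g.2 (D.circleOf g.1 (.inl (c, 0))))
      (h.2 (D.circleOf h.1 (.inl (c, 0)))) (h.2 (D.circleOf h.1 (.inl (c, 2))))
  else 0

/-- The sign of a change at the crossing `c`. -/
def edgeSign (s : D.KauffmanState) (c : Fin D.n) : ℤ :=
  (-1) ^ (Finset.univ.filter fun c' => c' < c ∧ s c' = true).card

open Classical in
theorem cubeCoeff_eq_sum (m Δ : Bool → Bool → Bool → ℤ) (g h : D.khovanovModule.gen) :
    D.cubeCoeff m Δ g h =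
      ∑ c, if IsEdge c g h then edgeSign g.1 c * localCoeff m Δ c g h else 0 := by
  refine Finset.sum_congr rfl fun c _ => ?_
  have hiff : (g.1 c = false ∧ h.1 = Function.update g.1 c true ∧
      ∀ a : D.Point, D.circleOf g.1 a ≠ D.circleOf g.1 (.inl (c, 0)) →
          D.circleOf g.1 a ≠ D.circleOf g.1 (.inl (c, 2)) →
          h.2 (D.circleOf h.1 a) = g.2 (D.circleOf g.1 a)) ↔ IsEdge c g h := by
    refine and_congr_right' (and_congr_right' (forall_congr' fun a => ?_))
    rw [Touches, not_or, and_imp]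
    rfl
  by_cases hE : IsEdge c g h
  · rw [if_pos hE, if_pos (hiff.2 hE)]
    congr 1
  · rw [if_neg hE, if_neg fun h' => hE (hiff.1 h')]

/-- The multiplication of Lee's deformation `ℤ[X]/(X² - 1)`. -/
def totalMul (a b c : Bool) : ℤ := khMul a b c + leeMul a b c

/-- The comultiplication of Lee's deformation `ℤ[X]/(X² - 1)`. -/
def totalComul (a b c : Bool) : ℤ := khComul a b c + leeComul a b c

/-- The matrix of Lee's differential. -/
noncomputable def leeMatrix (D : LinkDiagram) :
    Matrix D.khovanovModule.gen D.khovanovModule.gen ℤ :=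
  fun g h => D.cubeCoeff totalMul totalComul g h

theorem leeMatrix_apply (g h : D.khovanovModule.gen) : D.leeMatrix g h =
    D.cubeCoeff khMul khComul g h + D.cubeCoeff leeMul leeComul g h := by
  classical
  rw [leeMatrix, cubeCoeff_eq_sum, cubeCoeff_eq_sum, cubeCoeff_eq_sum, ← Finset.sum_add_distrib]
  refine Finset.sum_congr rfl fun c _ => ?_
  unfold localCoeff totalMul totalComul
  split_ifs <;> ring

theorem IsEdge.eq {c c' : Fin D.n} {g h : D.khovanovModule.gen} (hc : IsEdge c g h)
    (hc' : IsEdge c' g h) : c = c' := by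
  by_contra hne
  have h1 := congrFun (hc.2.1.symm.trans hc'.2.1) c
  rw [Function.update_self, Function.update_of_ne hne, hc.1] at h1
  simp at h1

theorem IsEdge.leeMatrix_eq {c : Fin D.n} {g h : D.khovanovModule.gen} (hc : IsEdge c g h) :
    D.leeMatrix g h = edgeSign g.1 c * localCoeff totalMul totalComul c g h := by
  classical
  rw [leeMatrix, cubeCoeff_eq_sum, Finset.sum_eq_single c, if_pos hc]
  · exact fun c' _ hne => if_neg fun h' => hne (h'.eq hc)
  · exact fun h => absurd (Finset.mem_univ c) h

theorem exists_isEdge {g h : D.khovanovModule.gen} (hne : D.leeMatrix g h ≠ 0) :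
    ∃ c, IsEdge c g h ∧ localCoeff totalMul totalComul c g h ≠ 0 := by
  classical
  rw [leeMatrix, cubeCoeff_eq_sum] at hne
  obtain ⟨c, -, hc⟩ := Finset.exists_ne_zero_of_sum_ne_zero hne
  by_cases h' : IsEdge c g h
  · rw [if_pos h'] at hc
    exact ⟨c, h', right_ne_zero_of_mul hc⟩
  · exact absurd (if_neg h') hc

theorem IsEdge.eq_off {c : Fin D.n} {g h : D.khovanovModule.gen} (hc : IsEdge c g h) :
    ∀ c', c' ≠ c → g.1 c' = h.1 c' := fun c' h' => by rw [hc.2.1, Function.update_of_ne h']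

theorem IsEdge.joined_iff {c : Fin D.n} {g h : D.khovanovModule.gen} (hc : IsEdge c g h) :
    Joined (ofState h.1) (.inl (c, 0)) (.inl (c, 2)) ↔
      ¬ Joined (ofState g.1) (.inl (c, 0)) (.inl (c, 2)) := by
  rw [hc.2.1]
  have := joined_update_iff g.1 c
  rwa [hc.1] at this

theorem IsEdge.prim_eq {c : Fin D.n} {g h : D.khovanovModule.gen} (hc : IsEdge c g h) :
    D.khovanovModule.prim h = D.khovanovModule.prim g + 1 := by
  change ((Finset.univ.filter fun c' => h.1 c' = true).card : ℤ) =
    (Finset.univ.filter fun c' => g.1 c' = true).card + 1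
  have : (Finset.univ.filter fun c' => h.1 c' = true) =
      insert c (Finset.univ.filter fun c' => g.1 c' = true) := by
    ext c'
    by_cases h' : c' = c
    · subst h'; simp [hc.2.1]
    · simp [hc.eq_off c' h', h']
  rw [this, Finset.card_insert_of_notMem (by simp [hc.1])]
  push_cast
  ring

theorem IsEdge.sum_far_eq {c : Fin D.n} {g h : D.khovanovModule.gen} (hc : IsEdge c g h) :
    ∑ γ : FarCircles h.1 c, labelDeg (h.2 γ.1) = ∑ γ : FarCircles g.1 c, labelDeg (g.2 γ.1) := by
  refine (Fintype.sum_equiv (farCirclesEquiv hc.eq_off) _ _ fun γ => ?_).symm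
  have := hc.2.2 γ.1.out γ.2
  rw [circleOf_out] at this
  exact congrArg labelDeg this.symm

theorem IsEdge.sec_eq {c : Fin D.n} {g h : D.khovanovModule.gen} (hc : IsEdge c g h) :
    (¬ Joined (ofState g.1) (.inl (c, 0)) (.inl (c, 2)) →
      D.khovanovModule.sec h + labelDeg (g.2 (D.circleOf g.1 (.inl (c, 0)))) +
          labelDeg (g.2 (D.circleOf g.1 (.inl (c, 2)))) =
        D.khovanovModule.sec g + labelDeg (h.2 (D.circleOf h.1 (.inl (c, 0)))) + 1) ∧
    (Joined (ofState g.1) (.inl (c, 0)) (.inl (c, 2)) →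
      D.khovanovModule.sec h + labelDeg (g.2 (D.circleOf g.1 (.inl (c, 0)))) =
        D.khovanovModule.sec g + labelDeg (h.2 (D.circleOf h.1 (.inl (c, 0)))) +
          labelDeg (h.2 (D.circleOf h.1 (.inl (c, 2)))) + 1) := by
  have h1 : D.khovanovModule.sec h = ∑ γ, labelDeg (h.2 γ) + D.khovanovModule.prim h := rfl
  have h2 : D.khovanovModule.sec g = ∑ γ, labelDeg (g.2 γ) + D.khovanovModule.prim g := rfl
  have h3 := hc.sum_far_eq
  rw [hc.prim_eq, sum_circles _ c] at h1
  rw [sum_circles _ c] at h2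
  have h4 := hc.joined_iff
  constructor <;> intro hj
  · rw [if_pos (h4.2 hj)] at h1
    rw [if_neg hj] at h2
    linarith
  · rw [if_neg (fun h' => h4.1 h' hj)] at h1
    rw [if_pos hj] at h2
    linarith

theorem hasDeg_leeMatrix (D : LinkDiagram) : BigradedBasis.HasDeg 1 D.leeMatrix := by
  intro g h hne
  obtain ⟨c, hc, hl⟩ := exists_isEdge hne
  refine ⟨hc.prim_eq, ?_⟩
  have hm : ∀ a b c, totalMul a b c ≠ 0 → labelDeg a + labelDeg b ≤ labelDeg c + 1 := by decide
  have hΔ : ∀ a b c, totalComul a b c ≠ 0 → labelDeg a ≤ labelDeg b + labelDeg c + 1 := by decide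
  unfold localCoeff at hl
  split_ifs at hl with h1 h2
  · exact absurd rfl hl
  · have := hc.sec_eq.2 h1
    have := hΔ _ _ _ hl
    linarith
  · have := hc.sec_eq.1 h1
    have := hm _ _ _ hl
    linarith

/-! ### The square of Lee's differential

Evaluating the labels at `X = ± 1` diagonalizes Lee's deformation. -/

open Classical in
noncomputable instance (D : LinkDiagram) : Fintype D.khovanovModule.gen :=
  inferInstanceAs (Fintype (Σ s : D.KauffmanState, (D.Circles s → Bool)))

/-- The generator given by a state with labels on its circles. -/
def mkGen (s : D.KauffmanState) (ℓ : D.Circles s → Bool) : D.khovanovModule.gen := ⟨s, ℓ⟩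

/-- The value of the label at `X = x`. -/
def labelEval (b : Bool) (x : ℤ) : ℤ := if b then 1 else x

/-- The value of a labelled state where `X` is evaluated at `κ`. -/
noncomputable def evalGen (κ : D.Point → ℤ) (g : D.khovanovModule.gen) : ℤ :=
  ∏ γ, labelEval (g.2 γ) (κ γ.out)

theorem evalGen_mkGen (κ : D.Point → ℤ) (s : D.KauffmanState) (ℓ : D.Circles s → Bool) :
    evalGen κ (mkGen s ℓ) = ∏ γ, labelEval (ℓ γ) (κ γ.out) := rfl

open Classical in
theorem localCoeff_mkGen (m Δ : Bool → Bool → Bool → ℤ) (c : Fin D.n) (s t : D.KauffmanState)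
    (ℓ : D.Circles s → Bool) (ℓ' : D.Circles t → Bool) :
    localCoeff m Δ c (mkGen s ℓ) (mkGen t ℓ') =
      if ¬ Joined (ofState s) (.inl (c, 0)) (.inl (c, 2)) then
        m (ℓ (D.circleOf s (.inl (c, 0)))) (ℓ (D.circleOf s (.inl (c, 2))))
          (ℓ' (D.circleOf t (.inl (c, 0))))
      else if ¬ Joined (ofState t) (.inl (c, 0)) (.inl (c, 2)) then
        Δ (ℓ (D.circleOf s (.inl (c, 0)))) (ℓ' (D.circleOf t (.inl (c, 0))))
          (ℓ' (D.circleOf t (.inl (c, 2))))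
      else 0 := rfl

open Classical in
/-- Evaluation at `κ` of the part that belongs to the state `t`. -/
noncomputable def evalState (κ : D.Point → ℤ) (t : D.KauffmanState)
    (g : D.khovanovModule.gen) : ℤ := if g.1 = t then evalGen κ g else 0

/-- The function `κ` is constant on the circles of the state `t`. -/
def ConstantOn (κ : D.Point → ℤ) (t : D.KauffmanState) : Prop :=
  ∀ a b, Joined (ofState t) a b → κ a = κ b

open Classical in
/-- The factor by which the evaluation changes at the crossing `c` of `t`. -/
noncomputable def weight (κ : D.Point → ℤ) (t : D.KauffmanState) (c : Fin D.n) : ℤ :=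
  if κ (.inl (c, 0)) = κ (.inl (c, 2)) then
    if Joined (ofState t) (.inl (c, 0)) (.inl (c, 2)) then 1 else 2 * κ (.inl (c, 0))
  else 0

theorem ConstantOn.update {κ : D.Point → ℤ} {t : D.KauffmanState} (hκ : ConstantOn κ t)
    {c : Fin D.n} (hc : κ (.inl (c, 0)) = κ (.inl (c, 2))) (b : Bool) :
    ConstantOn κ (Function.update t c b) := by
  intro x y hxy
  have hend : ∀ i, κ (.inl (c, i)) = κ (.inl (c, 0)) := fun i => by
    rcases Joined.end_of_some (ρ := ofState t) (c := c) rfl i with h | h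
    · exact (hκ _ _ h).symm
    · exact (hκ _ _ h).symm.trans hc.symm
  have key : ∀ x y, D.Adj (ofState (Function.update t c b)) x y → κ x = κ y := by
    intro x y h
    cases h with
    | edge a => exact hκ _ _ (.edge a)
    | crossing c' i j h' => simp at h'
    | smoothing c' b' i h' =>
      by_cases hcc : c' = c
      · subst hcc; exact (hend _).trans (hend _).symm
      · have h2 : ofState t c' = some b' := by rw [← h']; simp [Function.update_of_ne hcc]
        have := Joined.through (ρ := ofState t) c' i
        rw [h2] at this
        exact hκ _ _ this
  exact congrArg (Quot.lift κ key) hxy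

open Classical in
theorem sum_localCoeff {κ : D.Point → ℤ} (hκ1 : ∀ a, κ a = 1 ∨ κ a = -1) {s t : D.KauffmanState}
    (hκ : ConstantOn κ t) {c : Fin D.n} (hsc : s c = false) (htu : t = Function.update s c true)
    (ℓ : D.Circles s → Bool) :
    ∑ ℓ' : D.Circles t → Bool, (if IsEdge c (mkGen s ℓ) (mkGen t ℓ') then
        localCoeff totalMul totalComul c (mkGen s ℓ) (mkGen t ℓ') * evalGen κ (mkGen t ℓ') else 0) =
      weight κ t c * evalGen κ (mkGen s ℓ) := by
  have hst' : ∀ c', c' ≠ c → t c' = s c' := fun c' h' => by rw [htu, Function.update_of_ne h']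
  have hst : ∀ c', c' ≠ c → s c' = t c' := fun c' h' => (hst' c' h').symm
  have hflip : Joined (ofState s) (.inl (c, 0)) (.inl (c, 2)) ↔
      ¬ Joined (ofState t) (.inl (c, 0)) (.inl (c, 2)) := by
    have := joined_update_iff s c
    rw [hsc, Bool.not_false, ← htu] at this
    rw [this, not_not]
  have hκ' : κ (.inl (c, 0)) = κ (.inl (c, 2)) → ConstantOn κ s := fun h => by
    have := hκ.update h false
    rwa [htu, Function.update_idem, ← hsc, Function.update_eq_self] at this
  let w0 := D.circleOf t (.inl (c, 0))
  let w2 := D.circleOf t (.inl (c, 2))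
  have hEdge : ∀ ℓ' : D.Circles t → Bool,
      IsEdge c (mkGen s ℓ) (mkGen t ℓ') ↔
        ∀ γ : D.Circles t, γ ≠ w0 → γ ≠ w2 → ℓ' γ = ℓ (D.circleOf s γ.out) := by
    intro ℓ'
    constructor
    · intro h γ h0 h2
      have h3 : ¬ Touches s c γ.out := by
        rw [touches_iff hst, touches_out_iff, not_or]
        exact ⟨h0, h2⟩
      have : ℓ' (D.circleOf t γ.out) = ℓ (D.circleOf s γ.out) := h.2.2 γ.out h3
      rwa [circleOf_out] at this
    · intro h
      refine ⟨hsc, htu, fun a ha => ?_⟩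
      have h1 : ¬ Touches t c (D.circleOf t a).out := fun h' =>
        ha ((touches_iff hst).2 (h'.congr (joined_out t a)))
      have h2 := h1
      rw [touches_out_iff, not_or] at h2
      refine (h _ h2.1 h2.2).trans (congrArg ℓ ?_)
      exact (joined_iff_of_not_touches hst' h1).1 (joined_out t a)
  let R := ∏ γ : FarCircles t c, labelEval (ℓ (D.circleOf s γ.1.out)) (κ γ.1.out)
  have hκw : ∀ a, κ (D.circleOf t a).out = κ a := fun a => hκ _ _ (joined_out t a)
  have heval : ∀ ℓ' : D.Circles t → Bool, IsEdge c (mkGen s ℓ) (mkGen t ℓ') →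
      evalGen κ (mkGen t ℓ') = (if Joined (ofState t) (.inl (c, 0)) (.inl (c, 2)) then
        labelEval (ℓ' w0) (κ (.inl (c, 0)))
        else labelEval (ℓ' w0) (κ (.inl (c, 0))) * labelEval (ℓ' w2) (κ (.inl (c, 2)))) * R := by
    intro ℓ' h
    rw [evalGen_mkGen, prod_circles t c]
    rw [hκw, hκw]
    congr 1
    refine Finset.prod_congr rfl fun γ _ => ?_
    have := γ.2
    rw [touches_out_iff, not_or] at this
    rw [(hEdge ℓ').1 h _ this.1 this.2]
  have heval' : κ (.inl (c, 0)) = κ (.inl (c, 2)) → evalGen κ (mkGen s ℓ) =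
      (if Joined (ofState s) (.inl (c, 0)) (.inl (c, 2)) then
        labelEval (ℓ (D.circleOf s (.inl (c, 0)))) (κ (.inl (c, 0)))
        else labelEval (ℓ (D.circleOf s (.inl (c, 0)))) (κ (.inl (c, 0))) *
          labelEval (ℓ (D.circleOf s (.inl (c, 2)))) (κ (.inl (c, 2)))) * R := by
    intro h
    have hκs : ∀ a, κ (D.circleOf s a).out = κ a := fun a =>
      hκ' h _ _ (joined_out s a)
    rw [evalGen_mkGen, prod_circles s c]
    rw [hκs, hκs]
    congr 1
    refine (Fintype.prod_equiv (farCirclesEquiv hst') _ _ fun γ => ?_).symm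
    change _ = labelEval (ℓ (D.circleOf s γ.1.out)) (κ (D.circleOf s γ.1.out).out)
    rw [hκs]
  rw [← Finset.sum_filter]
  let T : Bool × Bool → D.Circles t → Bool := fun p γ =>
    if γ = w0 then p.1 else if γ = w2 then p.2 else ℓ (D.circleOf s γ.out)
  have hT : ∀ p, IsEdge c (mkGen s ℓ) (mkGen t (T p)) := fun p =>
    (hEdge _).2 fun γ h0 h2 => by simp only [T, if_neg h0, if_neg h2]
  by_cases hj : Joined (ofState t) (.inl (c, 0)) (.inl (c, 2))
  · have hjs := fun h' => hflip.1 h' hj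
    have hw : w2 = w0 := (circleOf_eq_iff.2 hj).symm
    have hκc := hκ _ _ hj
    have h1 : ∑ ℓ' ∈ Finset.univ.filter (fun ℓ' : D.Circles t → Bool =>
        IsEdge c (mkGen s ℓ) (mkGen t ℓ')),
        localCoeff totalMul totalComul c (mkGen s ℓ) (mkGen t ℓ') *
          evalGen κ (mkGen t ℓ') = ∑ b : Bool,
        totalMul (ℓ (D.circleOf s (.inl (c, 0)))) (ℓ (D.circleOf s (.inl (c, 2)))) b *
          (labelEval b (κ (.inl (c, 0))) * R) := by
      refine Finset.sum_bij' (fun ℓ' _ => ℓ' w0) (fun b _ => T (b, b)) (fun _ _ => Finset.mem_univ _)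
        (fun b _ => Finset.mem_filter.2 ⟨Finset.mem_univ _, hT _⟩) (fun ℓ' hℓ' => ?_)
        (fun b _ => if_pos rfl) fun ℓ' hℓ' => ?_
      · funext γ
        have := (hEdge ℓ').1 (Finset.mem_filter.1 hℓ').2 γ
        simp only [T]
        split_ifs with h0 h2
        · rw [h0]
        · rw [h2, hw]
        · exact (this h0 h2).symm
      · rw [heval _ (Finset.mem_filter.1 hℓ').2, if_pos hj, localCoeff_mkGen, if_pos hjs]
    rw [h1, weight, if_pos hκc, if_pos hj, heval' hκc, if_neg hjs, one_mul, Fintype.sum_bool,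
      ← hκc]
    rcases hκ1 (.inl (c, 0)) with h | h <;> rw [h] <;>
      cases ℓ (D.circleOf s (.inl (c, 0))) <;> cases ℓ (D.circleOf s (.inl (c, 2))) <;>
      simp [totalMul, khMul, leeMul, labelEval]
  · have hjs := hflip.2 hj
    have hw : w2 ≠ w0 := fun h' => hj (circleOf_eq_iff.1 h'.symm)
    have h1 : ∑ ℓ' ∈ Finset.univ.filter (fun ℓ' : D.Circles t → Bool =>
        IsEdge c (mkGen s ℓ) (mkGen t ℓ')),
        localCoeff totalMul totalComul c (mkGen s ℓ) (mkGen t ℓ') *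
          evalGen κ (mkGen t ℓ') = ∑ p : Bool × Bool,
        totalComul (ℓ (D.circleOf s (.inl (c, 0)))) p.1 p.2 *
          (labelEval p.1 (κ (.inl (c, 0))) * labelEval p.2 (κ (.inl (c, 2))) * R) := by
      refine Finset.sum_bij' (fun ℓ' _ => (ℓ' w0, ℓ' w2)) (fun p _ => T p)
        (fun _ _ => Finset.mem_univ _)
        (fun b _ => Finset.mem_filter.2 ⟨Finset.mem_univ _, hT _⟩) (fun ℓ' hℓ' => ?_)
        (fun p _ => ?_) fun ℓ' hℓ' => ?_
      · funext γ
        have := (hEdge ℓ').1 (Finset.mem_filter.1 hℓ').2 γ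
        simp only [T]
        split_ifs with h0 h2
        · rw [h0]
        · rw [h2]
        · exact (this h0 h2).symm
      · simp only [T, if_true, if_neg hw]
      · rw [heval _ (Finset.mem_filter.1 hℓ').2, if_neg hj, localCoeff_mkGen, if_neg (not_not.2 hjs),
          if_pos hj]
    rw [h1, weight, if_neg hj, Fintype.sum_prod_type, Fintype.sum_bool, Fintype.sum_bool,
      Fintype.sum_bool]
    by_cases hκc : κ (.inl (c, 0)) = κ (.inl (c, 2))
    · rw [if_pos hκc, heval' hκc, if_pos hjs, ← hκc]
      rcases hκ1 (.inl (c, 0)) with h | h <;> rw [h] <;>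
        cases ℓ (D.circleOf s (.inl (c, 0))) <;>
        simp [totalComul, khComul, leeComul, labelEval] <;> ring
    · rw [if_neg hκc, zero_mul]
      rcases hκ1 (.inl (c, 0)) with h | h <;> rcases hκ1 (.inl (c, 2)) with h' | h' <;>
        rw [h, h'] at hκc ⊢ <;> first | exact absurd rfl hκc | skip
      all_goals
        cases ℓ (D.circleOf s (.inl (c, 0))) <;>
        simp [totalComul, khComul, leeComul, labelEval]

open Classical in
theorem sum_gen {R : Type*} [AddCommMonoid R] (F : D.khovanovModule.gen → R) :
    ∑ g, F g = ∑ s : D.KauffmanState, ∑ ℓ : D.Circles s → Bool, F (mkGen s ℓ) :=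
  Fintype.sum_sigma fun g : Σ s : D.KauffmanState, (D.Circles s → Bool) => F g

open Classical in
theorem evalState_mkGen (κ : D.Point → ℤ) (t s : D.KauffmanState) (ℓ : D.Circles s → Bool) :
    evalState κ t (mkGen s ℓ) = if s = t then evalGen κ (mkGen s ℓ) else 0 := rfl

open Classical in
theorem leeMatrix_mulVec {κ : D.Point → ℤ} (hκ1 : ∀ a, κ a = 1 ∨ κ a = -1) {t : D.KauffmanState}
    (hκ : ConstantOn κ t) : D.leeMatrix *ᵥ evalState κ t =
      ∑ c, (if t c = true then edgeSign t c * weight κ t c else 0) •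
        evalState κ (Function.update t c false) := by
  funext g
  rw [Finset.sum_apply]
  have h0 : (D.leeMatrix *ᵥ evalState κ t) g = ∑ ℓ' : D.Circles t → Bool, ∑ c,
      (if IsEdge c g (mkGen t ℓ') then edgeSign g.1 c *
        (localCoeff totalMul totalComul c g (mkGen t ℓ') * evalGen κ (mkGen t ℓ')) else 0) := by
    change ∑ h, D.leeMatrix g h * evalState κ t h = _
    rw [sum_gen, Finset.sum_eq_single t]
    · refine Finset.sum_congr rfl fun ℓ' _ => ?_
      rw [evalState_mkGen, if_pos rfl, leeMatrix, cubeCoeff_eq_sum, Finset.sum_mul]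
      refine Finset.sum_congr rfl fun c _ => ?_
      split_ifs
      · ring
      · ring
    · intro t' _ ht'
      refine Finset.sum_eq_zero fun ℓ' _ => ?_
      rw [evalState_mkGen, if_neg ht', mul_zero]
    · exact fun h => absurd (Finset.mem_univ t) h
  rw [h0, Finset.sum_comm]
  refine Finset.sum_congr rfl fun c _ => ?_
  rw [Pi.smul_apply, smul_eq_mul]
  by_cases hg : t c = true ∧ g.1 = Function.update t c false
  · obtain ⟨hc, hg⟩ := hg
    obtain ⟨s, ℓ, rfl⟩ : ∃ s ℓ, g = mkGen s ℓ := ⟨g.1, g.2, rfl⟩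
    change s = _ at hg
    have hsc : s c = false := by rw [hg, Function.update_self]
    have htu : t = Function.update s c true := by
      rw [hg, Function.update_idem, ← hc, Function.update_eq_self]
    change ∑ ℓ' : D.Circles t → Bool, (if IsEdge c (mkGen s ℓ) (mkGen t ℓ') then edgeSign s c *
      (localCoeff totalMul totalComul c (mkGen s ℓ) (mkGen t ℓ') * evalGen κ (mkGen t ℓ')) else 0) = _
    have hsign : edgeSign s c = edgeSign t c := by
      rw [hg]
      unfold edgeSign
      congr 2
      ext c'
      simp only [Finset.mem_filter, Finset.mem_univ, true_and]
      refine and_congr_right fun h' => ?_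
      rw [Function.update_of_ne h'.ne]
    have he : evalState κ (Function.update t c false) (mkGen s ℓ) = evalGen κ (mkGen s ℓ) :=
      if_pos hg
    rw [if_pos hc, he, mul_assoc, ← sum_localCoeff hκ1 hκ hsc htu ℓ, Finset.mul_sum, hsign]
    refine Finset.sum_congr rfl fun ℓ' _ => ?_
    rw [mul_ite, mul_zero]
  · rw [Finset.sum_eq_zero]
    · by_cases hc : t c = true
      · rw [evalState, if_neg fun h => hg ⟨hc, h⟩, mul_zero]
      · rw [if_neg hc, zero_mul]
    · intro ℓ' _
      refine if_neg fun h => hg ?_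
      have h1 : t = _ := h.2.1
      refine ⟨by rw [h1, Function.update_self], ?_⟩
      rw [h1, Function.update_idem, ← h.1, Function.update_eq_self]

open Classical in
theorem ite_mul_ite_of_count {P₁ P₂ P₃ P₄ : Prop} {N A B C : ℕ} {x : ℤ}
    (h₁ : P₁ → A = N + 1) (h₁' : ¬ P₁ → A + 1 = N) (h₂ : P₂ → C = A + 1) (h₂' : ¬ P₂ → C + 1 = A)
    (h₃ : P₃ → B = N + 1) (h₃' : ¬ P₃ → B + 1 = N) (h₄ : P₄ → C = B + 1) (h₄' : ¬ P₄ → C + 1 = B) :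
    (if P₁ then 1 else x) * (if P₂ then 1 else x) =
      (if P₃ then 1 else x) * (if P₄ then 1 else x) := by
  by_cases p₁ : P₁ <;> by_cases p₂ : P₂ <;> by_cases p₃ : P₃ <;> by_cases p₄ : P₄ <;>
    simp only [p₁, p₂, p₃, p₄, if_true, if_false, one_mul, mul_one, true_implies, not_true,
      not_false_eq_true, false_implies] at * <;> omega

open Classical in
theorem ite_mul_ite_of_iff {P₁ P₂ P₃ P₄ : Prop} {x y : ℤ} (h : P₁ ↔ P₄) (h' : P₃ ↔ P₂) :
    (if P₁ then 1 else x) * (if P₂ then 1 else y) =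
      (if P₃ then 1 else y) * (if P₄ then 1 else x) := by
  simp only [h, h']
  ring

theorem weight_mul_weight {κ : D.Point → ℤ} {t : D.KauffmanState} (hκ : ConstantOn κ t)
    {c c' : Fin D.n} (hne : c ≠ c') (hc : t c = true) (hc' : t c' = true) :
    weight κ t c * weight κ (Function.update t c false) c' =
      weight κ t c' * weight κ (Function.update t c' false) c := by
  unfold weight
  by_cases h1 : κ (.inl (c, 0)) = κ (.inl (c, 2))
  swap
  · simp [h1]
  by_cases h2 : κ (.inl (c', 0)) = κ (.inl (c', 2))
  swap
  · simp [h2]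
  simp only [if_pos h1, if_pos h2]
  by_cases hx : κ (.inl (c, 0)) = κ (.inl (c', 0))
  · rw [← hx]
    have e1 := fun h => card_circles_update (s := t) (c := c) h
    have e1' := fun h => card_circles_update' (s := t) (c := c) h
    have e2 := fun h => card_circles_update (s := Function.update t c false) (c := c') h
    have e2' := fun h => card_circles_update' (s := Function.update t c false) (c := c') h
    have f1 := fun h => card_circles_update (s := t) (c := c') h
    have f1' := fun h => card_circles_update' (s := t) (c := c') h
    have f2 := fun h => card_circles_update (s := Function.update t c' false) (c := c) h
    have f2' := fun h => card_circles_update' (s := Function.update t c' false) (c := c) h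
    rw [Function.update_of_ne hne.symm, hc'] at e2 e2'
    rw [Function.update_of_ne hne, hc, Function.update_comm hne.symm] at f2 f2'
    rw [hc] at e1 e1'
    rw [hc'] at f1 f1'
    exact ite_mul_ite_of_count e1 e1' e2 e2' f1 f1' f2 f2'
  · have key : ∀ {c c' : Fin D.n}, c ≠ c' → κ (.inl (c, 0)) ≠ κ (.inl (c', 0)) →
        κ (.inl (c', 0)) = κ (.inl (c', 2)) →
        (Joined (ofState t) (.inl (c, 0)) (.inl (c, 2)) ↔
          Joined (ofState (Function.update t c' false)) (.inl (c, 0)) (.inl (c, 2))) := by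
      intro c c' _ hx h2
      refine joined_iff_of_not_touches (c := c')
        (fun d hd => (Function.update_of_ne hd _ _).symm) ?_
      rintro (h | h)
      · exact hx (hκ _ _ h)
      · exact hx ((hκ _ _ h).trans h2.symm)
    have k1 := key hne hx h2
    have k2 := key hne.symm (Ne.symm hx) h1
    exact ite_mul_ite_of_iff k1 k2

theorem leeMatrix_mulVec_mulVec {κ : D.Point → ℤ} (hκ1 : ∀ a, κ a = 1 ∨ κ a = -1)
    {t : D.KauffmanState} (hκ : ConstantOn κ t) :
    D.leeMatrix *ᵥ (D.leeMatrix *ᵥ evalState κ t) = 0 := by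
  let A (c c' : Fin D.n) : D.khovanovModule.gen → ℤ :=
    (if t c = true ∧ Function.update t c false c' = true then
      edgeSign t c * edgeSign (Function.update t c false) c' *
        (weight κ t c * weight κ (Function.update t c false) c') else 0) •
      evalState κ (Function.update (Function.update t c false) c' false)
  have h1 : D.leeMatrix *ᵥ (D.leeMatrix *ᵥ evalState κ t) = ∑ c, ∑ c', A c c' := by
    rw [leeMatrix_mulVec hκ1 hκ, mulVec_sum]
    refine Finset.sum_congr rfl fun c _ => ?_
    rw [mulVec_smul]
    by_cases hc : t c = true
    · by_cases hκc : κ (.inl (c, 0)) = κ (.inl (c, 2))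
      · rw [leeMatrix_mulVec hκ1 (hκ.update hκc false), Finset.smul_sum]
        refine Finset.sum_congr rfl fun c' _ => ?_
        rw [smul_smul]
        simp only [A, hc, true_and, if_true]
        split_ifs
        · congr 1; ring
        · simp
      · have hw : weight κ t c = 0 := if_neg hκc
        simp [A, hw]
    · simp [A, hc]
  have hanti : ∀ c c', A c c' = -A c' c := by
    intro c c'
    by_cases hne : c = c'
    · subst hne
      simp [A]
    simp only [A, Function.update_of_ne hne, Function.update_of_ne (Ne.symm hne)]
    by_cases hc : t c = true
    swap
    · simp [hc]
    by_cases hc' : t c' = true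
    swap
    · simp [hc']
    simp only [hc, hc', and_self, if_true]
    rw [weight_mul_weight hκ hne hc hc', Function.update_comm hne, ← neg_smul]
    congr 1
    rw [← neg_mul]
    congr 1
    have hsame : ∀ {c c' : Fin D.n}, c < c' → edgeSign (Function.update t c' false) c =
        edgeSign t c := by
      intro c c' h
      unfold edgeSign
      congr 2
      ext d
      simp only [Finset.mem_filter, Finset.mem_univ, true_and]
      refine and_congr_right fun h' => ?_
      rw [Function.update_of_ne (h'.trans h).ne]
    have hopp : ∀ {c c' : Fin D.n}, c < c' → t c = true →
        edgeSign t c' = -edgeSign (Function.update t c false) c' := by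
      intro c c' h hc
      unfold edgeSign
      have : (Finset.univ.filter fun d => d < c' ∧ t d = true) = insert c
          (Finset.univ.filter fun d => d < c' ∧ Function.update t c false d = true) := by
        ext d
        by_cases h' : d = c
        · subst h'; simp [h, hc]
        · simp [h']
      rw [this, Finset.card_insert_of_notMem (by simp), pow_succ]
      ring
    rcases lt_or_gt_of_ne hne with h | h
    · rw [hsame h, hopp h hc]; ring
    · rw [hsame h, hopp h hc']; ring
  have h2 : ∑ c, ∑ c', A c c' = -∑ c, ∑ c', A c c' := by
    conv_lhs => rw [Finset.sum_comm]
    rw [← Finset.sum_neg_distrib]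
    refine Finset.sum_congr rfl fun c _ => ?_
    rw [← Finset.sum_neg_distrib]
    exact Finset.sum_congr rfl fun c' _ => hanti c' c
  rw [h1]
  funext g
  have := congrFun h2 g
  rw [Pi.neg_apply] at this
  change _ = (0 : ℤ)
  linarith

/-- The evaluations at all `κ` determine an integral combination of labelled states. -/
theorem eq_zero_of_evalState (r : D.khovanovModule.gen → ℤ)
    (hr : ∀ (κ : D.Point → ℤ) (t : D.KauffmanState), (∀ a, κ a = 1 ∨ κ a = -1) → ConstantOn κ t →
      r ⬝ᵥ evalState κ t = 0) : r = 0 := by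
  classical
  funext g
  obtain ⟨t, ℓ₀, rfl⟩ : ∃ s ℓ, g = mkGen s ℓ := ⟨g.1, g.2, rfl⟩
  change r (mkGen t ℓ₀) = 0
  have h1 : ∀ v : D.Circles t → Bool, ∑ ℓ : D.Circles t → Bool,
      r (mkGen t ℓ) * ∏ γ, labelEval (ℓ γ) (labelEval (v γ) (-1)) = 0 := by
    intro v
    have h := hr (fun a => labelEval (v (D.circleOf t a)) (-1)) t
      (fun a => by cases v (D.circleOf t a) <;> simp [labelEval])
      (fun a b hab => congrArg (fun γ => labelEval (v γ) (-1)) (circleOf_eq_iff.2 hab))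
    rw [dotProduct, sum_gen, Finset.sum_eq_single t] at h
    · rw [← h]
      refine Finset.sum_congr rfl fun ℓ _ => ?_
      rw [evalState_mkGen, if_pos rfl, evalGen_mkGen]
      simp only [circleOf_out]
    · intro t' _ ht'
      refine Finset.sum_eq_zero fun ℓ' _ => ?_
      rw [evalState_mkGen, if_neg ht', mul_zero]
    · exact fun h => absurd (Finset.mem_univ t) h
  have h2 : ∑ v : D.Circles t → Bool, (∏ γ, labelEval (ℓ₀ γ) (labelEval (v γ) (-1))) *
      ∑ ℓ : D.Circles t → Bool,
        r (mkGen t ℓ) * ∏ γ, labelEval (ℓ γ) (labelEval (v γ) (-1)) = 0 :=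
    Finset.sum_eq_zero fun v _ => by rw [h1, mul_zero]
  simp_rw [Finset.mul_sum] at h2
  rw [Finset.sum_comm, Finset.sum_eq_single ℓ₀] at h2
  · have h3 : ∀ v : D.Circles t → Bool, (∏ γ, labelEval (ℓ₀ γ) (labelEval (v γ) (-1))) *
        (r (mkGen t ℓ₀) * ∏ γ, labelEval (ℓ₀ γ) (labelEval (v γ) (-1))) = r (mkGen t ℓ₀) := by
      intro v
      rw [mul_left_comm, ← Finset.prod_mul_distrib, Finset.prod_eq_one, mul_one]
      intro γ _
      cases ℓ₀ γ <;> cases v γ <;> simp [labelEval]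
    simp_rw [h3] at h2
    rw [Finset.sum_const, smul_eq_zero] at h2
    exact h2.resolve_left (Finset.card_ne_zero_of_mem (Finset.mem_univ ℓ₀))
  · intro ℓ _ hℓ
    obtain ⟨γ₀, hγ₀⟩ := Function.ne_iff.1 hℓ
    simp_rw [mul_left_comm _ (r _), ← Finset.mul_sum, ← Finset.prod_mul_distrib]
    rw [← Fintype.piFinset_univ, ← Finset.prod_univ_sum (fun _ => Finset.univ) fun γ b =>
      labelEval (ℓ₀ γ) (labelEval b (-1)) * labelEval (ℓ γ) (labelEval b (-1)),
      Finset.prod_eq_zero (Finset.mem_univ γ₀), mul_zero]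
    rw [Fintype.sum_bool]
    cases h4 : ℓ γ₀ <;> cases h5 : ℓ₀ γ₀ <;> simp_all [labelEval]
  · exact fun h => absurd (Finset.mem_univ ℓ₀) h

theorem leeMatrix_mul_self (D : LinkDiagram) : D.leeMatrix * D.leeMatrix = 0 := by
  ext g h
  refine congrFun (eq_zero_of_evalState ((D.leeMatrix * D.leeMatrix) g) fun κ t hκ1 hκ => ?_) h
  have := congrFun (leeMatrix_mulVec_mulVec hκ1 hκ) g
  rwa [mulVec_mulVec] at this

/-! ### Leaves of the binary tree -/

/-- A connected diagram where no crossing has two connected smoothings. -/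
def IsTerminal (ρ : D.PartialSmoothing) : Prop :=
  D.IsConn ρ ∧ ∀ c, ρ c = none → ∃ b, ¬ D.IsConn (Function.update ρ c (some b))

theorem leafBelow_of_notMem (s : D.KauffmanState) {c : Fin D.n} :
    ∀ (cs : List (Fin D.n)) (ρ : D.PartialSmoothing), c ∉ cs → D.leafBelow s cs ρ c = ρ c
  | [], _, _ => rfl
  | a :: cs, ρ, hc => by
    rw [List.mem_cons, not_or] at hc
    rw [leafBelow]
    split_ifs
    · rw [leafBelow_of_notMem s cs _ hc.2, Function.update_of_ne hc.1]
    · exact leafBelow_of_notMem s cs ρ hc.2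

theorem isConn_leafBelow (s : D.KauffmanState) :
    ∀ (cs : List (Fin D.n)) (ρ : D.PartialSmoothing), D.IsConn ρ → D.IsConn (D.leafBelow s cs ρ)
  | [], _, h => h
  | c :: cs, ρ, h => by
    rw [leafBelow]
    split_ifs with h'
    · refine isConn_leafBelow s cs _ ?_
      cases s c
      · exact h'.1
      · exact h'.2
    · exact isConn_leafBelow s cs ρ h

theorem exists_not_isConn_leafBelow (s : D.KauffmanState) {c : Fin D.n} :
    ∀ (cs : List (Fin D.n)) (ρ : D.PartialSmoothing), cs.Nodup → (∀ a ∈ cs, ρ a = none) → c ∈ cs →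
      D.leafBelow s cs ρ c = none →
        ∃ b, ¬ D.IsConn (Function.update (D.leafBelow s cs ρ) c (some b))
  | a :: cs, ρ, hcs, hρ, hc, hn => by
    rw [List.nodup_cons] at hcs
    have hρ' : ∀ x ∈ cs, ρ x = none := fun x hx => hρ x (List.mem_cons_of_mem _ hx)
    have hupd : ∀ b, ∀ x ∈ cs, Function.update ρ a (some b) x = none := fun b x hx => by
      have hne : x ≠ a := fun h => hcs.1 (h ▸ hx)
      rw [Function.update_of_ne hne]; exact hρ' x hx
    rw [leafBelow] at hn ⊢
    split_ifs at hn ⊢ with h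
    · rcases List.mem_cons.1 hc with rfl | hc
      · rw [leafBelow_of_notMem s cs _ hcs.1, Function.update_self] at hn
        simp at hn
      · exact exists_not_isConn_leafBelow s cs _ hcs.2 (hupd _) hc hn
    · rcases List.mem_cons.1 hc with rfl | hc
      · obtain ⟨b, hb⟩ : ∃ b, ¬ D.IsConn (Function.update ρ c (some b)) := by
          by_contra! h'
          exact h ⟨h' _, h' _⟩
        refine ⟨b, fun h' => hb (h'.mono fun x => ?_)⟩
        by_cases hx : x = c
        · subst hx; simp
        · rw [Function.update_of_ne hx, Function.update_of_ne hx]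
          by_cases hx' : x ∈ cs
          · exact .inl (hρ' x hx')
          · exact .inr (leafBelow_of_notMem s cs ρ hx').symm
      · exact exists_not_isConn_leafBelow s cs ρ hcs.2 hρ' hc hn

theorem isTerminal_leaf (hD : D.Connected) (s : D.KauffmanState) : IsTerminal (D.leaf s) :=
  ⟨isConn_leafBelow s _ _ hD, fun c hc => exists_not_isConn_leafBelow s _ _
    (List.nodup_finRange _) (fun _ _ => rfl) (List.mem_finRange c) hc⟩

theorem hasState_leaf (s : D.KauffmanState) : D.HasState (D.leaf s) s :=
  ((D.mem_T_and_hasState_iff s _).2 rfl).2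

theorem leaf_eq_of_hasState {s s' : D.KauffmanState} (h : D.HasState (D.leaf s) s') :
    D.leaf s' = D.leaf s :=
  ((D.mem_T_and_hasState_iff s' _).1 ⟨((D.mem_T_and_hasState_iff s _).2 rfl).1, h⟩).symm

theorem HasState.update {ρ : D.PartialSmoothing} {s : D.KauffmanState} (h : D.HasState ρ s)
    {c : Fin D.n} (hc : ρ c = none) (b : Bool) : D.HasState ρ (Function.update s c b) := by
  intro c' b' h'
  rw [Function.update_of_ne fun h'' => by rw [h'', hc] at h'; simp at h']
  exact h c' b' h'

theorem leafBelow_branch {s s' : D.KauffmanState} {c : Fin D.n}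
    (hs : ∀ c', c' ≠ c → s' c' = s c') :
    ∀ (cs : List (Fin D.n)) (ρ : D.PartialSmoothing), cs.Pairwise (· < ·) →
      (∀ a ∈ cs, ρ a = none) → c ∈ cs → D.leafBelow s cs ρ c ≠ none →
        D.leafBelow s' cs ρ c = some (s' c) ∧
          ∀ i < c, D.leafBelow s' cs ρ i = D.leafBelow s cs ρ i
  | a :: cs, ρ, hcs, hρ, hc, hn => by
    rw [List.pairwise_cons] at hcs
    have hρ' : ∀ x ∈ cs, ρ x = none := fun x hx => hρ x (List.mem_cons_of_mem _ hx)
    have hupd : ∀ b, ∀ x ∈ cs, Function.update ρ a (some b) x = none := fun b x hx => by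
      rw [Function.update_of_ne (hcs.1 x hx).ne']; exact hρ' x hx
    rw [leafBelow] at hn
    rw [leafBelow, leafBelow]
    by_cases hac : c = a
    · subst hac
      have hc' : ∀ i ≤ c, i ∉ cs := fun i hi h => absurd (hcs.1 i h) hi.not_gt
      split_ifs at hn ⊢
      · rw [leafBelow_of_notMem s' cs _ (hc' c le_rfl)]
        refine ⟨by simp, fun i hi => ?_⟩
        rw [leafBelow_of_notMem s' cs _ (hc' i hi.le), leafBelow_of_notMem s cs _ (hc' i hi.le),
          Function.update_of_ne hi.ne, Function.update_of_ne hi.ne]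
      · rw [leafBelow_of_notMem s cs _ (hc' c le_rfl), hρ c List.mem_cons_self] at hn
        exact absurd rfl hn
    · have hc' : c ∈ cs := (List.mem_cons.1 hc).resolve_left hac
      rw [hs a fun h => hac h.symm]
      split_ifs at hn ⊢
      · exact leafBelow_branch hs cs _ hcs.2 (hupd _) hc' hn
      · exact leafBelow_branch hs cs ρ hcs.2 hρ' hc' hn

/-- If two states differ only at a crossing where the tree branches, their leaves agree at the
crossings before it. -/
theorem leaf_branch {s s' : D.KauffmanState} {c : Fin D.n} (hs : ∀ c', c' ≠ c → s' c' = s c')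
    (hc : D.leaf s c ≠ none) :
    D.leaf s' c = some (s' c) ∧ ∀ i < c, D.leaf s' i = D.leaf s i :=
  leafBelow_branch hs _ _ (List.pairwise_lt_finRange _) (fun _ _ => rfl) (List.mem_finRange c) hc

/-! ### Crossings with a disconnecting smoothing -/

/-- A partial orientation of a component that enters a crossing must leave it. -/
theorem balance {ρ : D.PartialSmoothing} {c : Fin D.n} {b : Bool} {f : Fin D.n × Fin 4 → Bool}
    (hc : ρ c = some b) (hJ : ¬ Joined ρ (.inl (c, 0)) (.inl (c, 2)))
    (hf : ∀ a, f (D.opp a) = !f a)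
    (hf' : ∀ c', c' ≠ c → ∀ i, f (c', through (ρ c') i) = !f (c', i)) :
    f (c, through (some b) 0) = !f (c, 0) := by
  classical
  let g : Fin D.n × Fin 4 → ℤ := fun a =>
    if Joined ρ (.inl (c, 0)) (.inl a) then (if f a then 1 else -1) else 0
  have hg : ∀ x y, Joined ρ (.inl x) (.inl y) → f y = !f x → g y = - g x := by
    intro x y hxy hfxy
    by_cases hx : Joined ρ (.inl (c, 0)) (.inl x)
    · simp only [g, if_pos hx, if_pos (hx.trans hxy), hfxy]
      cases f x <;> simp
    · have hy : ¬ Joined ρ (.inl (c, 0)) (.inl y) := fun h => hx (h.trans hxy.symm)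
      simp only [g, if_neg hx, if_neg hy, neg_zero]
  have hsum : ∑ a, g a = 0 := by
    have h1 : ∑ a, g (D.opp a) = ∑ a, g a :=
      Equiv.sum_comp (Function.Involutive.toPerm D.opp D.opp_opp) g
    have h2 : ∑ a, g (D.opp a) = - ∑ a, g a := by
      rw [← Finset.sum_neg_distrib]
      exact Finset.sum_congr rfl fun a _ => hg _ _ (.edge a) (hf a)
    omega
  have hsum' : ∑ a : Fin D.n × Fin 4, g (a.1, through (ρ a.1) a.2) = ∑ a, g a :=
    Equiv.sum_comp (Function.Involutive.toPerm
      (fun a : Fin D.n × Fin 4 => (a.1, through (ρ a.1) a.2))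
      fun a => by simp [through_through]) g
  have h3 : ∑ a : Fin D.n × Fin 4, (g a + g (a.1, through (ρ a.1) a.2)) = 0 := by
    rw [Finset.sum_add_distrib, hsum', hsum, add_zero]
  rw [Fintype.sum_prod_type, Finset.sum_eq_single c] at h3
  · have h0 : g (c, 0) = if f (c, 0) then 1 else -1 := if_pos (.refl _)
    have hz : ∀ i, Joined ρ (.inl (c, 2)) (.inl (c, i)) → g (c, i) = 0 := fun i hi =>
      if_neg fun h => hJ (h.trans hi.symm)
    have h2 := hz 2 (.refl _)
    have ht0 := Joined.through (ρ := ρ) c 0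
    have ht2 := Joined.through (ρ := ρ) c 2
    rw [Fin.sum_univ_four] at h3
    simp only [hc] at h3 ht0 ht2
    cases b
    · have h4 := hz 3 ht2
      have h5 : g (c, 1) = if f (c, 1) then 1 else -1 := if_pos ht0
      change g (c, 0) + g (c, 1) + (g (c, 1) + g (c, 0)) + (g (c, 2) + g (c, 3)) +
        (g (c, 3) + g (c, 2)) = 0 at h3
      change f (c, 1) = !f (c, 0)
      rw [h0, h2, h4, h5] at h3
      revert h3
      cases f (c, 0) <;> cases f (c, 1) <;> simp
    · have h4 := hz 1 ht2
      have h5 : g (c, 3) = if f (c, 3) then 1 else -1 := if_pos ht0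
      change g (c, 0) + g (c, 3) + (g (c, 1) + g (c, 2)) + (g (c, 2) + g (c, 1)) +
        (g (c, 3) + g (c, 0)) = 0 at h3
      change f (c, 3) = !f (c, 0)
      rw [h0, h2, h4, h5] at h3
      revert h3
      cases f (c, 0) <;> cases f (c, 3) <;> simp
  · intro c' _ hc'
    refine Finset.sum_eq_zero fun i _ => ?_
    rw [hg _ _ (.through c' i) (hf' c' hc' i), add_neg_cancel]
  · exact fun h => absurd (Finset.mem_univ c) h

theorem not_joined_of_not_isConn {ρ : D.PartialSmoothing} (hρ : D.IsConn ρ) {c : Fin D.n} {b : Bool}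
    (h : ¬ D.IsConn (Function.update ρ c (some b))) :
    ¬ Joined (Function.update ρ c (some b)) (.inl (c, 0)) (.inl (c, 2)) := by
  intro hJ
  rw [isConn_iff] at hρ
  have key : ∀ a, Joined (Function.update ρ c (some b)) a (.inl (c, 0)) := fun a =>
    ((hρ.2 a (.inl (c, 0))).cut (Function.update_self c _ ρ)
      fun c' hc' => Function.update_of_ne hc' _ _).elim id fun h => h.trans hJ.symm
  exact h (isConn_iff.2 ⟨hρ.1, fun x y => (key x).trans (key y).symm⟩)

theorem Orientation.isPositive_iff {ρ : D.PartialSmoothing} (o : D.Orientation ρ)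
    (hρ : D.IsConn ρ) {c : Fin D.n} (hc : ρ c = none) {b : Bool}
    (h : ¬ D.IsConn (Function.update ρ c (some b))) : o.IsPositive c ↔ b = false := by
  have h1 := balance (f := o.out) (Function.update_self c _ ρ) (not_joined_of_not_isConn hρ h) o.edge
    fun c' hc' i => by rw [Function.update_of_ne hc']; exact o.strand c' i
  have h2 := o.strand c 1
  rw [hc] at h2
  change o.out (c, 3) = _ at h2
  unfold Orientation.IsPositive
  cases b
  · change o.out (c, 1) = _ at h1
    simp [h1]
  · change o.out (c, 3) = _ at h1
    rw [h1] at h2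
    simpa using h2

open Classical in
/-- The disconnecting smoothing of a crossing of a terminal diagram. -/
noncomputable def cutBit (ρ : D.PartialSmoothing) (c : Fin D.n) : Bool :=
  decide (¬ D.IsConn (Function.update ρ c (some true)))

/-- The diagram `ρ` with the disconnecting smoothing at `c`. -/
noncomputable def cutAt (ρ : D.PartialSmoothing) (c : Fin D.n) : D.PartialSmoothing :=
  Function.update ρ c (some (cutBit ρ c))

open Classical in
theorem eq_cutBit {ρ : D.PartialSmoothing} (hρ : IsTerminal ρ) {c : Fin D.n} (hc : ρ c = none)
    {b : Bool} (h : ¬ D.IsConn (Function.update ρ c (some b))) : b = cutBit ρ c := by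
  obtain ⟨o⟩ : Nonempty (D.Orientation ρ) := inferInstance
  cases b
  · refine (decide_eq_false fun h' => ?_).symm
    have h1 := (o.isPositive_iff hρ.1 hc h).2 rfl
    have h2 := (o.isPositive_iff hρ.1 hc h').1 h1
    simp at h2
  · exact (decide_eq_true h).symm

theorem not_isConn_cutAt {ρ : D.PartialSmoothing} (hρ : IsTerminal ρ) {c : Fin D.n}
    (hc : ρ c = none) : ¬ D.IsConn (cutAt ρ c) := by
  obtain ⟨b, hb⟩ := hρ.2 c hc
  rw [cutAt, ← eq_cutBit hρ hc hb]
  exact hb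

theorem isConn_update_not_cutBit {ρ : D.PartialSmoothing} (hρ : IsTerminal ρ) {c : Fin D.n}
    (hc : ρ c = none) : D.IsConn (Function.update ρ c (some (!cutBit ρ c))) := by
  by_contra h
  have := eq_cutBit hρ hc h
  simp at this

theorem not_joined_cutAt {ρ : D.PartialSmoothing} (hρ : IsTerminal ρ) {c : Fin D.n}
    (hc : ρ c = none) : ¬ Joined (cutAt ρ c) (.inl (c, 0)) (.inl (c, 2)) :=
  not_joined_of_not_isConn hρ.1 (not_isConn_cutAt hρ hc)

theorem Orientation.w_eq {ρ : D.PartialSmoothing} (o : D.Orientation ρ) (hρ : IsTerminal ρ) :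
    o.w = ∑ c with ρ c = none, labelDeg (cutBit ρ c) := by
  have hpos : ∀ c, ρ c = none → (o.IsPositive c ↔ cutBit ρ c = false) := fun c hc =>
    o.isPositive_iff hρ.1 hc (not_isConn_cutAt hρ hc)
  rw [Orientation.w, Orientation.x, Orientation.y, ← Finset.filter_filter, ← Finset.filter_filter,
    Finset.card_filter, Finset.card_filter]
  push_cast
  rw [← Finset.sum_sub_distrib]
  refine Finset.sum_congr rfl fun c hc => ?_
  have := hpos c (Finset.mem_filter.1 hc).2
  by_cases h : o.IsPositive c
  · simp [h, this.1 h, labelDeg]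
  · have h' : cutBit ρ c = true := by
      cases hb : cutBit ρ c
      · exact absurd (this.2 hb) h
      · rfl
    simp [h, h', labelDeg]

theorem joined_of_hasState {ρ : D.PartialSmoothing} {s : D.KauffmanState} (h : D.HasState ρ s)
    {a b : D.Point} (hab : Joined (ofState s) a b) : Joined ρ a b :=
  hab.mono fun c => by
    cases hc : ρ c with
    | none => exact .inl rfl
    | some b => exact .inr (congrArg some (h c b hc).symm)

theorem hasState_cutAt {ρ : D.PartialSmoothing} {s : D.KauffmanState} (h : D.HasState ρ s)
    {c : Fin D.n} (hc : s c = cutBit ρ c) : D.HasState (cutAt ρ c) s := by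
  intro c' b hb
  by_cases h' : c' = c
  · subst h'
    rw [cutAt, Function.update_self] at hb
    exact hc.trans (Option.some.inj hb)
  · rw [cutAt, Function.update_of_ne h'] at hb
    exact h c' b hb

/-! ### Counting the circles of the states of a terminal diagram -/

theorem isTerminal_update {ρ : D.PartialSmoothing} (hρ : IsTerminal ρ) {e : Fin D.n}
    (he : ρ e = none) : IsTerminal (Function.update ρ e (some (!cutBit ρ e))) ∧
      ∀ c, c ≠ e → ρ c = none → cutBit (Function.update ρ e (some (!cutBit ρ e))) c = cutBit ρ c := by
  have key : ∀ c, c ≠ e → ρ c = none →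
      ¬ D.IsConn (Function.update (Function.update ρ e (some (!cutBit ρ e))) c
        (some (cutBit ρ c))) := by
    intro c hce hc h
    refine not_isConn_cutAt hρ hc (h.mono fun x => ?_)
    rw [cutAt]
    by_cases hx : x = c
    · subst hx; simp
    · rw [Function.update_of_ne hx, Function.update_of_ne hx]
      by_cases hx' : x = e
      · subst hx'; exact .inl he
      · rw [Function.update_of_ne hx']; exact .inr rfl
  have hne : ∀ c, Function.update ρ e (some (!cutBit ρ e)) c = none → c ≠ e ∧ ρ c = none := by
    intro c hc
    by_cases h : c = e
    · subst h; simp at hc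
    · rw [Function.update_of_ne h] at hc; exact ⟨h, hc⟩
  have hT : IsTerminal (Function.update ρ e (some (!cutBit ρ e))) :=
    ⟨isConn_update_not_cutBit hρ he, fun c hc => ⟨_, key c (hne c hc).1 (hne c hc).2⟩⟩
  refine ⟨hT, fun c hce hc => (eq_cutBit hT ?_ (key c hce hc)).symm⟩
  rw [Function.update_of_ne hce, hc]

theorem isConn_ofState {s : D.KauffmanState} {ρ : D.PartialSmoothing} (hρ : IsTerminal ρ)
    (hs : D.HasState ρ s) (h : ∀ c, ρ c = none → s c = !cutBit ρ c) : D.IsConn (ofState s) := by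
  induction hm : (Finset.univ.filter fun c => ρ c = none).card generalizing ρ with
  | zero =>
    have : ρ = ofState s := by
      funext c
      cases hc : ρ c with
      | none =>
        rw [Finset.card_eq_zero, Finset.filter_eq_empty_iff] at hm
        exact absurd hc (hm (Finset.mem_univ c))
      | some b => exact congrArg some (hs c b hc).symm
    exact this ▸ hρ.1
  | succ m ih =>
    obtain ⟨e, he⟩ : ∃ e, e ∈ Finset.univ.filter fun c => ρ c = none :=
      Finset.card_pos.1 (by omega)
    have he' := (Finset.mem_filter.1 he).2
    obtain ⟨h1, h2⟩ := isTerminal_update hρ he'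
    refine ih h1 (fun c b hb => ?_) (fun c hc => ?_) ?_
    · by_cases hce : c = e
      · subst hce
        rw [Function.update_self] at hb
        rw [h c he', Option.some.inj hb]
      · rw [Function.update_of_ne hce] at hb
        exact hs c b hb
    · have hce : c ≠ e := fun h => by subst h; simp at hc
      rw [h2 c hce (by rwa [Function.update_of_ne hce] at hc)]
      rw [Function.update_of_ne hce] at hc
      exact h c hc
    · have : (Finset.univ.filter fun c => Function.update ρ e (some (!cutBit ρ e)) c = none) =
          (Finset.univ.filter fun c => ρ c = none).erase e := by
        ext c
        by_cases hce : c = e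
        · subst hce; simp
        · simp [hce]
      rw [this, Finset.card_erase_of_mem he, hm]
      rfl

theorem eq_not_cutBit {s : D.KauffmanState} {ρ : D.PartialSmoothing} (hρ : IsTerminal ρ)
    (hs : D.HasState ρ s) (h : D.IsConn (ofState s)) (c : Fin D.n) (hc : ρ c = none) :
    s c = !cutBit ρ c := by
  by_contra hne
  have hs' : D.HasState (cutAt ρ c) s := hasState_cutAt hs (by simpa using hne)
  rw [isConn_iff] at h
  exact not_joined_cutAt hρ hc (joined_of_hasState hs' (h.2 _ _))

theorem card_circles {s : D.KauffmanState} {ρ : D.PartialSmoothing} (hρ : IsTerminal ρ)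
    (hs : D.HasState ρ s) : Nat.card (D.Circles s) =
      (Finset.univ.filter fun c => ρ c = none ∧ s c = cutBit ρ c).card + 1 := by
  induction hm : (Finset.univ.filter fun c => ρ c = none ∧ s c = cutBit ρ c).card
    generalizing s with
  | zero =>
    refine isConn_ofState hρ hs fun c hc => ?_
    rw [Finset.card_eq_zero, Finset.filter_eq_empty_iff] at hm
    have := hm (Finset.mem_univ c)
    rw [not_and] at this
    exact Bool.eq_not_of_ne (this hc)
  | succ m ih =>
    obtain ⟨c, hc⟩ : ∃ c, c ∈ Finset.univ.filter fun c => ρ c = none ∧ s c = cutBit ρ c :=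
      Finset.card_pos.1 (by omega)
    obtain ⟨-, hc1, hc2⟩ := Finset.mem_filter.1 hc
    rw [← card_circles_update' fun h => not_joined_cutAt hρ hc1
      (joined_of_hasState (hasState_cutAt hs hc2) h), ih (hs.update hc1 _)]
    have : (Finset.univ.filter fun x => ρ x = none ∧
        Function.update s c (!s c) x = cutBit ρ x) =
          (Finset.univ.filter fun x => ρ x = none ∧ s x = cutBit ρ x).erase c := by
      ext x
      by_cases hx : x = c
      · subst hx; simp [hc2]
      · simp [hx]
    rw [this, Finset.card_erase_of_mem hc, hm]
    rfl

/-! ### The two sides of a crossing -/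

open Classical in
/-- The end in `{0, 2}` at `c` that is separated from `p` by the disconnecting smoothing of `c`. -/
noncomputable def farEnd (p : D.Point) (ρ : D.PartialSmoothing) (c : Fin D.n) : Fin 4 :=
  if Joined (cutAt ρ c) p (.inl (c, 0)) then 2 else 0

open Classical in
/-- The end in `{0, 2}` at `c` that stays joined to `p` after the disconnecting smoothing of `c`. -/
noncomputable def nearEnd (p : D.Point) (ρ : D.PartialSmoothing) (c : Fin D.n) : Fin 4 :=
  if Joined (cutAt ρ c) p (.inl (c, 0)) then 0 else 2

/-- The points separated from `p` by the disconnecting smoothing of `c`. -/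
def farSet (p : D.Point) (ρ : D.PartialSmoothing) (c : Fin D.n) : Set D.Point :=
  {a | ¬ Joined (cutAt ρ c) p a}

/-- An injective numbering of the crossings that respects the inclusion of the far sets. -/
noncomputable def height (p : D.Point) (ρ : D.PartialSmoothing) (c : Fin D.n) : ℕ :=
  (farSet p ρ c).ncard * D.n + c

theorem height_injective (p : D.Point) (ρ : D.PartialSmoothing) :
    Function.Injective (height p ρ) := by
  intro c e h
  have := congrArg (· % D.n) h
  simp only [height, Nat.mul_add_mod_self_right, Nat.mod_eq_of_lt c.2, Nat.mod_eq_of_lt e.2] at this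
  exact Fin.ext this

theorem end_cases (p : D.Point) (ρ : D.PartialSmoothing) (c : Fin D.n) :
    (farEnd p ρ c = 0 ∧ nearEnd p ρ c = 2) ∨ (farEnd p ρ c = 2 ∧ nearEnd p ρ c = 0) := by
  unfold farEnd nearEnd
  split_ifs
  · exact .inr ⟨rfl, rfl⟩
  · exact .inl ⟨rfl, rfl⟩

section Terminal

variable {p : D.Point} {ρ : D.PartialSmoothing} {c e : Fin D.n} {s : D.KauffmanState}

theorem not_joined_farEnd (hρ : IsTerminal ρ) (hc : ρ c = none) :
    ¬ Joined (cutAt ρ c) p (.inl (c, farEnd p ρ c)) := by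
  unfold farEnd
  split_ifs with h
  · exact fun h' => not_joined_cutAt hρ hc (h.symm.trans h')
  · exact h

theorem joined_nearEnd (hρ : IsTerminal ρ) (c : Fin D.n) :
    Joined (cutAt ρ c) p (.inl (c, nearEnd p ρ c)) := by
  unfold nearEnd
  split_ifs with h
  · exact h
  · exact (((isConn_iff.1 hρ.1).2 p (.inl (c, 0))).cut (Function.update_self c _ ρ)
      fun c' hc' => Function.update_of_ne hc' _ _).resolve_left h

theorem not_joined_base_farEnd (hρ : IsTerminal ρ) (hc : ρ c = none) (hs : D.HasState ρ s)
    (hsc : s c = cutBit ρ c) : ¬ Joined (ofState s) p (.inl (c, farEnd p ρ c)) := fun h =>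
  not_joined_farEnd hρ hc (joined_of_hasState (hasState_cutAt hs hsc) h)

theorem farSet_ssubset (hρ : IsTerminal ρ) (hc : ρ c = none) (he : ρ e = none) (hce : c ≠ e)
    (hs : D.HasState ρ s) (hsc : s c = cutBit ρ c) {i : Fin 4}
    (h : Joined (ofState s) (.inl (c, farEnd p ρ c)) (.inl (e, i))) :
    farSet p ρ e ⊂ farSet p ρ c := by
  have hce' : cutAt ρ c e = none := by rw [cutAt, Function.update_of_ne hce.symm, he]
  have hec : cutAt ρ e c = none := by rw [cutAt, Function.update_of_ne hce, hc]
  have h1 : ∀ j, ¬ Joined (cutAt ρ c) p (.inl (e, j)) := fun j h' =>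
    not_joined_farEnd hρ hc ((h'.trans (.crossing hce' j i)).trans
      (joined_of_hasState (hasState_cutAt hs hsc) h).symm)
  have hsub : farSet p ρ e ⊆ farSet p ρ c := fun a ha ha' => ha <| Joined.transfer ha' fun x => by
    by_cases hxe : x = e
    · subst hxe; exact .inr (.inr h1)
    · by_cases hxc : x = c
      · subst hxc; exact .inl hec
      · refine .inr (.inl ?_)
        rw [cutAt, cutAt, Function.update_of_ne hxe, Function.update_of_ne hxc]
  exact hsub.ssubset_of_mem_notMem (a := .inl (e, nearEnd p ρ e)) (h1 _)
    (not_not.2 (joined_nearEnd hρ e))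

theorem height_lt (hρ : IsTerminal ρ) (hc : ρ c = none) (he : ρ e = none) (hce : c ≠ e)
    (hs : D.HasState ρ s) (hsc : s c = cutBit ρ c) {i : Fin 4}
    (h : Joined (ofState s) (.inl (c, farEnd p ρ c)) (.inl (e, i))) :
    height p ρ e < height p ρ c := by
  have h1 := Set.ncard_lt_ncard (farSet_ssubset hρ hc he hce hs hsc h) (Set.toFinite _)
  calc height p ρ e < ((farSet p ρ e).ncard + 1) * D.n := by
        rw [height, add_mul, one_mul]; exact Nat.add_lt_add_left e.2 _
    _ ≤ (farSet p ρ c).ncard * D.n := Nat.mul_le_mul_right _ h1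
    _ ≤ height p ρ c := Nat.le_add_right _ _

theorem not_touches_farEnd (hρ : IsTerminal ρ) (hc : ρ c = none) (he : ρ e = none) (hce : c ≠ e)
    (hs : D.HasState ρ s) (hsc : s c = cutBit ρ c) (hlt : height p ρ c ≤ height p ρ e) :
    ¬ Touches s e (.inl (c, farEnd p ρ c)) := fun h => by
  rcases h with h | h <;> exact absurd (height_lt hρ hc he hce hs hsc h) hlt.not_gt

/-- The circles of the state of `ρ` where all crossings have the disconnecting smoothing. -/
theorem bijective_circles (hρ : IsTerminal ρ) (hs : D.HasState ρ s)
    (h : ∀ c, ρ c = none → s c = cutBit ρ c) :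
    Function.Bijective fun x : Option {c // ρ c = none} =>
      x.elim (D.circleOf s p) fun c => D.circleOf s (.inl (c.1, farEnd p ρ c.1)) := by
  classical
  rw [Fintype.bijective_iff_injective_and_card]
  constructor
  · have hne : ∀ c, ρ c = none → D.circleOf s p ≠ D.circleOf s (.inl (c, farEnd p ρ c)) :=
      fun c hc h' => not_joined_base_farEnd hρ hc hs (h c hc) h'
    rintro (_ | ⟨c, hc⟩) (_ | ⟨e, he⟩) hxy
    · rfl
    · exact absurd hxy (hne e he)
    · exact absurd hxy.symm (hne c hc)
    · by_contra h'
      have hce : c ≠ e := fun h'' => h' (by subst h''; rfl)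
      have h1 := height_lt hρ hc he hce hs (h c hc) hxy
      have h2 := height_lt hρ he hc hce.symm hs (h e he) hxy.symm
      exact lt_asymm h1 h2
  · rw [Fintype.card_option, ← Nat.card_eq_fintype_card (α := D.Circles s), card_circles hρ hs,
      Fintype.card_subtype]
    congr 2
    ext c
    simpa using h c

end Terminal

/-! ### The matching -/

/-- The label of the circle at an end of a crossing. -/
def endLabel (g : D.khovanovModule.gen) (c : Fin D.n) (i : Fin 4) : Bool :=
  g.2 (D.circleOf g.1 (.inl (c, i)))

theorem label_eq_of_joined (g : D.khovanovModule.gen) {a b : D.Point}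
    (h : Joined (ofState g.1) a b) : g.2 (D.circleOf g.1 a) = g.2 (D.circleOf g.1 b) :=
  congrArg g.2 (circleOf_eq_iff.2 h)

/-- At the crossing `c`, the generator `g` has the disconnecting smoothing, and the circle at the
far end has the label that the matching leaves alone. -/
def Crit (p : D.Point) (ρ : D.PartialSmoothing) (g : D.khovanovModule.gen) (c : Fin D.n) : Prop :=
  g.1 c = cutBit ρ c ∧ endLabel g c (farEnd p ρ c) = cutBit ρ c

section FixedLeaf

variable {p : D.Point} {ρ : D.PartialSmoothing} {c e : Fin D.n} {s : D.KauffmanState}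
  {g h h' : D.khovanovModule.gen}

theorem joined_ends_iff (hρ : IsTerminal ρ) (he : ρ e = none) (hs : D.HasState ρ s) :
    Joined (ofState s) (.inl (e, 0)) (.inl (e, 2)) ↔ s e ≠ cutBit ρ e := by
  constructor
  · exact fun h h' => not_joined_cutAt hρ he (joined_of_hasState (hasState_cutAt hs h') h)
  · intro h'
    by_contra h
    have h1 := (joined_update_iff s e).2 h
    refine not_joined_cutAt hρ he (joined_of_hasState (hasState_cutAt (hs.update he _) ?_) h1)
    rw [Function.update_self, Bool.eq_not_of_ne h', Bool.not_not]

theorem Touches.joined_ends {a : D.Point} (h : Touches s e a) (p : D.Point)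
    (ρ : D.PartialSmoothing) : Joined (ofState s) a (.inl (e, nearEnd p ρ e)) ∨
      Joined (ofState s) a (.inl (e, farEnd p ρ e)) := by
  rcases end_cases p ρ e with ⟨h1, h2⟩ | ⟨h1, h2⟩ <;> rw [h1, h2]
  · exact Or.symm h
  · exact h

theorem joined_near_far (hρ : IsTerminal ρ) (he : ρ e = none) (hs : D.HasState ρ s)
    (hse : s e ≠ cutBit ρ e) :
    Joined (ofState s) (.inl (e, nearEnd p ρ e)) (.inl (e, farEnd p ρ e)) := by
  have := (joined_ends_iff hρ he hs).2 hse
  rcases end_cases p ρ e with ⟨h1, h2⟩ | ⟨h1, h2⟩ <;> rw [h1, h2]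
  · exact this.symm
  · exact this

theorem not_joined_near_far (hρ : IsTerminal ρ) (he : ρ e = none) (hs : D.HasState ρ s)
    (hse : s e = cutBit ρ e) :
    ¬ Joined (ofState s) (.inl (e, nearEnd p ρ e)) (.inl (e, farEnd p ρ e)) := by
  have := fun h => (joined_ends_iff hρ he hs).1 h hse
  rcases end_cases p ρ e with ⟨h1, h2⟩ | ⟨h1, h2⟩ <;> rw [h1, h2]
  · exact fun h => this h.symm
  · exact this

theorem joined_near_of_touches (hρ : IsTerminal ρ) (hc : ρ c = none) (he : ρ e = none)
    (hce : c ≠ e) (hs : D.HasState ρ s) (hsc : s c = cutBit ρ c)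
    (h : Touches s e (.inl (c, farEnd p ρ c))) :
    Joined (ofState s) (.inl (c, farEnd p ρ c)) (.inl (e, nearEnd p ρ e)) := by
  refine (h.joined_ends p ρ).elim id fun h1 => ?_
  by_cases hse : s e = cutBit ρ e
  · exact absurd (height_lt hρ hc he hce hs hsc h1)
      (height_lt hρ he hc hce.symm hs hse h1.symm).not_gt
  · exact h1.trans (joined_near_far hρ he hs hse).symm

/-- The generators `g` and `h` agree away from the crossing `e`. -/
structure AgreeOff (ρ : D.PartialSmoothing) (e : Fin D.n) (g h : D.khovanovModule.gen) :
    Prop where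
  state : D.HasState ρ g.1
  unsmoothed : ρ e = none
  off : ∀ c, c ≠ e → g.1 c = h.1 c
  far : ∀ a, ¬ Touches g.1 e a → h.2 (D.circleOf h.1 a) = g.2 (D.circleOf g.1 a)

theorem AgreeOff.state' (H : AgreeOff ρ e g h) : D.HasState ρ h.1 := fun c b hb => by
  rw [← H.off c fun hc => by rw [hc, H.unsmoothed] at hb; simp at hb]
  exact H.state c b hb

theorem AgreeOff.symm (H : AgreeOff ρ e g h) : AgreeOff ρ e h g where
  state := H.state'
  unsmoothed := H.unsmoothed
  off c hc := (H.off c hc).symm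
  far a ha := (H.far a fun h' => ha ((touches_iff H.off).1 h')).symm

theorem AgreeOff.crit_iff_of_le (H : AgreeOff ρ e g h) (hρ : IsTerminal ρ) (hc : ρ c = none)
    (hce : c ≠ e) (hle : height p ρ c ≤ height p ρ e) : Crit p ρ g c ↔ Crit p ρ h c := by
  unfold Crit
  rw [← H.off c hce]
  refine and_congr_right fun hsc => ?_
  have : endLabel h c _ = endLabel g c _ :=
    H.far _ (not_touches_farEnd hρ hc H.unsmoothed hce H.state hsc hle)
  rw [this]

/-- The generators `g` and `h` differ, if at all, by the cancellation at the crossing `e`, the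
first crossing that is not critical. -/
structure Twin (p : D.Point) (ρ : D.PartialSmoothing) (e : Fin D.n) (g h : D.khovanovModule.gen) :
    Prop extends AgreeOff ρ e g h where
  near : endLabel g e (nearEnd p ρ e) = endLabel h e (nearEnd p ρ e)
  left : ¬ Crit p ρ g e
  right : ¬ Crit p ρ h e
  first : ∀ c, ρ c = none → height p ρ c < height p ρ e → Crit p ρ g c

theorem Twin.crit_iff (H : Twin p ρ e g h) (hρ : IsTerminal ρ) (hc : ρ c = none) :
    Crit p ρ g c ↔ Crit p ρ h c := by
  by_cases hce : c = e
  · subst hce; exact iff_of_false H.left H.right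
  unfold Crit
  rw [← H.off c hce]
  refine and_congr_right fun hsc => ?_
  by_cases ht : Touches g.1 e (.inl (c, farEnd p ρ c))
  · have h1 : endLabel g c _ = endLabel g e _ := label_eq_of_joined g
      (joined_near_of_touches hρ hc H.unsmoothed hce H.state hsc ht)
    have h2 : endLabel h c _ = endLabel h e _ := label_eq_of_joined h
      (joined_near_of_touches hρ hc H.unsmoothed hce H.state' ((H.off c hce).symm.trans hsc)
        ((touches_iff H.off).1 ht))
    rw [h1, h2, H.near]
  · have : endLabel h c _ = endLabel g c _ := H.far _ ht
    rw [this]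

theorem Twin.symm (H : Twin p ρ e g h) (hρ : IsTerminal ρ) : Twin p ρ e h g where
  toAgreeOff := H.toAgreeOff.symm
  near := H.near.symm
  left := H.right
  right := H.left
  first c hc hlt := (H.crit_iff hρ hc).1 (H.first c hc hlt)

theorem Twin.crossing_eq {e' : Fin D.n} (H : Twin p ρ e g h) (H' : Twin p ρ e' g h') : e = e' := by
  by_contra hne
  rcases lt_or_gt_of_ne ((height_injective p ρ).ne hne) with hlt | hlt
  · exact H.left (H'.first e H.unsmoothed hlt)
  · exact H'.left (H.first e' H'.unsmoothed hlt)

theorem Twin.far_label (H : Twin p ρ e g h) (hg : g.1 e = cutBit ρ e) :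
    endLabel g e (farEnd p ρ e) = !cutBit ρ e :=
  Bool.eq_not_of_ne fun h' => H.left ⟨hg, h'⟩

theorem Twin.eq (H : Twin p ρ e g h) (H' : Twin p ρ e g h') (hρ : IsTerminal ρ)
    (he : h.1 e = h'.1 e) : h = h' := by
  have hst : h.1 = h'.1 := by
    funext c
    by_cases hce : c = e
    · rw [hce, he]
    · rw [← H.off c hce, H'.off c hce]
  have key : ∀ a, h.2 (D.circleOf h.1 a) = h'.2 (D.circleOf h'.1 a) := by
    intro a
    by_cases ha : Touches g.1 e a
    · have ht := (touches_iff H.off).1 ha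
      have hnear : Joined (ofState h.1) a (.inl (e, nearEnd p ρ e)) →
          h.2 (D.circleOf h.1 a) = h'.2 (D.circleOf h'.1 a) := fun h1 => by
        have h2 : h.2 (D.circleOf h.1 a) = endLabel h e _ := label_eq_of_joined h h1
        have h3 : h'.2 (D.circleOf h'.1 a) = endLabel h' e _ := label_eq_of_joined h' (hst ▸ h1)
        rw [h2, h3, ← H.near, H'.near]
      rcases ht.joined_ends p ρ with h1 | h1
      · exact hnear h1
      · by_cases hse : h.1 e = cutBit ρ e
        · have h2 : h.2 (D.circleOf h.1 a) = endLabel h e _ := label_eq_of_joined h h1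
          have h3 : h'.2 (D.circleOf h'.1 a) = endLabel h' e _ := label_eq_of_joined h' (hst ▸ h1)
          rw [h2, h3, (H.symm hρ).far_label hse, (H'.symm hρ).far_label (he ▸ hse)]
        · exact hnear (h1.trans (joined_near_far hρ H.unsmoothed H.state' hse).symm)
    · rw [H.far a ha, H'.far a ha]
  obtain ⟨t, ℓ, rfl⟩ : ∃ t ℓ, h = mkGen t ℓ := ⟨h.1, h.2, rfl⟩
  obtain ⟨t', ℓ', rfl⟩ : ∃ t ℓ, h' = mkGen t ℓ := ⟨h'.1, h'.2, rfl⟩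
  change t = t' at hst
  subst hst
  congr 1
  funext γ
  obtain ⟨a, rfl⟩ := circleOf_surjective t γ
  exact key a

theorem exists_twin (hρ : IsTerminal ρ) (hs : D.HasState ρ g.1) (he : ρ e = none)
    (hg : ¬ Crit p ρ g e) (hfirst : ∀ c, ρ c = none → height p ρ c < height p ρ e → Crit p ρ g c) :
    ∃ h, Twin p ρ e g h ∧ h.1 e = !g.1 e := by
  classical
  obtain ⟨t, ht⟩ : ∃ t, t = Function.update g.1 e (!g.1 e) := ⟨_, rfl⟩
  have hte : t e = !g.1 e := by rw [ht, Function.update_self]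
  have hst : ∀ c, c ≠ e → g.1 c = t c := fun c hc => by rw [ht, Function.update_of_ne hc]
  have hst' : ∀ c, c ≠ e → t c = g.1 c := fun c hc => (hst c hc).symm
  have hts : D.HasState ρ t := ht ▸ hs.update he _
  let ℓ : D.Circles t → Bool := fun γ =>
    if γ = D.circleOf t (.inl (e, nearEnd p ρ e)) then endLabel g e (nearEnd p ρ e)
    else if γ = D.circleOf t (.inl (e, farEnd p ρ e)) then !cutBit ρ e
    else g.2 (D.circleOf g.1 γ.out)
  refine ⟨mkGen t ℓ, ⟨⟨hs, he, hst, fun a ha => ?_⟩, (if_pos rfl).symm, hg, fun h => ?_, hfirst⟩, hte⟩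
  · change ℓ (D.circleOf t a) = _
    have ha' : ¬ Touches t e a := fun h => ha ((touches_iff hst).2 h)
    have hend : ∀ i, D.circleOf t a ≠ D.circleOf t (.inl (e, i)) := not_touches_iff.1 ha'
    refine (if_neg (hend _)).trans ((if_neg (hend _)).trans (label_eq_of_joined g ?_))
    exact ((joined_iff_of_not_touches hst' ha').1 (joined_out t a).symm).symm
  · have h1 : t e = cutBit ρ e := h.1
    have h2 : ℓ (D.circleOf t (.inl (e, farEnd p ρ e))) = cutBit ρ e := h.2
    have h3 : ℓ (D.circleOf t (.inl (e, farEnd p ρ e))) = !cutBit ρ e :=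
      (if_neg fun h' => not_joined_near_far (p := p) hρ he hts h1
        (Joined.symm (circleOf_eq_iff.1 h'))).trans (if_pos rfl)
    rw [h2] at h3
    simp at h3

theorem AgreeOff.isEdge (H : AgreeOff ρ e g h) (hg : g.1 e = false) (hh : h.1 e = true) :
    IsEdge e g h := by
  refine ⟨hg, ?_, H.far⟩
  funext c
  by_cases hce : c = e
  · rw [hce, Function.update_self, hh]
  · rw [Function.update_of_ne hce, H.off c hce]

theorem IsEdge.agreeOff (hE : IsEdge e g h) (hs : D.HasState ρ g.1) (he : ρ e = none) :
    AgreeOff ρ e g h := ⟨hs, he, hE.eq_off, hE.2.2⟩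

/-- The coefficient at a crossing with a disconnecting `0`-smoothing. -/
theorem AgreeOff.localCoeff_of_cutBit_false (H : AgreeOff ρ e g h) (hρ : IsTerminal ρ)
    (hg : g.1 e = false) (hh : h.1 e = true) (hb : cutBit ρ e = false) (p : D.Point) :
    localCoeff totalMul totalComul e g h = totalMul (endLabel g e (nearEnd p ρ e))
        (endLabel g e (farEnd p ρ e)) (endLabel h e (nearEnd p ρ e)) ∧
      D.khovanovModule.sec h + labelDeg (endLabel g e (nearEnd p ρ e)) +
          labelDeg (endLabel g e (farEnd p ρ e)) =
        D.khovanovModule.sec g + labelDeg (endLabel h e (nearEnd p ρ e)) + 1 := by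
  have hcomm : ∀ a b c, totalMul a b c = totalMul b a c := by decide
  have hJ : ¬ Joined (ofState g.1) (.inl (e, 0)) (.inl (e, 2)) := fun h' =>
    (joined_ends_iff hρ H.unsmoothed H.state).1 h' (hg.trans hb.symm)
  have hJ' := (joined_ends_iff hρ H.unsmoothed H.state').2 (by rw [hh, hb]; simp)
  have h02 : endLabel h e 0 = endLabel h e 2 := label_eq_of_joined h hJ'
  have h1 : localCoeff totalMul totalComul e g h =
      totalMul (endLabel g e 0) (endLabel g e 2) (endLabel h e 0) := if_pos hJ
  have h2 : _ + labelDeg (endLabel g e 0) + labelDeg (endLabel g e 2) =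
    _ + labelDeg (endLabel h e 0) + 1 := (H.isEdge hg hh).sec_eq.1 hJ
  rcases end_cases p ρ e with ⟨h3, h4⟩ | ⟨h3, h4⟩ <;> rw [h3, h4]
  · rw [h1, ← h02]
    exact ⟨hcomm _ _ _, by linarith⟩
  · exact ⟨h1, h2⟩

/-- The coefficient at a crossing with a disconnecting `1`-smoothing. -/
theorem AgreeOff.localCoeff_of_cutBit_true (H : AgreeOff ρ e g h) (hρ : IsTerminal ρ)
    (hg : g.1 e = false) (hh : h.1 e = true) (hb : cutBit ρ e = true) (p : D.Point) :
    localCoeff totalMul totalComul e g h = totalComul (endLabel g e (nearEnd p ρ e))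
        (endLabel h e (nearEnd p ρ e)) (endLabel h e (farEnd p ρ e)) ∧
      D.khovanovModule.sec h + labelDeg (endLabel g e (nearEnd p ρ e)) =
        D.khovanovModule.sec g + labelDeg (endLabel h e (nearEnd p ρ e)) +
          labelDeg (endLabel h e (farEnd p ρ e)) + 1 := by
  have hcomm : ∀ a b c, totalComul a b c = totalComul a c b := by decide
  have hJ := (joined_ends_iff hρ H.unsmoothed H.state).2 (by rw [hg, hb]; simp)
  have hJ' : ¬ Joined (ofState h.1) (.inl (e, 0)) (.inl (e, 2)) := fun h' =>
    (joined_ends_iff hρ H.unsmoothed H.state').1 h' (hh.trans hb.symm)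
  have h02 : endLabel g e 0 = endLabel g e 2 := label_eq_of_joined g hJ
  have h1 : localCoeff totalMul totalComul e g h =
      totalComul (endLabel g e 0) (endLabel h e 0) (endLabel h e 2) :=
    (if_neg (not_not.2 hJ)).trans (if_pos hJ')
  have h2 : _ + labelDeg (endLabel g e 0) = _ + labelDeg (endLabel h e 0) +
    labelDeg (endLabel h e 2) + 1 := (H.isEdge hg hh).sec_eq.2 hJ
  rcases end_cases p ρ e with ⟨h3, h4⟩ | ⟨h3, h4⟩ <;> rw [h3, h4]
  · rw [h1, ← h02]
    exact ⟨hcomm _ _ _, by linarith⟩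
  · exact ⟨h1, h2⟩

theorem Twin.localCoeff_eq_one (H : Twin p ρ e g h) (hρ : IsTerminal ρ) (hg : g.1 e = false)
    (hh : h.1 e = true) : localCoeff totalMul totalComul e g h = 1 ∧
      D.khovanovModule.sec h = D.khovanovModule.sec g := by
  cases hb : cutBit ρ e
  · have hm : ∀ a, totalMul a true a = 1 := by decide
    obtain ⟨h1, h2⟩ := H.localCoeff_of_cutBit_false hρ hg hh hb p
    have h3 := H.far_label (hg.trans hb.symm)
    rw [hb, Bool.not_false] at h3
    rw [h3, ← H.near] at h1 h2
    have : labelDeg true = 1 := rfl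
    exact ⟨h1.trans (hm _), by linarith⟩
  · have hm : ∀ a, totalComul a a false = 1 := by decide
    obtain ⟨h1, h2⟩ := H.localCoeff_of_cutBit_true hρ hg hh hb p
    have h3 := (H.symm hρ).far_label (hh.trans hb.symm)
    rw [hb, Bool.not_true] at h3
    rw [h3, ← H.near] at h1 h2
    refine ⟨h1.trans (hm _), ?_⟩
    have : labelDeg false = -1 := rfl
    rw [this] at h2
    linarith

theorem AgreeOff.twin (H : AgreeOff ρ e g h) (hρ : IsTerminal ρ) (hg : g.1 e = false)
    (hh : h.1 e = true) (hne : localCoeff totalMul totalComul e g h ≠ 0)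
    (hl : ¬ Crit p ρ g e) (hr : ¬ Crit p ρ h e)
    (hfirst : ∀ c, ρ c = none → height p ρ c < height p ρ e → Crit p ρ h c) :
    Twin p ρ e g h := by
  refine ⟨H, ?_, hl, hr, fun c hc hlt =>
    (H.crit_iff_of_le hρ hc (fun h => hlt.ne (by rw [h])) hlt.le).2 (hfirst c hc hlt)⟩
  cases hb : cutBit ρ e
  · have hm : ∀ a b, totalMul a true b ≠ 0 → a = b := by decide
    rw [(H.localCoeff_of_cutBit_false hρ hg hh hb p).1] at hne
    have h3 : endLabel g e (farEnd p ρ e) = true := by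
      by_contra h'
      exact hl ⟨hg.trans hb.symm, (Bool.eq_false_of_not_eq_true h').trans hb.symm⟩
    rw [h3] at hne
    exact hm _ _ hne
  · have hm : ∀ a b, totalComul a b false ≠ 0 → a = b := by decide
    rw [(H.localCoeff_of_cutBit_true hρ hg hh hb p).1] at hne
    have h3 : endLabel h e (farEnd p ρ e) = false := by
      by_contra h'
      exact hr ⟨hh.trans hb.symm, (Bool.eq_true_of_not_eq_false h').trans hb.symm⟩
    rw [h3] at hne
    exact hm _ _ hne

end FixedLeaf

/-- The generators `g` and `h` are matched. -/
def Matched (p : D.Point) (g h : D.khovanovModule.gen) : Prop :=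
  ∃ e, Twin p (D.leaf g.1) e g h ∧ g.1 e = false ∧ h.1 e = true

/-- The generators that are not matched. -/
def Critical (p : D.Point) (g : D.khovanovModule.gen) : Prop :=
  ∀ c, D.leaf g.1 c = none → Crit p (D.leaf g.1) g c

/-- The generator `h` is the target of a matched pair. -/
def Upper (p : D.Point) (h : D.khovanovModule.gen) : Prop := ∃ g, Matched p g h

/-- The generator `g` is the source of a matched pair. -/
def Lower (p : D.Point) (g : D.khovanovModule.gen) : Prop := ∃ h, Matched p g h

theorem AgreeOff.leaf_eq {e : Fin D.n} {g h : D.khovanovModule.gen}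
    (H : AgreeOff (D.leaf g.1) e g h) : D.leaf h.1 = D.leaf g.1 := leaf_eq_of_hasState H.state'

section Matching

variable {p : D.Point} {g h g' h' : D.khovanovModule.gen}

theorem Matched.leaf_eq (H : Matched p g h) : D.leaf h.1 = D.leaf g.1 := by
  obtain ⟨e, H, -⟩ := H
  exact H.leaf_eq

theorem Matched.right_unique (hD : D.Connected) (H : Matched p g h) (H' : Matched p g h') : h = h' := by
  obtain ⟨e, H, hg, hh⟩ := H
  obtain ⟨e', H', hg', hh'⟩ := H'
  obtain rfl := H.crossing_eq H'
  exact H.eq H' (isTerminal_leaf hD _) (hh.trans hh'.symm)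

theorem Matched.left_unique (hD : D.Connected) (H : Matched p g h) (H' : Matched p g' h) : g = g' := by
  have hl := H.leaf_eq.symm.trans H'.leaf_eq
  obtain ⟨e, H, hg, hh⟩ := H
  obtain ⟨e', H', hg', hh'⟩ := H'
  rw [← hl] at H'
  have H₁ := H.symm (isTerminal_leaf hD _)
  have H₁' := H'.symm (isTerminal_leaf hD _)
  obtain rfl := H₁.crossing_eq H₁'
  exact H₁.eq H₁' (isTerminal_leaf hD _) (hg.trans hg'.symm)

theorem Lower.not_upper (hD : D.Connected) (H : Lower p g) : ¬ Upper p g := by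
  rintro ⟨f, H'⟩
  obtain ⟨h, H⟩ := H
  have hl := H'.leaf_eq
  obtain ⟨e, H, hg, hh⟩ := H
  obtain ⟨e', H', hg', hh'⟩ := H'
  rw [← hl] at H'
  obtain rfl := H.crossing_eq (H'.symm (isTerminal_leaf hD _))
  rw [hg] at hh'
  simp at hh'

theorem Critical.not_lower (H : Critical p g) : ¬ Lower p g := by
  rintro ⟨h, e, H', -⟩
  exact H'.left (H e H'.unsmoothed)

theorem Critical.not_upper (H : Critical p g) : ¬ Upper p g := by
  rintro ⟨f, H'⟩
  have hl := H'.leaf_eq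
  obtain ⟨e, H', -⟩ := H'
  rw [← hl] at H'
  exact H'.right (H e H'.unsmoothed)

theorem exists_matched (hD : D.Connected) {e : Fin D.n} (he : D.leaf g.1 e = none) (hg : ¬ Crit p (D.leaf g.1) g e)
    (hfirst : ∀ c, D.leaf g.1 c = none → height p (D.leaf g.1) c < height p (D.leaf g.1) e →
      Crit p (D.leaf g.1) g c) :
    (g.1 e = false → Lower p g) ∧ (g.1 e = true → Upper p g) := by
  obtain ⟨h, H, hh⟩ := exists_twin (isTerminal_leaf hD g.1) (hasState_leaf g.1) he hg hfirst
  refine ⟨fun h' => ⟨h, e, H, h', by rw [hh, h']; rfl⟩, fun h' => ⟨h, e, ?_, by rw [hh, h']; rfl, h'⟩⟩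
  rw [H.leaf_eq]
  exact H.symm (isTerminal_leaf hD g.1)

theorem lower_or_upper (hD : D.Connected) (H : ¬ Critical p g) : Lower p g ∨ Upper p g := by
  classical
  let S := Finset.univ.filter fun c => D.leaf g.1 c = none ∧ ¬ Crit p (D.leaf g.1) g c
  have hS : S.Nonempty := by
    unfold Critical at H
    push Not at H
    obtain ⟨c, hc⟩ := H
    exact ⟨c, by simpa [S] using hc⟩
  obtain ⟨e, he, hmin⟩ := S.exists_min_image (height p (D.leaf g.1)) hS
  obtain ⟨-, he1, he2⟩ := Finset.mem_filter.1 he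
  have key := exists_matched hD he1 he2 fun c hc hlt => by
    by_contra h'
    exact absurd (hmin c (Finset.mem_filter.2 ⟨Finset.mem_univ c, hc, h'⟩)) hlt.not_ge
  cases hb : g.1 e
  · exact .inl (key.1 hb)
  · exact .inr (key.2 hb)

theorem Matched.leeMatrix_mul_self (hD : D.Connected) (H : Matched p g h) :
    D.leeMatrix g h * D.leeMatrix g h = 1 := by
  obtain ⟨e, H, hg, hh⟩ := H
  rw [(H.isEdge hg hh).leeMatrix_eq, (H.localCoeff_eq_one (isTerminal_leaf hD _) hg hh).1, mul_one,
    edgeSign, ← pow_add, ← two_mul, pow_mul]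
  norm_num

theorem Matched.sec_eq (hD : D.Connected) (H : Matched p g h) :
    D.khovanovModule.sec h = D.khovanovModule.sec g := by
  obtain ⟨e, H, hg, hh⟩ := H
  exact (H.localCoeff_eq_one (isTerminal_leaf hD _) hg hh).2

theorem Matched.prim_eq (H : Matched p g h) :
    D.khovanovModule.prim h = D.khovanovModule.prim g + 1 := by
  obtain ⟨e, H, hg, hh⟩ := H
  exact (H.isEdge hg hh).prim_eq

end Matching

/-! ### Lee's differential is triangular with respect to the matching -/

open Classical in
/-- The branches that lead to the leaf of `g`. -/
noncomputable def branchRank (g : D.khovanovModule.gen) : Fin D.n → ℕ :=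
  fun c => if D.leaf g.1 c = some true then 1 else 0

open Classical in
/-- The primary degree of the source of the matched pair of `g`. -/
noncomputable def sourcePrim (p : D.Point) (g : D.khovanovModule.gen) : ℤ :=
  if Upper p g then D.khovanovModule.prim g - 1 else D.khovanovModule.prim g

open Classical in
/-- The critical crossings of `g`, in the order of their heights. -/
noncomputable def critRank (p : D.Point) (ρ : D.PartialSmoothing) (g : D.khovanovModule.gen)
    (k : ℕ) : ℕ :=
  if ∃ c, ρ c = none ∧ height p ρ c = k ∧ (Crit p ρ g c ↔ cutBit ρ c = true) then 1 else 0

/-- The order in which Lee's differential is triangular. -/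
noncomputable def rank (p : D.Point) (g : D.khovanovModule.gen) :
    Lex (Fin D.n → ℕ) ×ₗ ℤ ×ₗ Lex (ℕ → ℕ) :=
  toLex (toLex (branchRank g), toLex (sourcePrim p g, toLex (critRank p (D.leaf g.1) g)))

section Rank

variable {p : D.Point} {ρ : D.PartialSmoothing} {g h : D.khovanovModule.gen}

open Classical in
theorem critRank_congr {k : ℕ}
    (H : ∀ c, ρ c = none → height p ρ c = k → (Crit p ρ g c ↔ Crit p ρ h c)) :
    critRank p ρ g k = critRank p ρ h k := by
  unfold critRank
  refine if_congr (exists_congr fun c => and_congr_right fun h1 => and_congr_right fun h2 => ?_)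
    rfl rfl
  rw [H c h1 h2]

theorem critRank_lt {c : Fin D.n} (hc : ρ c = none)
    (hlt : ∀ c', ρ c' = none → height p ρ c' < height p ρ c → (Crit p ρ g c' ↔ Crit p ρ h c'))
    (hg : ¬ (Crit p ρ g c ↔ cutBit ρ c = true)) (hh : Crit p ρ h c ↔ cutBit ρ c = true) :
    toLex (critRank p ρ g) < toLex (critRank p ρ h) := by
  refine ⟨height p ρ c, fun k hk => critRank_congr fun c' hc' hk' => hlt c' hc' (hk' ▸ hk), ?_⟩
  have h1 : critRank p ρ g (height p ρ c) = 0 := if_neg <| by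
    rintro ⟨c', -, h1, h2⟩
    rw [height_injective p ρ h1] at h2
    exact hg h2
  have h2 : critRank p ρ h (height p ρ c) = 1 := if_pos ⟨c, hc, rfl, hh⟩
  change critRank p ρ g (height p ρ c) < critRank p ρ h (height p ρ c)
  omega

theorem Matched.rank_eq (hD : D.Connected) (H : Matched p g h) : rank p g = rank p h := by
  have hl := H.leaf_eq
  have h1 : branchRank g = branchRank h := by unfold branchRank; rw [hl]
  have h2 : sourcePrim p g = sourcePrim p h := by
    rw [sourcePrim, sourcePrim, if_neg (Lower.not_upper hD ⟨h, H⟩), if_pos ⟨g, H⟩, H.prim_eq,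
      add_sub_cancel_right]
  have h3 : critRank p (D.leaf g.1) g = critRank p (D.leaf h.1) h := by
    rw [hl]
    funext k
    obtain ⟨e, H, -⟩ := H
    exact critRank_congr fun c hc _ => H.crit_iff (isTerminal_leaf hD _) hc
  rw [rank, rank, h1, h2, h3]

theorem branchRank_lt {e : Fin D.n} (hE : IsEdge e g h) (he : D.leaf g.1 e ≠ none) :
    toLex (branchRank g) < toLex (branchRank h) := by
  obtain ⟨h1, h2⟩ := leaf_branch (fun c hc => (hE.eq_off c hc).symm) he
  refine ⟨e, fun c hc => ?_, ?_⟩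
  · change branchRank g c = branchRank h c
    unfold branchRank
    rw [h2 c hc]
  · have hg : D.leaf g.1 e = some false := by
      cases hb : D.leaf g.1 e with
      | none => exact absurd hb he
      | some b => rw [← hasState_leaf g.1 e b hb, hE.1]
    have hh : h.1 e = true := by rw [hE.2.1, Function.update_self]
    change branchRank g e < branchRank h e
    unfold branchRank
    rw [h1, hg, hh]
    simp

theorem rank_lt (hD : D.Connected) (hne : D.leeMatrix g h ≠ 0) (hM : ¬ Matched p g h) :
    rank p g < rank p h := by
  obtain ⟨e, hE, hl⟩ := exists_isEdge hne
  unfold rank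
  rw [Prod.Lex.toLex_lt_toLex]
  by_cases he : D.leaf g.1 e = none
  swap
  · exact .inl (branchRank_lt hE he)
  have hρ := isTerminal_leaf hD g.1
  have H := hE.agreeOff (hasState_leaf g.1) he
  have hleaf : D.leaf h.1 = D.leaf g.1 := H.leaf_eq
  have hh : h.1 e = true := by rw [hE.2.1, Function.update_self]
  refine .inr ⟨by unfold branchRank; rw [hleaf], ?_⟩
  change toLex (sourcePrim p g, toLex (critRank p (D.leaf g.1) g)) <
    toLex (sourcePrim p h, toLex (critRank p (D.leaf h.1) h))
  rw [Prod.Lex.toLex_lt_toLex, hleaf]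
  by_cases hgh : ¬ Upper p g ∧ Upper p h
  swap
  · refine .inl ?_
    change sourcePrim p g < sourcePrim p h
    have := hE.prim_eq
    unfold sourcePrim
    rw [not_and_or, not_not] at hgh
    split_ifs with h1 h2 h2
    · omega
    · omega
    · exact absurd h2 (hgh.resolve_left h1)
    · omega
  obtain ⟨hg, hu⟩ := hgh
  refine .inr ⟨?_, ?_⟩
  · change sourcePrim p g = sourcePrim p h
    rw [sourcePrim, sourcePrim, if_neg hg, if_pos hu, hE.prim_eq, add_sub_cancel_right]
  change toLex (critRank p (D.leaf g.1) g) < toLex (critRank p (D.leaf g.1) h)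
  obtain ⟨f, hf⟩ := hu
  have hf' := hf.leaf_eq
  obtain ⟨e', H', hfe, hhe⟩ := hf
  rw [← hf', hleaf] at H'
  have Hh := H'.symm hρ
  have hlow : ∀ c, D.leaf g.1 c = none →
      height p (D.leaf g.1) c < height p (D.leaf g.1) e →
        (Crit p (D.leaf g.1) g c ↔ Crit p (D.leaf g.1) h c) := fun c hc hlt =>
    H.crit_iff_of_le hρ hc (fun h' => hlt.ne (by rw [h'])) hlt.le
  rcases lt_trichotomy (height p (D.leaf g.1) e) (height p (D.leaf g.1) e') with hlt | heq | hlt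
  · have h1 := Hh.first e he hlt
    have h2 : cutBit (D.leaf g.1) e = true := h1.1.symm.trans hh
    refine critRank_lt he hlow (fun h' => ?_) (iff_of_true h1 h2)
    have h3 := (h'.2 h2).1
    rw [hE.1, h2] at h3
    simp at h3
  · obtain rfl := height_injective p _ heq
    by_cases h1 : Crit p (D.leaf g.1) g e
    · have h2 : ¬ cutBit (D.leaf g.1) e = true := by rw [← h1.1, hE.1]; simp
      exact critRank_lt he hlow (fun h' => h2 (h'.1 h1)) (iff_of_false Hh.left h2)
    · exact absurd ⟨e, H.twin hρ hE.1 hh hl h1 Hh.left Hh.first, hE.1, hh⟩ hM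
  · refine absurd ?_ hg
    have hne : e' ≠ e := fun h' => hlt.ne (by rw [h'])
    have hcr := H.crit_iff_of_le (p := p) hρ Hh.unsmoothed hne hlt.le
    refine (exists_matched hD Hh.unsmoothed (fun h' => Hh.left (hcr.1 h')) fun c hc hc' => ?_).2
      ((H.off e' hne).trans hhe)
    exact (hlow c hc (hc'.trans hlt)).2 (Hh.first c hc hc')

end Rank

/-! ### The decomposition -/

open Classical in
/-- The part of Lee's differential given by the matching. -/
noncomputable def matchingMatrix (p : D.Point) :
    Matrix D.khovanovModule.gen D.khovanovModule.gen ℤ :=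
  fun g h => if Matched p g h then D.leeMatrix g h else 0

section MatchingMatrix

variable {p : D.Point} {g h : D.khovanovModule.gen}

theorem matched_of_ne_zero (hne : matchingMatrix p g h ≠ 0) : Matched p g h := by
  by_contra h'
  exact hne (if_neg h')

theorem matchingMatrix_of_matched (H : Matched p g h) : matchingMatrix p g h = D.leeMatrix g h :=
  if_pos H

open Classical in
theorem matchingMatrix_mul_transpose (hD : D.Connected) (p : D.Point) :
    matchingMatrix p * (matchingMatrix p)ᵀ =
      diagonal fun g : D.khovanovModule.gen => if Lower p g then 1 else 0 := by
  ext g h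
  rw [Matrix.mul_apply, diagonal_apply]
  by_cases hgh : g = h
  · subst hgh
    rw [if_pos rfl]
    by_cases hL : Lower p g
    · obtain ⟨k, hk⟩ := id hL
      rw [if_pos hL, Finset.sum_eq_single k]
      · rw [Matrix.transpose_apply, matchingMatrix_of_matched hk, hk.leeMatrix_mul_self hD]
      · intro k' _ hk'
        by_contra hne
        exact hk' (Matched.right_unique hD (matched_of_ne_zero (left_ne_zero_of_mul hne)) hk)
      · exact fun h => absurd (Finset.mem_univ k) h
    · rw [if_neg hL]
      refine Finset.sum_eq_zero fun k _ => ?_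
      by_contra hne
      exact hL ⟨k, matched_of_ne_zero (left_ne_zero_of_mul hne)⟩
  · rw [if_neg hgh]
    refine Finset.sum_eq_zero fun k _ => ?_
    by_contra hne
    exact hgh (Matched.left_unique hD (matched_of_ne_zero (left_ne_zero_of_mul hne))
      (matched_of_ne_zero (right_ne_zero_of_mul hne)))

open Classical in
theorem transpose_mul_matchingMatrix (hD : D.Connected) (p : D.Point) :
    (matchingMatrix p)ᵀ * matchingMatrix p =
      diagonal fun g : D.khovanovModule.gen => if Upper p g then 1 else 0 := by
  ext g h
  rw [Matrix.mul_apply, diagonal_apply]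
  by_cases hgh : g = h
  · subst hgh
    rw [if_pos rfl]
    by_cases hL : Upper p g
    · obtain ⟨k, hk⟩ := id hL
      rw [if_pos hL, Finset.sum_eq_single k]
      · rw [Matrix.transpose_apply, matchingMatrix_of_matched hk, hk.leeMatrix_mul_self hD]
      · intro k' _ hk'
        by_contra hne
        exact hk' (Matched.left_unique hD (matched_of_ne_zero (left_ne_zero_of_mul hne)) hk)
      · exact fun h => absurd (Finset.mem_univ k) h
    · rw [if_neg hL]
      refine Finset.sum_eq_zero fun k _ => ?_
      by_contra hne
      exact hL ⟨k, matched_of_ne_zero (left_ne_zero_of_mul hne)⟩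
  · rw [if_neg hgh]
    refine Finset.sum_eq_zero fun k _ => ?_
    by_contra hne
    exact hgh (Matched.right_unique hD (matched_of_ne_zero (left_ne_zero_of_mul hne))
      (matched_of_ne_zero (right_ne_zero_of_mul hne)))

/-- Lee's complex splits off a contractible complex; what is left has the critical generators as a
basis. -/
theorem exists_decomposition (hD : D.Connected) (p : D.Point) :
    ∃ A B : FilteredDiffModule, A.IsFilteredComplex ∧ B.IsFilteredComplex ∧ B.Contractible ∧
      A.toFilteredModule = (D.khovanovModule.restrict (Critical p)).toFilteredModule ∧
      Nonempty (FilteredDiffModule.Iso (D.khovanovModule.withMatrix D.leeMatrix)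
        (A.directSum B)) := by
  classical
  have hrow := matchingMatrix_mul_transpose hD p
  have hcol := transpose_mul_matchingMatrix hD p
  refine BigradedBasis.exists_decomposition (φ := rank p) (q₀ := matchingMatrix p)
    (p₀ := (matchingMatrix p)ᵀ) D.hasDeg_leeMatrix (fun g h hne => ?_) (fun g h hne => ?_)
    D.leeMatrix_mul_self (fun g h hne => ?_) (fun g h hne => ?_) (fun g h hne => ?_) ?_ ?_
    (Critical p) ?_
  · have H := matched_of_ne_zero hne
    exact ⟨H.prim_eq, (H.sec_eq hD).ge⟩
  · have H := matched_of_ne_zero hne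
    exact ⟨by rw [H.prim_eq]; ring, (H.sec_eq hD).le⟩
  · exact ((matched_of_ne_zero hne).rank_eq hD).le
  · exact ((matched_of_ne_zero hne).rank_eq hD).ge
  · have hM : ¬ Matched p g h := fun H => hne <| by
      rw [Matrix.sub_apply, matchingMatrix_of_matched H, sub_self]
    refine rank_lt hD (fun h0 => hne ?_) hM
    have : matchingMatrix p g h = 0 := if_neg hM
    rw [Matrix.sub_apply, h0, this, sub_self]
  · ext g h
    rw [Matrix.mul_apply]
    refine Finset.sum_eq_zero fun k _ => ?_
    by_contra hne
    have h1 : Matched p k g := matched_of_ne_zero (left_ne_zero_of_mul hne)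
    have h2 : Matched p h k := matched_of_ne_zero (right_ne_zero_of_mul hne)
    exact Lower.not_upper hD ⟨g, h1⟩ ⟨h, h2⟩
  · rw [hcol]
    ext g h
    rw [diagonal_mul]
    by_cases hU : Upper p g
    · rw [if_pos hU, one_mul]
    · rw [if_neg hU, zero_mul]
      by_contra hne
      exact hU ⟨h, matched_of_ne_zero (Ne.symm hne)⟩
  · rw [hrow, hcol, ← diagonal_one, diagonal_sub, diagonal_sub]
    congr 1
    funext g
    by_cases hC : Critical p g
    · rw [if_pos hC, if_neg (hC.not_lower), if_neg (hC.not_upper), sub_zero, sub_zero]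
    · rw [if_neg hC]
      by_cases hL : Lower p g
      · rw [if_pos hL, if_neg (Lower.not_upper hD hL)]; norm_num
      · rw [if_neg hL, if_pos ((lower_or_upper hD hC).resolve_left hL)]; norm_num

end MatchingMatrix

end LinkDiagram

namespace BigradedBasis

theorem matrixMap_add {M N : BigradedBasis} [Fintype M.gen] [Finite N.gen]
    (q q' : Matrix M.gen N.gen ℤ) (i j : ℤ) :
    matrixMap (q + q') i j = matrixMap q i j + matrixMap q' i j := by
  refine LinearMap.ext fun x => freePart.injective (Finsupp.ext fun h => ?_)
  rw [LinearMap.add_apply, map_add, Finsupp.add_apply, freePart_matrixMap, freePart_matrixMap,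
    freePart_matrixMap, ← Finset.sum_add_distrib]
  exact Finset.sum_congr rfl fun g _ => by rw [Matrix.add_apply, mul_add]

end BigradedBasis

namespace LinkDiagram

variable {D : LinkDiagram}

theorem leeComplex_eq (D : LinkDiagram) :
    D.leeComplex = D.khovanovModule.withMatrix D.leeMatrix := by
  have h0 : D.leeMatrix = Matrix.of (D.cubeCoeff khMul khComul) +
      Matrix.of (D.cubeCoeff leeMul leeComul) := by
    ext g h
    exact leeMatrix_apply g h
  have h : D.leeComplex.d = (D.khovanovModule.withMatrix D.leeMatrix).d := by
    funext i
    rw [h0]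
    exact (BigradedBasis.matrixMap_add _ _ i (i + 1)).symm
  exact congrArg (FilteredDiffModule.mk D.khovanovModule.toFilteredModule) h

/-! ### The critical generators -/

/-- The state with the other smoothing at all crossings of its leaf. -/
noncomputable def flipLeaf (s : D.KauffmanState) : D.KauffmanState :=
  fun c => if D.leaf s c = none then !s c else s c

theorem leaf_flipLeaf (s : D.KauffmanState) : D.leaf (flipLeaf s) = D.leaf s :=
  leaf_eq_of_hasState fun c b hb => by
    rw [flipLeaf, if_neg (by rw [hb]; simp)]
    exact hasState_leaf s c b hb

theorem flipLeaf_flipLeaf (s : D.KauffmanState) : flipLeaf (flipLeaf s) = s := by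
  funext c
  rw [flipLeaf, leaf_flipLeaf, flipLeaf]
  split_ifs
  · exact Bool.not_not _
  · rfl

theorem isConn_flipLeaf (hD : D.Connected) {s : D.KauffmanState}
    (h : ∀ c, D.leaf s c = none → s c = cutBit (D.leaf s) c) :
    Nat.card (D.Circles (flipLeaf s)) = 1 := by
  have hs := hasState_leaf (flipLeaf s)
  rw [leaf_flipLeaf] at hs
  refine isConn_ofState (isTerminal_leaf hD s) hs fun c hc => ?_
  rw [flipLeaf, if_pos hc, h c hc]

theorem flipLeaf_eq_cutBit (hD : D.Connected) (S : D.K₁) {c : Fin D.n}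
    (hc : D.leaf (flipLeaf S.1) c = none) :
    flipLeaf S.1 c = cutBit (D.leaf (flipLeaf S.1)) c := by
  rw [leaf_flipLeaf] at hc ⊢
  rw [flipLeaf, if_pos hc,
    eq_not_cutBit (isTerminal_leaf hD S.1) (hasState_leaf S.1) S.2 c hc, Bool.not_not]

theorem r_flipLeaf {s : D.KauffmanState}
    (h : ∀ c, D.leaf s c = none → s c = cutBit (D.leaf s) c) :
    D.r s = D.r (flipLeaf s) + ∑ c with D.leaf s c = none, labelDeg (cutBit (D.leaf s) c) := by
  rw [r, r, Finset.card_filter, Finset.card_filter, Finset.sum_filter]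
  push_cast
  rw [← Finset.sum_add_distrib]
  refine Finset.sum_congr rfl fun c _ => ?_
  by_cases hc : D.leaf s c = none
  · rw [if_pos hc, flipLeaf, if_pos hc, ← h c hc]
    cases s c <;> simp [labelDeg]
  · rw [if_neg hc, flipLeaf, if_neg hc, add_zero]

theorem sum_labelDeg_of_critical (hD : D.Connected) {p : D.Point} {g : D.khovanovModule.gen}
    (H : Critical p g) : ∑ γ, labelDeg (g.2 γ) = labelDeg (g.2 (D.circleOf g.1 p)) +
      ∑ c with D.leaf g.1 c = none, labelDeg (cutBit (D.leaf g.1) c) := by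
  rw [← (bijective_circles (p := p) (isTerminal_leaf hD g.1) (hasState_leaf g.1)
    fun c hc => (H c hc).1).sum_comp fun γ => labelDeg (g.2 γ), Fintype.sum_option]
  congr 1
  rw [Finset.sum_subtype (p := fun c => D.leaf g.1 c = none) _ fun c => by simp]
  exact Finset.sum_congr rfl fun c _ => congrArg labelDeg (H c.1 c.2).2

/-- A critical generator is given by its leaf and the label of the circle through `p`. -/
noncomputable def criticalMap (hD : D.Connected) (p : D.Point)
    (g : {g : D.khovanovModule.gen // Critical p g}) : Σ _ : D.K₁, Bool :=
  ⟨⟨flipLeaf g.1.1, isConn_flipLeaf hD fun c hc => (g.2 c hc).1⟩, g.1.2 (D.circleOf g.1.1 p)⟩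

theorem criticalMap_injective (hD : D.Connected) (p : D.Point) :
    Function.Injective (criticalMap hD p) := by
  rintro ⟨g, hg⟩ ⟨h, hh⟩ hgh
  have h1 : flipLeaf g.1 = flipLeaf h.1 := congrArg (fun x => x.1.1) hgh
  have h2 : g.2 (D.circleOf g.1 p) = h.2 (D.circleOf h.1 p) := congrArg (fun x => x.2) hgh
  replace h1 : g.1 = h.1 := by rw [← flipLeaf_flipLeaf g.1, h1, flipLeaf_flipLeaf]
  obtain ⟨s, ℓ, rfl⟩ : ∃ t ℓ, g = mkGen t ℓ := ⟨g.1, g.2, rfl⟩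
  obtain ⟨t, ℓ', rfl⟩ : ∃ t ℓ, h = mkGen t ℓ := ⟨h.1, h.2, rfl⟩
  change s = t at h1
  subst h1
  refine Subtype.ext (congrArg (mkGen s) (funext fun γ => ?_))
  obtain ⟨x, rfl⟩ := (bijective_circles (p := p) (isTerminal_leaf hD s) (hasState_leaf s)
    fun c hc => (hg c hc).1).2 γ
  cases x with
  | none => exact h2
  | some c => exact (hg c.1 c.2).2.trans (hh c.1 c.2).2.symm

theorem criticalMap_surjective (hD : D.Connected) (p : D.Point) :
    Function.Surjective (criticalMap hD p) := by
  rintro ⟨S, b⟩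
  obtain ⟨s, hs⟩ : ∃ s, s = flipLeaf S.1 := ⟨_, rfl⟩
  have hcut : ∀ c, D.leaf s c = none → s c = cutBit (D.leaf s) c := fun c hc => by
    subst hs; exact flipLeaf_eq_cutBit hD S hc
  let E := Equiv.ofBijective _
    (bijective_circles (p := p) (isTerminal_leaf hD s) (hasState_leaf s) hcut)
  let ℓ : D.Circles s → Bool := fun γ => (E.symm γ).elim b fun c => cutBit (D.leaf s) c.1
  have hp : ℓ (D.circleOf s p) = b := by
    change (E.symm (E none)).elim _ _ = _
    rw [E.symm_apply_apply]
    rfl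
  have hC : Critical p (mkGen s ℓ) := by
    intro c hc
    refine ⟨hcut c hc, ?_⟩
    change (E.symm (E (some ⟨c, hc⟩))).elim _ _ = _
    rw [E.symm_apply_apply]
    rfl
  refine ⟨⟨mkGen s ℓ, hC⟩, ?_⟩
  have h1 : (criticalMap hD p ⟨mkGen s ℓ, hC⟩).1 = S :=
    Subtype.ext ((congrArg flipLeaf hs).trans (flipLeaf_flipLeaf S.1))
  have h2 : (criticalMap hD p ⟨mkGen s ℓ, hC⟩).2 = b := hp
  exact Sigma.ext h1 (heq_of_eq h2)

theorem nonempty_iso_spanningTreeModule (hD : D.Connected) (p : D.Point)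
    (o : ∀ S : D.K₁, D.Orientation (D.leaf S.1)) :
    Nonempty (FilteredModule.Iso (D.khovanovModule.restrict (Critical p)).toFilteredModule
      (D.spanningTreeModule o).toFilteredModule) := by
  let E : (D.khovanovModule.restrict (Critical p)).gen ≃ (D.spanningTreeModule o).gen :=
    Equiv.ofBijective (criticalMap hD p)
      ⟨criticalMap_injective hD p, criticalMap_surjective hD p⟩
  have hw : ∀ g : {g : D.khovanovModule.gen // Critical p g},
      (o (criticalMap hD p g).1).w =
        ∑ c with D.leaf g.1.1 c = none, labelDeg (cutBit (D.leaf g.1.1) c) := fun g => by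
    rw [Orientation.w_eq _ (isTerminal_leaf hD _)]
    change ∑ c with D.leaf (flipLeaf g.1.1) c = none,
      labelDeg (cutBit (D.leaf (flipLeaf g.1.1)) c) = _
    rw [leaf_flipLeaf]
  have hr : ∀ g : {g : D.khovanovModule.gen // Critical p g},
      D.r g.1.1 = D.r (criticalMap hD p g).1.1 + (o (criticalMap hD p g).1).w := fun g => by
    rw [hw]
    exact r_flipLeaf fun c hc => (g.2 c hc).1
  refine BigradedBasis.nonempty_iso_of_equiv E (fun g => ?_) fun g => ?_
  · change 0 + (o (criticalMap hD p g).1).w + D.r (criticalMap hD p g).1.1 = D.r g.1.1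
    rw [hr g]
    ring
  · change labelDeg (g.1.2 (D.circleOf g.1.1 p)) + 2 * (o (criticalMap hD p g).1).w +
      D.r (criticalMap hD p g).1.1 = ∑ γ, labelDeg (g.1.2 γ) + D.r g.1.1
    rw [sum_labelDeg_of_critical hD g.2, hr g, hw g]
    ring

end LinkDiagram

theorem mainTheorem9 (D : LinkDiagram) (hD : D.Connected)
    (o : ∀ S : D.K₁, D.Orientation (D.leaf S.1)) :
    D.leeComplex.IsFilteredComplex ∧
      ∃ A B : FilteredDiffModule,
        A.IsFilteredComplex ∧ B.IsFilteredComplex ∧ B.Contractible ∧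
        Nonempty (FilteredModule.Iso A.toFilteredModule
          (D.spanningTreeModule o).toFilteredModule) ∧
        Nonempty (FilteredDiffModule.Iso D.leeComplex (A.directSum B)) := by
  obtain ⟨p⟩ := (LinkDiagram.isConn_iff.1 hD).1
  rw [D.leeComplex_eq]
  refine ⟨BigradedBasis.isFilteredComplex_withMatrix _ D.hasDeg_leeMatrix D.leeMatrix_mul_self, ?_⟩
  obtain ⟨A, B, hA, hB, hB', hAM, hiso⟩ := LinkDiagram.exists_decomposition hD p
  refine ⟨A, B, hA, hB, hB', ?_, hiso⟩
  rw [hAM]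
  exact LinkDiagram.nonempty_iso_spanningTreeModule hD p o
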